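/- All multigraphs are finite and loopless. A $k$-forest decomposition ($k$-FD) of a multigraph $G$ is a coloring of its edges with $k$ colors such that every color class is a forest; it has diameter at most $D$ if every tree of every color class has diameter at most $D$. The arboricity $a(G)$ is the least $k$ for which a $k$-FD exists. In the LOCAL model, the vertices run the same program in synchronized rounds, in each round every vertex exchanges messages of arbitrary size along its incident edges (which it distinguishes by port numbers), and local computation and private random bits are unrestricted in amount. The vertices have distinct identifiers of $O(\log n)$ bits, i.e. identifiers in $\{0,\dots,n^{d}-1\}$ for a fixed $d$. Each vertex knows $\varepsilon$, $k$ and upper bounds $n, a, \Delta$ on the number of vertices, the arboricity and the maximum degree (counted with multiplicity) of $G$. In the input $k$-FD, both endpoints of an edge know its color; in the output, both endpoints of each edge must agree on its color. Fix $d, c\in\mathbb N$. The constants below depend only on $d$ and $c$. 1. There are a constant $C>0$ and a randomized LOCAL algorithm such that, for all $\varepsilon\in(0,\tfrac12)$ and all $n,a,\Delta,k$, the algorithm runs for at most $C\,\frac{\log n}{\varepsilon}$ rounds and, on every multigraph $G$ with at most $n$ vertices, arboricity at most $a$ and maximum degree at most $\Delta$, and for every $k$-FD of $G$ given as input, it outputs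 with probability at least $1-n^{-c}$ a $(k+\lceil \varepsilon a\rceil)$-FD of $G$ of diameter at most $C\,\frac{\log n}{\varepsilon}$. 2. There are constants $K, C>0$ and a randomized LOCAL algorithm such that, for all $\varepsilon\in(0,\tfrac12)$ and all $n,a,\Delta,k$ with $a\ge K\min\bigl\{\frac{\log n}{\varepsilon},\frac{\log\Delta}{\varepsilon^2}\bigr\}$, the algorithm runs for at most $C\,\frac{\log n}{\varepsilon}$ rounds and, on every $G$ and every input $k$-FD as in part 1, it outputs with probability at least $1-n^{-c}$ a $(k+\lceil \varepsilon a\rceil)$-FD of $G$ of diameter at most $\frac{C}{\varepsilon}$. -/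

import Mathlib

/-! ## Forest decompositions of multigraphs

Multigraphs are Mathlib's `Graph V E`: edges are named objects, parallel edges are allowed. -/

namespace Graph

variable {V E : Type}

/-- The degree of `v` in a (loopless) multigraph: the number of edges at `v`, counted with
multiplicity. -/
noncomputable def multiDegree (G : Graph V E) (v : V) : ℕ := (G.incidenceSet v).ncard

/-- A multigraph is a forest if it has no cycle: no loop, no pair of parallel edges, and no cycle
of length at least three. -/
def IsForest (H : Graph V E) : Prop := H.Simple ∧ H.toSimpleGraph.IsAcyclic

/-- The subgraph of `G` formed by the edges of color `c`. -/
def colorClass (G : Graph V E) (φ : E → ℕ) (c : ℕ) : Graph V E := G.restrict {e | φ e = c}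

/-- `φ` is a `k`-forest decomposition of `G`: the edges are colored with `0, …, k - 1`, and each
color class is a forest. -/
def IsForestDecomposition (G : Graph V E) (k : ℕ) (φ : E → ℕ) : Prop :=
  (∀ e ∈ G.edgeSet, φ e < k) ∧ ∀ c, (G.colorClass φ c).IsForest

/-- The arboricity: the least `k` for which a `k`-forest decomposition exists. -/
noncomputable def arboricity (G : Graph V E) : ℕ :=
  sInf {k | ∃ φ : E → ℕ, G.IsForestDecomposition k φ}

/-- Every connected component of every color class has (strong) diameter at most `D`. -/
def DecompositionDiameterLE (G : Graph V E) (φ : E → ℕ) (D : ℝ) : Prop :=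
  ∀ (c : ℕ) (u v : (G.colorClass φ c).vertexSet),
    (G.colorClass φ c).toSimpleGraph.Reachable u v →
      ((G.colorClass φ c).toSimpleGraph.dist u v : ℝ) ≤ D

end Graph

/-! ## The LOCAL model -/

/-- A communication network: a loopless multigraph with vertex set `V`, distinct vertex identifiers,
and at each vertex `v` a numbering of the edges at `v` by the ports `0, …, deg v - 1`.
(The values of `port v` on edges that are not at `v` are irrelevant.) -/
structure PortNetwork (V E : Type) where
  graph : Graph V E
  vertexSet_eq : graph.vertexSet = Set.univ
  loopless : graph.Loopless
  id : V → ℕ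
  id_injective : Function.Injective id
  port : V → E → ℕ
  port_injOn : ∀ v, Set.InjOn (port v) (graph.incidenceSet v)
  port_lt : ∀ v, ∀ e ∈ graph.incidenceSet v, port v e < graph.multiDegree v

namespace PortNetwork

variable {V E : Type}

open Classical in
/-- The edge at port `p` of `v`, if there is one. -/
noncomputable def edgeAt (N : PortNetwork V E) (v : V) (p : ℕ) : Option E :=
  if h : ∃ e, N.graph.Inc e v ∧ N.port v e = p then some h.choose else none

open Classical in
/-- The endpoint other than `v` of an edge `e` at `v` (and `v` itself if `e` is not at `v`). -/
noncomputable def neighbor (N : PortNetwork V E) (v : V) (e : E) : V :=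
  if h : N.graph.Inc e v then h.other else v

end PortNetwork

/-- What a vertex knows at the start: its identifier, its degree, the input color of the edge at
each of its ports, and its private random bits. -/
structure LocalInput (b : ℕ) where
  id : ℕ
  degree : ℕ
  color : ℕ → Option ℕ
  bits : Fin b → Bool

/-- A randomized algorithm in the LOCAL model. All vertices run the same program for `rounds`
synchronous rounds. In each round a vertex sends one message, of arbitrary size, through each of its
ports, and computes its new state from its old state and the messages that arrive at its ports.
In the end it outputs a color for the edge at each of its ports. Local computation is unrestricted.
Every vertex has `bits` private random bits. -/
structure LocalAlgorithm where
  State : Type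
  Message : Type
  bits : ℕ
  rounds : ℕ
  init : LocalInput bits → State
  send : State → ℕ → Message
  step : State → (ℕ → Option Message) → State
  output : State → ℕ → ℕ

namespace LocalAlgorithm

variable {V E : Type}

/-- The state of each vertex after `t` rounds, on the network `N` with input edge coloring `φ` and
random bits `ω`. -/
noncomputable def state (A : LocalAlgorithm) (N : PortNetwork V E) (φ : E → ℕ)
    (ω : V → Fin A.bits → Bool) : ℕ → V → A.State
  | 0 => fun v => A.init
      { id := N.id v
        degree := N.graph.multiDegree v
        color := fun p => (N.edgeAt v p).map φ
        bits := ω v }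
  | t + 1 => fun v => A.step (A.state N φ ω t v) (fun p => (N.edgeAt v p).map (fun e =>
      A.send (A.state N φ ω t (N.neighbor v e)) (N.port (N.neighbor v e) e)))

/-- The run with random bits `ω` ends with the edge coloring `ψ`; in particular, the two endpoints
of each edge agree on its color. -/
def Outputs (A : LocalAlgorithm) (N : PortNetwork V E) (φ : E → ℕ) (ω : V → Fin A.bits → Bool)
    (ψ : E → ℕ) : Prop :=
  ∀ v e, N.graph.Inc e v → A.output (A.state N φ ω A.rounds v) (N.port v e) = ψ e

/-- The probability, over independent uniform random bits at all vertices, that the output is a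
`k`-forest decomposition of diameter at most `D`. -/
noncomputable def successProbability (A : LocalAlgorithm) (N : PortNetwork V E) (φ : E → ℕ)
    (k : ℕ) (D : ℝ) : ℝ :=
  (Nat.card {ω : V → Fin A.bits → Bool // ∃ ψ : E → ℕ, A.Outputs N φ ω ψ ∧
      N.graph.IsForestDecomposition k ψ ∧ N.graph.DecompositionDiameterLE ψ D} : ℝ) /
    (Nat.card (V → Fin A.bits → Bool) : ℝ)

/-- On every finite network with at most `n` vertices, arboricity at most `a`, maximum degree at
most `Δ` and identifiers below `n ^ d` (that is, of `O(log n)` bits), and for every `k`-forest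
decomposition given as input, `A` outputs with probability at least `1 - 1 / n ^ c` a
`k'`-forest decomposition of diameter at most `D`. -/
def ConvertsForestDecompositions (A : LocalAlgorithm) (n a Δ k d c k' : ℕ) (D : ℝ) : Prop :=
  ∀ (V E : Type) [Finite V] [Finite E] (N : PortNetwork V E) (φ : E → ℕ),
    Nat.card V ≤ n → N.graph.arboricity ≤ a → (∀ v, N.graph.multiDegree v ≤ Δ) →
    (∀ v, N.id v < n ^ d) → N.graph.IsForestDecomposition k φ →
    1 - 1 / (n : ℝ) ^ c ≤ A.successProbability N φ k' D

end LocalAlgorithm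

/-! Both algorithms destroy long paths of the input forests by removing only O(εa) edges per vertex
from their classes, and then color the removed edges by O(εa) new star forests. The recoloring rests
on `forestClass_chargeColor` and `chargeColor_lt`. Suppose that every edge is charged to at most one
endpoint and every vertex is charged at most T edges. Numbering the charged edges at each vertex
splits them into T graphs of out-degree at most one. Color reduction in the style of Cole and
Vishkin colors each of them properly with 8 colors, and sorting the edges by the color of their head
yields 8T star forests.

Logarithmic diameter. Repeatedly peeling off the vertices of degree at most 4a lets every vertex own
at most 4a edges (`ncard_owns_le`). An owned edge is cut with probability at least 1/(4M), where M
is of order 1/ε, by a rule for which the cut edges already form about εa/2 star forests. A path with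
order log n/ε edges contains half as many disjoint edges, whose survivals are independent, and a
forest has at most n paths starting at a given vertex; so a long path rarely survives
(`prob_far_le`). The number of colors is not bounded in terms of n, which rules out a union bound
over all classes. Instead, edges that still lie in large components are recolored too, and Markov's
inequality shows that each vertex owns few of them (`prob_residual_le`). If 1/ε ≥ n, the input
already has small diameter.

Diameter O(1/ε). After the first stage with ε/4 the trees can be rooted within O(log n/ε) rounds.
Their depth levels are divided into blocks of R levels, with R of order 1/ε, and for each color the
vertex at the top of a block chooses at random the level at which its descendants in the block are
cut from their parents. Every descending path of 2R edges crosses a whole block and is therefore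
cut. A vertex loses at most K/R edges on average, K being the number of colors, and it is
overloaded, that is, loses more than t of them (t about εa/64), with probability at most exp(-t/4).
By the lower bound on a this is at most a high inverse power of D, a bound for the size of balls of
radius O(R): D is n or a power of Δ + 1, according to which term attains the minimum. Hence choices
without overload exist by the local lemma (`exists_not_overloaded`), and with high probability
overloaded vertices form clusters of diameter O(log n) (`prob_not_diamLE_le`). Each cluster agrees
on a locally computed choice without overload. Vertices follow the random choice unless they are
overloaded, and near a cluster they additionally follow its agreed choice. So at most 2t edges per
vertex are cut (`ncard_selected_le`), and no long descending path escapes (`exists_selected`). When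
k ≥ 32a, a star coloring that ignores the input suffices. -/

/-! ### Ports, neighbors and color classes -/

namespace PortNetwork

variable {V E : Type} (N : PortNetwork V E)

theorem edgeAt_eq_some {v : V} {p : ℕ} {e : E} :
    N.edgeAt v p = some e ↔ N.graph.Inc e v ∧ N.port v e = p := by
  unfold edgeAt
  constructor
  · intro h
    split_ifs at h with h1
    rw [Option.some.injEq] at h
    exact h ▸ h1.choose_spec
  · rintro ⟨h1, h2⟩
    have h3 : ∃ e, N.graph.Inc e v ∧ N.port v e = p := ⟨e, h1, h2⟩
    rw [dif_pos h3, Option.some.injEq]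
    exact N.port_injOn v h3.choose_spec.1 h1 (h3.choose_spec.2.trans h2.symm)

theorem edgeAt_port {v : V} {e : E} (h : N.graph.Inc e v) : N.edgeAt v (N.port v e) = some e :=
  N.edgeAt_eq_some.2 ⟨h, rfl⟩

theorem isLink_neighbor {v : V} {e : E} (h : N.graph.Inc e v) :
    N.graph.IsLink e v (N.neighbor v e) := by
  unfold neighbor
  rw [dif_pos h]
  exact h.isLink_other

theorem neighbor_eq {v w : V} {e : E} (h : N.graph.IsLink e v w) : N.neighbor v e = w :=
  (N.isLink_neighbor h.inc_left).right_unique h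

theorem neighbor_neighbor {v : V} {e : E} (h : N.graph.Inc e v) :
    N.neighbor (N.neighbor v e) e = v :=
  N.neighbor_eq (N.isLink_neighbor h).symm

theorem inc_neighbor {v : V} {e : E} (h : N.graph.Inc e v) : N.graph.Inc e (N.neighbor v e) :=
  (N.isLink_neighbor h).inc_right

theorem ne_of_isLink {v w : V} {e : E} (h : N.graph.IsLink e v w) : v ≠ w := by
  have := N.loopless
  exact h.ne

/-- The simple graph of the edges of color `c`. -/
def colorGraph {α : Type} (ψ : E → α) (c : α) : SimpleGraph V where
  Adj v w := ∃ e, N.graph.IsLink e v w ∧ ψ e = c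
  symm := ⟨fun _ _ ⟨e, h, hc⟩ => ⟨e, h.symm, hc⟩⟩
  loopless := ⟨fun _ ⟨_, h, _⟩ => N.ne_of_isLink h rfl⟩

theorem colorGraph_adj {α : Type} {ψ : E → α} {c : α} {v w : V} :
    (N.colorGraph ψ c).Adj v w ↔ ∃ e, N.graph.IsLink e v w ∧ ψ e = c := Iff.rfl

/-- The underlying simple graph. -/
def baseGraph : SimpleGraph V := N.colorGraph (fun _ => ()) ()

theorem colorGraph_le_baseGraph {α : Type} (ψ : E → α) (c : α) :
    N.colorGraph ψ c ≤ N.baseGraph :=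
  fun _ _ ⟨e, h, _⟩ => ⟨e, h, rfl⟩

end PortNetwork

/-! ### Closed balls -/

namespace SimpleGraph

variable {V : Type*} (H : SimpleGraph V)

/-- The closed ball of radius `i` around `v`. -/
def closedBall (i : ℕ) (v : V) : Set V := {y | ∃ p : H.Walk v y, p.length ≤ i}

variable {H}

theorem mem_closedBall_self (i : ℕ) (v : V) : v ∈ H.closedBall i v := ⟨.nil, Nat.zero_le _⟩

theorem closedBall_zero (v : V) : H.closedBall 0 v = {v} := by
  ext y
  constructor
  · rintro ⟨p, hp⟩
    exact (SimpleGraph.Walk.eq_of_length_eq_zero (Nat.le_zero.1 hp)).symm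
  · rintro rfl
    exact mem_closedBall_self 0 _

theorem closedBall_mono {i j : ℕ} (h : i ≤ j) (v : V) : H.closedBall i v ⊆ H.closedBall j v :=
  fun _ ⟨p, hp⟩ => ⟨p, hp.trans h⟩

theorem closedBall_mono_graph {H' : SimpleGraph V} (h : H ≤ H') (i : ℕ) (v : V) :
    H.closedBall i v ⊆ H'.closedBall i v :=
  fun _ ⟨p, hp⟩ => ⟨p.mapLe h, by simpa using hp⟩

theorem mem_closedBall_succ {i : ℕ} {v y : V} :
    y ∈ H.closedBall (i + 1) v ↔ y = v ∨ ∃ w, H.Adj v w ∧ y ∈ H.closedBall i w := by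
  constructor
  · rintro ⟨p, hp⟩
    cases p with
    | nil => exact Or.inl rfl
    | cons h p => exact Or.inr ⟨_, h, p, by simpa using hp⟩
  · rintro (rfl | ⟨w, h, p, hp⟩)
    · exact mem_closedBall_self _ _
    · exact ⟨.cons h p, by simpa using hp⟩

theorem mem_closedBall_comm {i : ℕ} {v y : V} :
    y ∈ H.closedBall i v ↔ v ∈ H.closedBall i y :=
  ⟨fun ⟨p, hp⟩ => ⟨p.reverse, by simpa using hp⟩, fun ⟨p, hp⟩ => ⟨p.reverse, by simpa using hp⟩⟩

theorem mem_closedBall_trans {i j : ℕ} {x y z : V} (h : y ∈ H.closedBall i x)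
    (h' : z ∈ H.closedBall j y) : z ∈ H.closedBall (i + j) x := by
  obtain ⟨p, hp⟩ := h
  obtain ⟨q, hq⟩ := h'
  exact ⟨p.append q, by rw [Walk.length_append]; omega⟩

end SimpleGraph

/-! ### Local functions -/

/-- An instance: a finite network with an input edge coloring and a label at each vertex. -/
structure Inst (Ω : Type) where
  V : Type
  E : Type
  finV : Finite V
  finE : Finite E
  N : PortNetwork V E
  φ : E → ℕ
  ω : V → Ω

attribute [instance] Inst.finV Inst.finE

/-- All that a vertex can learn in a number of rounds. -/
inductive View (Ω : Type) : Type
  | init (id degree : ℕ) (color : ℕ → Option ℕ) (ω : Ω) : View Ω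
  | step (s : View Ω) (m : ℕ → Option (View Ω × ℕ)) : View Ω

namespace Inst

variable {Ω : Type}

/-- The view of a vertex after `r` rounds. -/
noncomputable def view (I : Inst Ω) : ℕ → I.V → View Ω
  | 0 => fun v => .init (I.N.id v) (I.N.graph.multiDegree v)
      (fun p => (I.N.edgeAt v p).map I.φ) (I.ω v)
  | r + 1 => fun v => .step (I.view r v) (fun p => (I.N.edgeAt v p).map
      (fun e => (I.view r (I.N.neighbor v e), I.N.port (I.N.neighbor v e) e)))

end Inst

variable {Ω α β γ : Type}

/-- `F` can be computed in `r` rounds. -/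
def VertexLocal (r : ℕ) (F : (I : Inst Ω) → I.V → α) : Prop :=
  ∃ g : View Ω → α, ∀ I v, F I v = g (I.view r v)

/-- `F`, a function of edges together with one of their endpoints, can be computed by that endpoint
in `r` rounds. -/
def DartLocal (r : ℕ) (F : (I : Inst Ω) → I.V → I.E → α) : Prop :=
  ∃ g : View Ω → ℕ → α, ∀ I v e, I.N.graph.Inc e v → F I v e = g (I.view r v) (I.N.port v e)

/-- Both endpoints of each edge can compute the value of `ψ` in `r` rounds. -/
def EdgeLocal (r : ℕ) (ψ : (I : Inst Ω) → I.E → α) : Prop :=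
  DartLocal r (fun I _ e => ψ I e)

namespace VertexLocal

variable {r : ℕ} {F : (I : Inst Ω) → I.V → α} {G : (I : Inst Ω) → I.V → β}

/-- A view contains the preceding view of the same vertex. The `.init` branch is only there to make
the function total. -/
theorem succ (h : VertexLocal r F) : VertexLocal (r + 1) F := by
  obtain ⟨g, hg⟩ := h
  refine ⟨fun s => match s with
    | .init a b c d => g (.init a b c d)
    | .step s _ => g s, fun I v => ?_⟩
  rw [hg]
  rfl

theorem mono {r' : ℕ} (h : VertexLocal r F) (hr : r ≤ r') : VertexLocal r' F := by
  induction hr with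
  | refl => exact h
  | step _ ih => exact ih.succ

theorem const (a : α) : VertexLocal r (fun (_ : Inst Ω) _ => a) := ⟨fun _ => a, fun _ _ => rfl⟩

theorem map (h : VertexLocal r F) (f : α → β) : VertexLocal r (fun I v => f (F I v)) := by
  obtain ⟨g, hg⟩ := h
  exact ⟨fun s => f (g s), fun I v => by simp only [hg]⟩

theorem map₂ (h : VertexLocal r F) (h' : VertexLocal r G) (f : α → β → γ) :
    VertexLocal r (fun I v => f (F I v) (G I v)) := by
  obtain ⟨g, hg⟩ := h
  obtain ⟨g', hg'⟩ := h'
  exact ⟨fun s => f (g s) (g' s), fun I v => by simp only [hg, hg']⟩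

theorem pi {ι : Type} {F : ι → (I : Inst Ω) → I.V → α} (h : ∀ i, VertexLocal r (F i)) :
    VertexLocal r (fun I v i => F i I v) := by
  choose g hg using h
  exact ⟨fun s i => g i s, fun I v => funext fun i => hg i I v⟩

theorem id : VertexLocal r (fun (I : Inst Ω) v => I.N.id v) :=
  VertexLocal.mono (r := 0) ⟨fun s => match s with
    | .init a _ _ _ => a
    | .step _ _ => 0, fun _ _ => rfl⟩ (Nat.zero_le _)

theorem label [Inhabited Ω] : VertexLocal r (fun (I : Inst Ω) v => I.ω v) :=
  VertexLocal.mono (r := 0) ⟨fun s => match s with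
    | .init _ _ _ y => y
    | .step _ _ => default, fun _ _ => rfl⟩ (Nat.zero_le _)

theorem edgeAt_isSome : VertexLocal r (fun (I : Inst Ω) v p => (I.N.edgeAt v p).isSome) :=
  VertexLocal.mono (r := 0) ⟨fun s => match s with
    | .init _ _ f _ => fun p => (f p).isSome
    | .step _ _ => fun _ => false, fun I v => by simp [Inst.view]⟩ (Nat.zero_le _)

end VertexLocal

namespace DartLocal

variable {r : ℕ} {F : (I : Inst Ω) → I.V → I.E → α} {G : (I : Inst Ω) → I.V → I.E → β}

theorem succ (h : DartLocal r F) : DartLocal (r + 1) F := by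
  obtain ⟨g, hg⟩ := h
  refine ⟨fun s => match s with
    | .init a b c d => g (.init a b c d)
    | .step s _ => g s, fun I v e he => ?_⟩
  rw [hg I v e he]
  rfl

theorem mono {r' : ℕ} (h : DartLocal r F) (hr : r ≤ r') : DartLocal r' F := by
  induction hr with
  | refl => exact h
  | step _ ih => exact ih.succ

theorem map (h : DartLocal r F) (f : α → β) : DartLocal r (fun I v e => f (F I v e)) := by
  obtain ⟨g, hg⟩ := h
  exact ⟨fun s p => f (g s p), fun I v e he => by simp only [hg I v e he]⟩

theorem map₂ (h : DartLocal r F) (h' : DartLocal r G) (f : α → β → γ) :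
    DartLocal r (fun I v e => f (F I v e) (G I v e)) := by
  obtain ⟨g, hg⟩ := h
  obtain ⟨g', hg'⟩ := h'
  exact ⟨fun s p => f (g s p) (g' s p), fun I v e he => by simp only [hg I v e he, hg' I v e he]⟩

theorem congr {F' : (I : Inst Ω) → I.V → I.E → α} (h : DartLocal r F)
    (hF : ∀ I v e, I.N.graph.Inc e v → F' I v e = F I v e) : DartLocal r F' := by
  obtain ⟨g, hg⟩ := h
  exact ⟨g, fun I v e he => by rw [hF I v e he, hg I v e he]⟩

theorem ofVertex {F : (I : Inst Ω) → I.V → α} (h : VertexLocal r F) :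
    DartLocal r (fun I v _ => F I v) := by
  obtain ⟨g, hg⟩ := h
  exact ⟨fun s _ => g s, fun I v e _ => hg I v⟩

theorem port : DartLocal r (fun (I : Inst Ω) v e => I.N.port v e) :=
  ⟨fun _ p => p, fun _ _ _ _ => rfl⟩

/-- The value at the other endpoint is known one round later. -/
theorem swap (h : DartLocal r F) : DartLocal (r + 1) (fun I v e => F I (I.N.neighbor v e) e) := by
  classical
  obtain ⟨g, hg⟩ := h
  -- A default value is needed for views that never occur; if `α` is empty, so is everything to be
  -- proved.
  by_cases hα : Nonempty α
  · obtain ⟨a⟩ := hα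
    refine ⟨fun s p => match s with
      | .init _ _ _ _ => a
      | .step _ m => ((m p).map (fun x => g x.1 x.2)).getD a, fun I v e he => ?_⟩
    simp only [hg I _ e (I.N.inc_neighbor he)]
    simp [Inst.view, I.N.edgeAt_port he]
  · exact ⟨fun s p => (hα ⟨g s p⟩).elim, fun I v e _ => (hα ⟨F I v e⟩).elim⟩

/-- A vertex knows the values at its ports. -/
theorem atPorts (h : DartLocal r F) :
    VertexLocal r (fun I v p => (I.N.edgeAt v p).map (F I v)) := by
  obtain ⟨g, hg⟩ := h
  refine ((VertexLocal.edgeAt_isSome (Ω := Ω) (r := r)).map₂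
    (⟨fun s => g s, fun _ _ => rfl⟩ : VertexLocal r (fun I v => g (I.view r v)))
    (fun o f p => if o p then some (f p) else none)).mono le_rfl |> fun h => ?_
  convert h using 4 with I v p
  cases hp : I.N.edgeAt v p with
  | none => simp
  | some e =>
    obtain ⟨h1, rfl⟩ := I.N.edgeAt_eq_some.1 hp
    simp [hg I v e h1]

theorem input : EdgeLocal r (fun (I : Inst Ω) e => I.φ e) :=
  DartLocal.mono (r := 0) ⟨fun s p => match s with
    | .init _ _ f _ => (f p).getD 0
    | .step _ _ => 0, fun I v e he => by simp [Inst.view, I.N.edgeAt_port he]⟩ (Nat.zero_le _)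

/-- The set of values at a vertex. -/
theorem image (h : DartLocal r F) :
    VertexLocal r (fun I v => {x | ∃ e, I.N.graph.Inc e v ∧ F I v e = x}) := by
  convert h.atPorts.map (fun f => {x | ∃ p, f p = some x}) using 3 with I v
  ext x
  simp only [Set.mem_ofPred_eq, Option.map_eq_some_iff, I.N.edgeAt_eq_some]
  constructor
  · rintro ⟨e, he, hx⟩
    exact ⟨_, e, ⟨he, rfl⟩, hx⟩
  · rintro ⟨p, e, ⟨he, _⟩, hx⟩
    exact ⟨e, he, hx⟩

/-- A vertex can count the edges with a property. -/
theorem ncard {P : (I : Inst Ω) → I.V → I.E → Prop} (h : DartLocal r P) :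
    VertexLocal r (fun I v => {e | I.N.graph.Inc e v ∧ P I v e}.ncard) := by
  convert h.atPorts.map (fun f => {p | f p = some True}.ncard) using 3 with I v
  -- The program sees ports rather than edges; ports at one vertex are distinct, so the counts
  -- agree.
  rw [← Set.InjOn.ncard_image (f := I.N.port v) (s := {e | I.N.graph.Inc e v ∧ P I v e})
    (fun e he e' he' => I.N.port_injOn v he.1 he'.1)]
  congr 1
  ext p
  simp only [Set.mem_image, Set.mem_ofPred_eq, Option.map_eq_some_iff, I.N.edgeAt_eq_some, eq_iff_iff,
    iff_true]
  constructor
  · rintro ⟨e, ⟨h1, h2⟩, h3⟩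
    exact ⟨e, ⟨h1, h3⟩, h2⟩
  · rintro ⟨e, ⟨h1, h3⟩, h2⟩
    exact ⟨e, ⟨h1, h2⟩, h3⟩

end DartLocal

namespace DartLocal

variable {r : ℕ} {F : (I : Inst Ω) → I.V → I.E → α}

theorem sUnion {F : (I : Inst Ω) → I.V → I.E → Set α} (h : DartLocal r F) :
    VertexLocal r (fun I v => {x | ∃ e, I.N.graph.Inc e v ∧ x ∈ F I v e}) := by
  convert h.image.map (fun S => ⋃₀ S) using 3 with I v
  ext x
  simp [Set.mem_sUnion]

/-- Both endpoints can compute a value that one endpoint can compute. -/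
theorem edgeLocal_of_symm {ψ : (I : Inst Ω) → I.E → β} (h : DartLocal r F) (f : α → α → β)
    (hf : ∀ I v e, I.N.graph.Inc e v → ψ I e = f (F I v e) (F I (I.N.neighbor v e) e)) :
    EdgeLocal (r + 1) ψ :=
  (h.succ.map₂ h.swap f).congr hf

end DartLocal

namespace VertexLocal

variable {r : ℕ}

/-- The values on a ball of a locally known color class. -/
theorem image_closedBall {F : (I : Inst Ω) → I.V → α} {ψ : (I : Inst Ω) → I.E → β}
    (hF : VertexLocal r F) (hψ : EdgeLocal r ψ) (i : ℕ) :
    VertexLocal (r + i) (fun I v c => F I '' (I.N.colorGraph (ψ I) c).closedBall i v) := by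
  induction i with
  | zero =>
    change VertexLocal r _
    convert hF.map (fun x (_ : β) => ({x} : Set α)) using 4 with I v c
    rw [SimpleGraph.closedBall_zero, Set.image_singleton]
  | succ i ih =>
    have h1 := ((DartLocal.ofVertex ih).swap.map₂ (hψ.mono (by omega : r ≤ r + i + 1))
      (fun f c => ({x | x.2 ∈ f c ∧ x.1 = c} : Set (β × α)))).sUnion
    have h2 := h1.map₂ (hF.mono (by omega : r ≤ r + i + 1))
      (fun S x (c : β) => insert x {y | (c, y) ∈ S})
    change VertexLocal (r + i + 1) _
    convert h2 using 4 with I v c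
    ext y
    simp only [Set.mem_image, SimpleGraph.mem_closedBall_succ, Set.mem_insert_iff,
      Set.mem_ofPred_eq, PortNetwork.colorGraph_adj]
    constructor
    · rintro ⟨z, rfl | ⟨w, ⟨e, he, hc⟩, hz⟩, rfl⟩
      · exact Or.inl rfl
      · refine Or.inr ⟨e, he.inc_left, ⟨z, ?_, rfl⟩, hc.symm⟩
        rwa [I.N.neighbor_eq he, hc]
    · rintro (rfl | ⟨e, he, ⟨z, hz, rfl⟩, rfl⟩)
      · exact ⟨v, Or.inl rfl, rfl⟩
      · exact ⟨z, Or.inr ⟨_, ⟨e, I.N.isLink_neighbor he, rfl⟩, hz⟩, rfl⟩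

theorem image_baseBall {F : (I : Inst Ω) → I.V → α} (hF : VertexLocal r F) (i : ℕ) :
    VertexLocal (r + i) (fun I v => F I '' I.N.baseGraph.closedBall i v) :=
  (hF.image_closedBall (ψ := fun _ _ => ()) ⟨fun _ _ => (), fun _ _ _ _ => rfl⟩ i).map
    (fun f => f ())

/-- If a vertex knows the identifier of a nearby vertex, it also learns what that vertex knows. -/
theorem lookup {F : (I : Inst Ω) → I.V → α} {A : (I : Inst Ω) → I.V → I.V} {i : ℕ}
    (hF : VertexLocal r F) (hA : VertexLocal (r + i) (fun I v => I.N.id (A I v)))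
    (hi : ∀ I v, A I v ∈ I.N.baseGraph.closedBall i v) :
    VertexLocal (r + i) (fun I v => F I (A I v)) := by
  classical
  by_cases hα : Nonempty α
  · obtain ⟨a⟩ := hα
    -- Values travel together with identifiers. Identifiers are distinct, so the pair with the
    -- desired identifier is unique.
    have h1 := ((VertexLocal.id (Ω := Ω) (r := r)).map₂ hF Prod.mk).image_baseBall i
    convert h1.map₂ hA (fun S j => if h : ∃ x, (j, x) ∈ S then h.choose else a) using 3 with I v
    have h : ∃ x, (I.N.id (A I v), x) ∈ (fun v => (I.N.id v, F I v)) ''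
      I.N.baseGraph.closedBall i v := ⟨F I (A I v), A I v, hi I v, rfl⟩
    rw [dif_pos h]
    obtain ⟨z, _, hz⟩ := h.choose_spec
    rw [Prod.mk.injEq] at hz
    rw [← hz.2, I.N.id_injective hz.1]
  · obtain ⟨g, _⟩ := hF
    exact ⟨fun s => (hα ⟨g s⟩).elim, fun I v => (hα ⟨F I v⟩).elim⟩

end VertexLocal

/-! ### From local functions to algorithms -/

/-- The bad labelings have probability at most `1 / n ^ c`. -/
def RareFailure (n c : ℕ) {W : Type} (Bad : W → Prop) : Prop :=
  (Nat.card {ω // Bad ω} : ℝ) ≤ 1 / (n : ℝ) ^ c * Nat.card W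

namespace LocalAlgorithm

/-- The algorithm that computes a local edge coloring. -/
noncomputable def ofView {b : ℕ} (τ : (Fin b → Bool) → Ω) (r : ℕ) (g : View Ω → ℕ → ℕ) :
    LocalAlgorithm where
  State := View Ω
  Message := View Ω × ℕ
  bits := b
  rounds := r
  init x := .init x.id x.degree x.color (τ x.bits)
  send s p := (s, p)
  step s m := .step s m
  output := g

theorem state_ofView {b : ℕ} (τ : (Fin b → Bool) → Ω) (r : ℕ) (g : View Ω → ℕ → ℕ)
    {V E : Type} [hV : Finite V] [hE : Finite E] (N : PortNetwork V E) (φ : E → ℕ)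
    (ω : V → Fin b → Bool) (t : ℕ) (v : V) :
    (ofView τ r g).state N φ ω t v = (⟨V, E, hV, hE, N, φ, τ ∘ ω⟩ : Inst Ω).view t v := by
  induction t generalizing v with
  | zero => rfl
  | succ t ih =>
    have : (ofView τ r g).state N φ ω t = (⟨V, E, hV, hE, N, φ, τ ∘ ω⟩ : Inst Ω).view t :=
      funext ih
    simp only [LocalAlgorithm.state, this, Inst.view]
    rfl

/-- The requirement on an output coloring. -/
def GoodOutput (I : Inst Ω) (ψ : I.E → ℕ) (k' : ℕ) (D : ℝ) : Prop :=
  I.N.graph.IsForestDecomposition k' ψ ∧ I.N.graph.DecompositionDiameterLE ψ D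

/-- A local edge coloring that rarely fails gives an algorithm. -/
theorem exists_of_edgeLocal [Finite Ω] {b r : ℕ} (hΩ : Nat.card Ω = 2 ^ b)
    {out : (I : Inst Ω) → I.E → ℕ} (hout : EdgeLocal r out) (n a Δ k d c k' : ℕ) (D : ℝ)
    (h : ∀ (V E : Type) [hV : Finite V] [hE : Finite E] (N : PortNetwork V E) (φ : E → ℕ),
      Nat.card V ≤ n → N.graph.arboricity ≤ a → (∀ v, N.graph.multiDegree v ≤ Δ) →
      (∀ v, N.id v < n ^ d) → N.graph.IsForestDecomposition k φ →
      RareFailure n c (fun ω : V → Ω => ¬ GoodOutput ⟨V, E, hV, hE, N, φ, ω⟩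
        (out ⟨V, E, hV, hE, N, φ, ω⟩) k' D)) :
    ∃ A : LocalAlgorithm, A.rounds = r ∧ A.ConvertsForestDecompositions n a Δ k d c k' D := by
  classical
  have := Fintype.ofFinite Ω
  -- A bijection between bit strings and labels carries uniform bits to uniform labels; this is why
  -- the number of labels must be a power of two.
  obtain ⟨τ⟩ : Nonempty ((Fin b → Bool) ≃ Ω) := by
    refine ⟨Fintype.equivOfCardEq ?_⟩
    rw [← Nat.card_eq_fintype_card (α := Ω), hΩ]
    simp
  obtain ⟨g, hg⟩ := hout
  refine ⟨ofView τ r g, rfl, fun V E hV hE N φ h1 h2 h3 h4 h5 => ?_⟩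
  have hb := h V E N φ h1 h2 h3 h4 h5
  have : Finite (V → Fin b → Bool) := inferInstance
  let T : (V → Fin b → Bool) ≃ (V → Ω) := Equiv.arrowCongr (Equiv.refl V) τ
  have hT : ∀ ω, T ω = τ ∘ ω := fun ω => rfl
  let S : (V → Fin b → Bool) → Prop := fun ω => ∃ ψ : E → ℕ, (ofView τ r g).Outputs N φ ω ψ ∧
      N.graph.IsForestDecomposition k' ψ ∧ N.graph.DecompositionDiameterLE ψ D
  have hsub : ∀ ω, ¬ S ω → ¬ GoodOutput ⟨V, E, hV, hE, N, φ, T ω⟩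
      (out ⟨V, E, hV, hE, N, φ, T ω⟩) k' D := by
    intro ω hω hgood
    refine hω ⟨_, fun v e he => ?_, hgood⟩
    rw [state_ofView]
    exact (hg ⟨V, E, hV, hE, N, φ, T ω⟩ v e he).symm
  have hcard : Nat.card {ω // ¬ S ω} ≤ Nat.card {ω : V → Ω // ¬ GoodOutput ⟨V, E, hV, hE, N, φ, ω⟩
      (out ⟨V, E, hV, hE, N, φ, ω⟩) k' D} :=
    Nat.card_le_card_of_injective (fun ω => ⟨T ω.1, hsub _ ω.2⟩) (fun x y hxy => by
      have := congrArg Subtype.val hxy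
      exact Subtype.ext (T.injective this))
  have hsum : Nat.card {ω // S ω} + Nat.card {ω // ¬ S ω} = Nat.card (V → Fin b → Bool) := by
    have := Fintype.ofFinite (V → Fin b → Bool)
    rw [Nat.card_eq_fintype_card, Nat.card_eq_fintype_card, Nat.card_eq_fintype_card]
    exact (Fintype.card_subtype_compl S ▸ Nat.add_sub_cancel' (Fintype.card_subtype_le S))
  have hpos : (0 : ℝ) < Nat.card (V → Fin b → Bool) := by
    exact_mod_cast Nat.card_pos
  have heq : Nat.card (V → Ω) = Nat.card (V → Fin b → Bool) := (Nat.card_congr T).symm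
  unfold RareFailure at hb
  rw [heq] at hb
  change _ ≤ (Nat.card {ω // S ω} : ℝ) / (Nat.card (V → Fin b → Bool) : ℝ)
  rw [le_div_iff₀ hpos]
  have h6 : (Nat.card {ω // S ω} : ℝ) + Nat.card {ω // ¬ S ω} = Nat.card (V → Fin b → Bool) := by
    exact_mod_cast hsum
  have h7 : (Nat.card {ω // ¬ S ω} : ℝ) ≤ _ := (Nat.cast_le.2 hcard).trans hb
  linarith

end LocalAlgorithm

/-! ### Diameter, forests and stars -/

namespace SimpleGraph

variable {V : Type*}

/-- Reachable vertices are at distance at most `D`. -/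
def DiamLE (H : SimpleGraph V) (D : ℕ) : Prop :=
  ∀ u v, H.Reachable u v → v ∈ H.closedBall D u

theorem DiamLE.mono {H : SimpleGraph V} {D D' : ℕ} (h : H.DiamLE D) (hD : D ≤ D') :
    H.DiamLE D' :=
  fun u v huv => closedBall_mono hD u (h u v huv)

/-- If every vertex is close to its representative, and adjacent vertices have the same
representative, then the diameter is small. -/
theorem diamLE_of_representative {H : SimpleGraph V} {D : ℕ} (z : V → V)
    (hz : ∀ v, z v ∈ H.closedBall D v) (hadj : ∀ v w, H.Adj v w → z v = z w) :
    H.DiamLE (D + D) := by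
  rintro u v ⟨p⟩
  have h : z u = z v := by
    induction p with
    | nil => rfl
    | cons h _ ih => exact (hadj _ _ h).trans ih
  exact mem_closedBall_trans (hz u) (h ▸ mem_closedBall_comm.1 (hz v))

/-- A maximal acyclic extension inside the complete graph is a spanning tree, which has one edge
fewer than vertices. -/
theorem IsAcyclic.ncard_edgeSet_le [Finite V] {H : SimpleGraph V} (h : H.IsAcyclic) :
    H.edgeSet.ncard ≤ Nat.card V := by
  classical
  have := Fintype.ofFinite V
  by_cases hV : Nonempty V
  · obtain ⟨T, hT, hmax⟩ := exists_maximal_isAcyclic_of_le_isAcyclic (G := ⊤) le_top h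
    have hT' : T.IsTree := (connected_top.maximal_le_isAcyclic_iff_isTree le_top).1 hmax
    have h1 := hT'.card_edgeFinset
    have h2 : H.edgeSet.ncard ≤ T.edgeSet.ncard :=
      Set.ncard_le_ncard (edgeSet_mono hT) (Set.toFinite _)
    rw [← coe_edgeFinset T, Set.ncard_coe_finset] at h2
    rw [Nat.card_eq_fintype_card]
    omega
  · have := not_nonempty_iff.1 hV
    have : H.edgeSet = ∅ := by
      ext e
      induction e with
      | h x y => exact isEmptyElim x
    simp [this]

end SimpleGraph

namespace PortNetwork

variable {V E : Type} (N : PortNetwork V E)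

/-- The edges of color `c` form a forest. -/
def ForestClass (ψ : E → α) (c : α) : Prop :=
  (∀ e f v w, N.graph.IsLink e v w → N.graph.IsLink f v w → ψ e = c → ψ f = c → e = f) ∧
    (N.colorGraph ψ c).IsAcyclic

variable {N}

/-- The color classes as simple graphs. -/
def colorClassIso (ψ : E → ℕ) (c : ℕ) :
    (N.graph.colorClass ψ c).toSimpleGraph ≃g N.colorGraph ψ c where
  toEquiv := Equiv.subtypeUnivEquiv (fun v => by
    change v ∈ N.graph.vertexSet
    rw [N.vertexSet_eq]
    trivial)
  map_rel_iff' := by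
    rintro ⟨v, hv⟩ ⟨w, hw⟩
    rw [Graph.toSimpleGraph_adj]
    constructor
    · rintro ⟨e, h, hc⟩
      exact ⟨fun h' => N.ne_of_isLink h (congrArg Subtype.val h'), e, hc, h⟩
    · rintro ⟨_, e, hc, h⟩
      exact ⟨e, h, hc⟩

theorem forestClass_iff {ψ : E → ℕ} {c : ℕ} :
    N.ForestClass ψ c ↔ (N.graph.colorClass ψ c).IsForest := by
  unfold Graph.IsForest ForestClass
  rw [(colorClassIso ψ c).isAcyclic_iff]
  refine and_congr_left fun _ => ?_
  constructor
  · intro h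
    have : (N.graph.colorClass ψ c).Loopless :=
      ⟨fun e x h => N.ne_of_isLink (show N.graph.IsLink e x x from h.2) rfl⟩
    exact ⟨fun e f x y he hf => h e f x y he.2 hf.2 he.1 hf.1⟩
  · intro h e f v w he hf hec hfc
    exact h.eq_of_isLink (show (N.graph.colorClass ψ c).IsLink e v w from ⟨hec, he⟩)
      (show (N.graph.colorClass ψ c).IsLink f v w from ⟨hfc, hf⟩)

theorem decompositionDiameterLE_of_diamLE {ψ : E → ℕ} {D : ℕ} {D' : ℝ}
    (h : ∀ c, (N.colorGraph ψ c).DiamLE D) (hD : (D : ℝ) ≤ D') :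
    N.graph.DecompositionDiameterLE ψ D' := by
  intro c u v huv
  obtain ⟨p, hp⟩ := h c _ _ (huv.map (colorClassIso ψ c).toHom)
  have h1 := SimpleGraph.dist_le (p.map (colorClassIso ψ c).symm.toHom)
  rw [SimpleGraph.Walk.length_map] at h1
  have h2 : (N.graph.colorClass ψ c).toSimpleGraph.dist u v ≤ D := by
    refine le_trans ?_ (h1.trans hp)
    have hu : (colorClassIso ψ c).symm.toHom ((colorClassIso ψ c).toHom u) = u :=
      (colorClassIso ψ c).symm_apply_apply u
    have hv : (colorClassIso ψ c).symm.toHom ((colorClassIso ψ c).toHom v) = v :=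
      (colorClassIso ψ c).symm_apply_apply v
    rw [hu, hv]
  exact (Nat.cast_le.2 h2).trans hD

theorem ForestClass.anti {ψ : E → α} {ψ' : E → β} {c : α} {c' : β} (h : N.ForestClass ψ c)
    (hψ : ∀ e ∈ N.graph.edgeSet, ψ' e = c' → ψ e = c) : N.ForestClass ψ' c' :=
  ⟨fun e f v w he hf hec hfc => h.1 e f v w he hf (hψ e he.edge_mem hec) (hψ f hf.edge_mem hfc),
    h.2.anti (show N.colorGraph ψ' c' ≤ N.colorGraph ψ c from
      fun _ _ ⟨e, he, hec⟩ => ⟨e, he, hψ e he.edge_mem hec⟩)⟩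

/-- If each edge of a class has exactly one endpoint marked as a leaf, and leaves have only one
edge, then the class consists of stars. -/
theorem forestClass_of_stars {ψ : E → α} {c : α} (leaf : V → Prop)
    (h₁ : ∀ e v w, N.graph.IsLink e v w → ψ e = c → (leaf v ↔ ¬ leaf w))
    (h₂ : ∀ v e f, leaf v → N.graph.Inc e v → N.graph.Inc f v → ψ e = c → ψ f = c → e = f) :
    N.ForestClass ψ c ∧ (N.colorGraph ψ c).DiamLE 2 := by
  classical
  have huniq : ∀ v w w', leaf v → (N.colorGraph ψ c).Adj v w → (N.colorGraph ψ c).Adj v w' →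
      w = w' := by
    rintro v w w' hv ⟨e, he, hec⟩ ⟨f, hf, hfc⟩
    obtain rfl := h₂ v e f hv he.inc_left hf.inc_left hec hfc
    exact he.right_unique hf
  refine ⟨⟨?_, ?_⟩, ?_⟩
  · intro e f v w he hf hec hfc
    by_cases hv : leaf v
    · exact h₂ v e f hv he.inc_left hf.inc_left hec hfc
    · exact h₂ w e f (by_contra fun hw => hv ((h₁ e v w he hec).2 hw)) he.inc_right hf.inc_right
        hec hfc
  -- Once its only edge is deleted, a leaf is isolated; hence every edge is a bridge.
  · have key : ∀ v w, leaf v → (N.colorGraph ψ c).Adj v w →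
        ¬ ((N.colorGraph ψ c).deleteEdges {s(v, w)}).Reachable v w := by
      rintro v w hv hvw ⟨p⟩
      cases p with
      | nil => exact hvw.ne rfl
      | cons h p =>
        rw [SimpleGraph.deleteEdges_adj] at h
        obtain rfl := huniq _ _ _ hv hvw h.1
        exact h.2 rfl
    rw [SimpleGraph.isAcyclic_iff_forall_adj_isBridge]
    intro v w hvw
    rw [SimpleGraph.isBridge_iff]
    by_cases hv : leaf v
    · exact key v w hv hvw
    · obtain ⟨e, he, hec⟩ := _root_.id hvw
      have hw : leaf w := by_contra fun hw => hv ((h₁ e v w he hec).2 hw)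
      intro h
      exact key w v hw hvw.symm (by rw [Sym2.eq_swap]; exact h.symm)
  -- The representative is the center of the star: a leaf points to its neighbor, every other vertex
  -- to itself.
  · let z : V → V := fun v => if h : leaf v ∧ ∃ w, (N.colorGraph ψ c).Adj v w then h.2.choose else v
    refine SimpleGraph.diamLE_of_representative (D := 1) z ?_ ?_
    · intro v
      by_cases h : leaf v ∧ ∃ w, (N.colorGraph ψ c).Adj v w
      · have : z v = h.2.choose := dif_pos h
        rw [this]
        exact ⟨h.2.choose_spec.toWalk, le_rfl⟩
      · have : z v = v := dif_neg h
        rw [this]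
        exact SimpleGraph.mem_closedBall_self _ _
    · have key : ∀ v w, leaf v → (N.colorGraph ψ c).Adj v w → z v = z w := by
        intro v w hv hvw
        have h : leaf v ∧ ∃ w, (N.colorGraph ψ c).Adj v w := ⟨hv, w, hvw⟩
        have h3 : z v = h.2.choose := dif_pos h
        obtain ⟨e, he, hec⟩ := _root_.id hvw
        have h4 : z w = w := dif_neg fun h' => (h₁ e v w he hec).1 hv h'.1
        rw [h3, h4]
        exact huniq v _ _ hv h.2.choose_spec hvw
      intro v w hvw
      by_cases hv : leaf v
      · exact key v w hv hvw
      · obtain ⟨e, he, hec⟩ := _root_.id hvw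
        have hw : leaf w := by_contra fun hw => hv ((h₁ e v w he hec).2 hw)
        exact (key w v hw hvw.symm).symm

/-- A forest class has fewer edges than vertices on each vertex set. -/
theorem ForestClass.ncard_le [Finite V] [Finite E] {ψ : E → α} {c : α} (h : N.ForestClass ψ c)
    (W : Set V) :
    {e | ψ e = c ∧ ∃ v w, v ∈ W ∧ w ∈ W ∧ N.graph.IsLink e v w}.ncard ≤ W.ncard := by
  classical
  have h1 := (h.2.induce W).ncard_edgeSet_le
  rw [Nat.card_coe_set_eq] at h1
  refine le_trans ?_ h1
  rw [← Nat.card_coe_set_eq, ← Nat.card_coe_set_eq]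
  choose v w hv hw hl using
    fun e : {e | ψ e = c ∧ ∃ v w, v ∈ W ∧ w ∈ W ∧ N.graph.IsLink e v w} => e.2.2
  refine Nat.card_le_card_of_injective
    (fun e => ⟨s(⟨v e, hv e⟩, ⟨w e, hw e⟩), ⟨e.1, hl e, e.2.1⟩⟩) fun e f hef => ?_
  have hef' := congrArg Subtype.val hef
  simp only [Sym2.eq_iff, Subtype.mk.injEq] at hef'
  refine Subtype.ext ?_
  rcases hef' with ⟨h2, h3⟩ | ⟨h2, h3⟩
  · exact h.1 e f (v e) (w e) (hl e) (by rw [h2, h3]; exact hl f) e.2.1 f.2.1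
  · exact h.1 e f (v e) (w e) (hl e) (by rw [h2, h3]; exact (hl f).symm) e.2.1 f.2.1

end PortNetwork

/-! ### Arboricity and edge density -/

namespace PortNetwork

variable {V E : Type} {N : PortNetwork V E}

/-- The given decomposition makes the set under the infimum nonempty, so the infimum is attained
rather than a default 0. -/
theorem exists_forestDecomposition_of_arboricity_le {a k : ℕ} {φ : E → ℕ}
    (ha : N.graph.arboricity ≤ a) (hφ : N.graph.IsForestDecomposition k φ) :
    ∃ ψ : E → ℕ, N.graph.IsForestDecomposition a ψ := by
  obtain ⟨ψ, h1, h2⟩ := Nat.sInf_mem (s := {k | ∃ φ : E → ℕ, N.graph.IsForestDecomposition k φ})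
    ⟨k, φ, hφ⟩
  exact ⟨ψ, fun e he => (h1 e he).trans_le ha, h2⟩

theorem ncard_edges_within_le [Finite V] [Finite E] {a : ℕ} {ψ : E → ℕ}
    (h : N.graph.IsForestDecomposition a ψ) (W : Set V) :
    {e | ∃ v w, v ∈ W ∧ w ∈ W ∧ N.graph.IsLink e v w}.ncard ≤ a * W.ncard := by
  classical
  have := Fintype.ofFinite E
  set S := {e | ∃ v w, v ∈ W ∧ w ∈ W ∧ N.graph.IsLink e v w}
  rw [Set.ncard_eq_toFinset_card' S, Finset.card_eq_sum_card_fiberwise (f := ψ)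
    (t := Finset.range a)]
  · refine (Finset.sum_le_card_nsmul _ _ W.ncard fun c _ => ?_).trans (by simp)
    refine le_trans (le_of_eq ?_) ((forestClass_iff.2 (h.2 c)).ncard_le W)
    rw [Set.ncard_eq_toFinset_card']
    congr 1
    ext e
    simp [S, and_comm]
  · intro e he
    obtain ⟨v, w, _, _, hl⟩ := Set.mem_toFinset.1 he
    exact Finset.mem_coe.2 (Finset.mem_range.2 (h.1 e hl.edge_mem))

/-- At most half of the vertices of `W` have large degree within `W`. -/
theorem two_mul_ncard_large_degree_le [Finite V] [Finite E] {a : ℕ} {ψ : E → ℕ}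
    (h : N.graph.IsForestDecomposition a ψ) (W : Set V) :
    2 * {v | v ∈ W ∧ 4 * a < {e | N.graph.Inc e v ∧ N.neighbor v e ∈ W}.ncard}.ncard
      ≤ W.ncard := by
  classical
  have := Fintype.ofFinite E
  have := Fintype.ofFinite V
  set S := {e | ∃ v w, v ∈ W ∧ w ∈ W ∧ N.graph.IsLink e v w} with hS
  have h1 := ncard_edges_within_le h W
  set X := {v | v ∈ W ∧ 4 * a < {e | N.graph.Inc e v ∧ N.neighbor v e ∈ W}.ncard} with hX
  have h2 := Finset.sum_card_bipartiteAbove_eq_sum_card_bipartiteBelow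
    (s := X.toFinset) (t := S.toFinset) (fun v e => N.graph.Inc e v)
  -- Double counting: every vertex of `X` meets at least 4a + 1 edges inside `W`, each such edge has
  -- only two endpoints, and `W` spans at most a|W| edges.
  have h3 : (4 * a + 1) * X.ncard ≤
      ∑ v ∈ X.toFinset, (S.toFinset.bipartiteAbove (fun v e => N.graph.Inc e v) v).card := by
    refine le_trans (le_of_eq (by rw [Set.ncard_eq_toFinset_card', mul_comm, smul_eq_mul]))
      (Finset.card_nsmul_le_sum _ _ (4 * a + 1) fun v hv => ?_)
    obtain ⟨hv1, hv2⟩ := Set.mem_toFinset.1 hv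
    refine hv2.trans_le (le_of_eq ?_)
    rw [Set.ncard_eq_toFinset_card']
    congr 1
    ext e
    simp only [Set.mem_toFinset, Set.mem_ofPred_eq, Finset.mem_bipartiteAbove, hS]
    constructor
    · rintro ⟨he, hw⟩
      exact ⟨⟨v, _, hv1, hw, N.isLink_neighbor he⟩, he⟩
    · rintro ⟨⟨x, y, hx, hy, hl⟩, he⟩
      refine ⟨he, ?_⟩
      rcases (N.isLink_neighbor he).right_eq_or_eq hl with h | h <;> rw [h] <;> assumption
  have h4 : ∑ e ∈ S.toFinset, (X.toFinset.bipartiteBelow (fun v e => N.graph.Inc e v) e).card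
      ≤ S.ncard * 2 := by
    refine (Finset.sum_le_card_nsmul _ _ 2 fun e he => ?_).trans_eq
      (by rw [Set.ncard_eq_toFinset_card', smul_eq_mul])
    obtain ⟨x, y, hx, hy, hl⟩ := Set.mem_toFinset.1 he
    refine (Finset.card_le_card (t := {x, y}) fun v hv => ?_).trans Finset.card_le_two
    rw [Finset.mem_bipartiteBelow] at hv
    simpa using hv.2.eq_or_eq_of_isLink hl
  have h5 : (4 * a + 1) * X.ncard ≤ 2 * (a * W.ncard) := by
    calc _ ≤ _ := h3
      _ = _ := h2
      _ ≤ _ := h4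
      _ ≤ 2 * (a * W.ncard) := by
        have : S.ncard ≤ a * W.ncard := h1
        omega
  have h6 : X.ncard ≤ W.ncard := Set.ncard_le_ncard (fun v hv => hv.1) (Set.toFinite _)
  rcases Nat.eq_zero_or_pos a with rfl | ha
  · simp only [mul_zero, zero_add, one_mul, zero_mul] at h5
    omega
  · by_contra hcon
    push Not at hcon
    have : 2 * (a * W.ncard) < 2 * (a * (2 * X.ncard)) := by
      have := Nat.mul_lt_mul_of_pos_left hcon ha
      omega
    nlinarith

end PortNetwork

/-! ### Peeling off vertices of small degree -/

namespace PortNetwork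

variable {V E : Type} (N : PortNetwork V E)

/-- The vertices that remain after `i` rounds of removing the vertices of degree at most `t`. -/
def Active (N : PortNetwork V E) (t : ℕ) : ℕ → V → Prop
  | 0 => fun _ => True
  | i + 1 => fun v => N.Active t i v ∧
      t < {e | N.graph.Inc e v ∧ N.Active t i (N.neighbor v e)}.ncard

theorem active_local (t i : ℕ) : VertexLocal i (fun (I : Inst Ω) v => I.N.Active t i v) := by
  induction i with
  | zero => exact VertexLocal.const True
  | succ i ih =>
    exact ih.succ.map₂ ((DartLocal.ofVertex ih).swap.ncard) (fun p q => p ∧ t < q)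

theorem active_anti {t i j : ℕ} (h : i ≤ j) {v : V} (hv : N.Active t j v) : N.Active t i v := by
  induction h with
  | refl => exact hv
  | step _ ih => exact ih hv.1

/-- By `two_mul_ncard_large_degree_le`, each round removes at least half of the remaining vertices.
-/
theorem ncard_active_le [Finite V] [Finite E] {a : ℕ} {ψ : E → ℕ}
    (h : N.graph.IsForestDecomposition a ψ) (i : ℕ) :
    2 ^ i * {v | N.Active (4 * a) i v}.ncard ≤ Nat.card V := by
  induction i with
  | zero =>
    rw [pow_zero, one_mul]
    exact Set.ncard_le_card _
  | succ i ih =>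
    refine le_trans ?_ ih
    rw [pow_succ, mul_assoc]
    exact Nat.mul_le_mul_left _
      (PortNetwork.two_mul_ncard_large_degree_le h {v | N.Active (4 * a) i v})

/-- The number of the round in which a vertex is removed, cut off at `m`. -/
noncomputable def layer (t m : ℕ) (v : V) : ℕ := sInf {i | ¬ (i < m ∧ N.Active t i v)}

theorem layer_local (t m : ℕ) : VertexLocal m (fun (I : Inst Ω) v => I.N.layer t m v) := by
  have h : ∀ i, VertexLocal m (fun (I : Inst Ω) v => i < m ∧ I.N.Active t i v) := by
    intro i
    by_cases hi : i < m
    · exact ((active_local t i).mono hi.le).map (fun p => i < m ∧ p)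
    · convert VertexLocal.const (Ω := Ω) (r := m) False using 3
      simp [hi]
  exact (VertexLocal.pi h).map (fun f => sInf {i | ¬ f i})

/-- Each edge is owned by the endpoint that is removed first; ties are broken by identifiers. -/
def Owns (t m : ℕ) (v : V) (e : E) : Prop :=
  N.layer t m v < N.layer t m (N.neighbor v e) ∨
    N.layer t m v = N.layer t m (N.neighbor v e) ∧ N.id v < N.id (N.neighbor v e)

theorem owns_local (t m : ℕ) : DartLocal (m + 1) (fun (I : Inst Ω) v e => I.N.Owns t m v e) := by
  have h := DartLocal.ofVertex ((layer_local (Ω := Ω) t m).map₂ VertexLocal.id Prod.mk)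
  exact h.succ.map₂ h.swap (fun x y => x.1 < y.1 ∨ x.1 = y.1 ∧ x.2 < y.2)

theorem owns_neighbor_iff {t m : ℕ} {v : V} {e : E} (he : N.graph.Inc e v) :
    N.Owns t m (N.neighbor v e) e ↔ ¬ N.Owns t m v e := by
  unfold Owns
  rw [N.neighbor_neighbor he]
  have : N.id v ≠ N.id (N.neighbor v e) :=
    fun h => N.ne_of_isLink (N.isLink_neighbor he) (N.id_injective h)
  omega

/-- After log₂ n + 1 rounds nobody is active, so the cutoff in `layer` has no effect. Just before
its removal a vertex has at most 4a edges to active vertices, and all edges that it owns are among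
them, since their other ends are removed no earlier. -/
theorem ncard_owns_le [Finite V] [Finite E] {n a k : ℕ} {φ : E → ℕ} (hn : Nat.card V ≤ n)
    (ha : N.graph.arboricity ≤ a) (hφ : N.graph.IsForestDecomposition k φ) (v : V) :
    {e | N.graph.Inc e v ∧ N.Owns (4 * a) (Nat.log 2 n + 1) v e}.ncard ≤ 4 * a := by
  obtain ⟨ψ, hψ⟩ := PortNetwork.exists_forestDecomposition_of_arboricity_le ha hφ
  set m := Nat.log 2 n + 1
  set t := 4 * a
  have hm : ∀ w, ¬ N.Active t m w := by
    intro w hw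
    have h1 := N.ncard_active_le hψ m
    have h2 : 0 < {v | N.Active t m v}.ncard := (Set.ncard_pos (Set.toFinite _)).2 ⟨w, hw⟩
    have h3 : n < 2 ^ m := Nat.lt_pow_succ_log_self (by norm_num) n
    nlinarith
  have hne : ∀ w, ¬ (N.layer t m w < m ∧ N.Active t (N.layer t m w) w) := fun w =>
    Nat.sInf_mem (s := {i | ¬ (i < m ∧ N.Active t i w)}) ⟨m, fun h => h.1.false⟩
  have hlt : ∀ w i, i < N.layer t m w → i < m ∧ N.Active t i w := fun w i hi =>
    not_not.1 (Nat.notMem_of_lt_sInf hi)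
  have hv : ¬ N.Active t (N.layer t m v) v := by
    intro h
    refine hne v ⟨?_, h⟩
    by_contra hge
    exact hm v (N.active_anti (not_lt.1 hge) h)
  obtain ⟨j, hj⟩ : ∃ j, N.layer t m v = j + 1 := by
    refine Nat.exists_eq_succ_of_ne_zero fun h0 => hv ?_
    rw [h0]
    trivial
  have hjv := (hlt v j (by omega)).2
  rw [hj] at hv
  have hdeg : {e | N.graph.Inc e v ∧ N.Active t j (N.neighbor v e)}.ncard ≤ t :=
    not_lt.1 fun h => hv ⟨hjv, h⟩
  refine le_trans (Set.ncard_le_ncard ?_ (Set.toFinite _)) hdeg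
  rintro e ⟨he, h⟩
  refine ⟨he, (hlt _ j ?_).2⟩
  unfold Owns at h
  omega

end PortNetwork

/-! ### Color reduction along pointers -/

/-- One step of color reduction: the position of the lowest bit in which `x` differs from `y`,
and the value of that bit. -/
noncomputable def reduceColor (x y : ℕ) : ℕ :=
  2 * sInf {i | x.testBit i ≠ y.testBit i} + (x.testBit (sInf {i | x.testBit i ≠ y.testBit i})).toNat

theorem testBit_sInf_ne {x y : ℕ} (h : x ≠ y) :
    x.testBit (sInf {i | x.testBit i ≠ y.testBit i}) ≠
      y.testBit (sInf {i | x.testBit i ≠ y.testBit i}) :=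
  Nat.sInf_mem (s := {i | x.testBit i ≠ y.testBit i}) (by
    by_contra hcon
    refine h (Nat.eq_of_testBit_eq fun i => ?_)
    by_contra hi
    exact hcon ⟨i, hi⟩)

/-- Equal results would name the same position i and the same bit there, although i was chosen as a
position where `x` and `y` differ. The color `z` with which `y` is compared plays no role, so
adjacent vertices may recolor simultaneously. -/
theorem reduceColor_ne {x y : ℕ} (h : x ≠ y) (z : ℕ) : reduceColor x y ≠ reduceColor y z := by
  have h1 := testBit_sInf_ne h
  unfold reduceColor
  generalize sInf {i | x.testBit i ≠ y.testBit i} = i at *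
  generalize sInf {i | y.testBit i ≠ z.testBit i} = j at *
  intro h2
  have hx := Bool.toNat_lt (x.testBit i)
  have hy := Bool.toNat_lt (y.testBit j)
  obtain rfl : i = j := by omega
  refine h1 ?_
  cases hb : x.testBit i <;> cases hb' : y.testBit i <;> simp_all

theorem reduceColor_lt {x y m : ℕ} (hx : x < 2 ^ m) (hy : y < 2 ^ m) (hm : 0 < m) :
    reduceColor x y < 2 * m := by
  have h : sInf {i | x.testBit i ≠ y.testBit i} < m := by
    by_cases hxy : x = y
    · simpa [hxy] using hm
    · by_contra hge
      push Not at hge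
      refine testBit_sInf_ne hxy ?_
      have h2 := Nat.pow_le_pow_right (n := 2) (by norm_num) hge
      rw [Nat.testBit_lt_two_pow (hx.trans_le h2), Nat.testBit_lt_two_pow (hy.trans_le h2)]
  unfold reduceColor
  have := Bool.toNat_lt (x.testBit (sInf {i | x.testBit i ≠ y.testBit i}))
  omega

theorem two_mul_le_two_pow_pred {m : ℕ} (hm : 4 ≤ m) : 2 * m ≤ 2 ^ (m - 1) := by
  induction m, hm using Nat.le_induction with
  | base => norm_num
  | succ m hm ih =>
    have : 2 ^ (m + 1 - 1) = 2 * 2 ^ (m - 1) := by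
      rw [← pow_succ']
      congr 1
      omega
    omega

/-- One step of color reduction shortens colors of more than three bits. -/
theorem reduceColor_lt_pow {x y m : ℕ} (hm : 3 ≤ m) (hx : x < 2 ^ m) (hy : y < 2 ^ m) :
    reduceColor x y < 2 ^ (max 3 (m - 1)) := by
  have h := reduceColor_lt hx hy (by omega)
  rcases hm.eq_or_lt with rfl | hm
  · norm_num
    omega
  · rw [max_eq_right (by omega)]
    exact h.trans_le (two_mul_le_two_pow_pred hm)

namespace PortNetwork

variable {V E : Type} (N : PortNetwork V E) (Ch : V → E → Prop)

/-- The rank of an edge among the edges charged to `v`. -/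
noncomputable def slot (v : V) (e : E) : ℕ :=
  {e' | N.graph.Inc e' v ∧ Ch v e' ∧ N.port v e' < N.port v e}.ncard

variable {N Ch}

theorem slot_injOn [Finite E] {v : V} {e f : E} (he : N.graph.Inc e v) (hf : N.graph.Inc f v)
    (hce : Ch v e) (hcf : Ch v f) (h : N.slot Ch v e = N.slot Ch v f) : e = f := by
  have key : ∀ {e f : E}, N.graph.Inc e v → Ch v e → N.port v e < N.port v f →
      N.slot Ch v e < N.slot Ch v f := fun {e f} he hce hlt =>
    Set.ncard_lt_ncard ⟨fun x (hx : _ ∧ _ ∧ _) => ⟨hx.1, hx.2.1, hx.2.2.trans hlt⟩,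
      fun hsub => (hsub (show e ∈ {e' | _} from ⟨he, hce, hlt⟩)).2.2.false⟩ (Set.toFinite _)
  rcases lt_trichotomy (N.port v e) (N.port v f) with hlt | heq | hgt
  · exact absurd h (key he hce hlt).ne
  · exact N.port_injOn v he hf heq
  · exact absurd h (key hf hcf hgt).ne'

theorem slot_lt [Finite E] {v : V} {e : E} (he : N.graph.Inc e v) (hce : Ch v e) :
    N.slot Ch v e < {e | N.graph.Inc e v ∧ Ch v e}.ncard :=
  Set.ncard_lt_ncard ⟨fun _ (hx : _ ∧ _ ∧ _) => ⟨hx.1, hx.2.1⟩,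
    fun hsub => (hsub (show e ∈ {_e | _} from ⟨he, hce⟩)).2.2.false⟩ (Set.toFinite _)

theorem slot_local {r : ℕ} {Ch : (I : Inst Ω) → I.V → I.E → Prop}
    (h : DartLocal r Ch) : DartLocal r (fun I v e => I.N.slot (Ch I) v e) := by
  refine ((DartLocal.ofVertex h.atPorts).map₂ DartLocal.port
    (fun f p => {p' | f p' = some True ∧ p' < p}.ncard)).congr fun I v e he => ?_
  unfold slot
  rw [← Set.InjOn.ncard_image (f := I.N.port v)
    (fun e he e' he' => I.N.port_injOn v he.1 he'.1)]
  congr 1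
  ext p
  simp only [Set.mem_image, Set.mem_ofPred_eq, Option.map_eq_some_iff, I.N.edgeAt_eq_some,
    eq_iff_iff, iff_true]
  constructor
  · rintro ⟨e', ⟨h1, h2, h3⟩, h4⟩
    exact ⟨⟨e', ⟨h1, h4⟩, h2⟩, h4 ▸ h3⟩
  · rintro ⟨⟨e', ⟨h1, h4⟩, h2⟩, h3⟩
    exact ⟨e', ⟨h1, h2, h4 ▸ h3⟩, h4⟩

variable (N Ch)

/-- The color of a vertex in each slot after `i` steps of color reduction. -/
noncomputable def reduced (N : PortNetwork V E) (Ch : V → E → Prop) : ℕ → V → ℕ → ℕ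
  | 0 => fun v _ => N.id v
  | i + 1 => fun v s => reduceColor (N.reduced Ch i v s)
      (sSup {y | ∃ e, N.graph.Inc e v ∧ (Ch v e ∧ N.slot Ch v e = s) ∧
        N.reduced Ch i (N.neighbor v e) s = y})

variable {N Ch}

theorem reduced_local {r : ℕ} {Ch : (I : Inst Ω) → I.V → I.E → Prop} (h : DartLocal r Ch) (i : ℕ) :
    VertexLocal (r + i) (fun I v => I.N.reduced (Ch I) i v) := by
  induction i with
  | zero => exact VertexLocal.id.map (fun x _ => x)
  | succ i ih =>
    have h1 := (h.map₂ (slot_local h) Prod.mk).mono (by omega : r ≤ r + i + 1)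
    have h2 := (h1.map₂ (DartLocal.ofVertex ih).swap Prod.mk).image
    have h3 := (ih.mono (by omega : r + i ≤ r + i + 1)).map₂ h2
      (fun f S s => reduceColor (f s) (sSup {y | ∃ x ∈ S, (x.1.1 ∧ x.1.2 = s) ∧ x.2 s = y}))
    change VertexLocal (r + i + 1) _
    convert h3 using 4 with I v s
    simp [reduced]

/-- A vertex has at most one charged edge in each slot, so the supremum in `reduced` only reads the
color of its head. For an empty slot it supplies the default 0. -/
theorem reduced_succ_eq [Finite V] [Finite E] {v : V} {e : E} (he : N.graph.Inc e v) (hc : Ch v e)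
    (i : ℕ) :
    N.reduced Ch (i + 1) v (N.slot Ch v e) = reduceColor (N.reduced Ch i v (N.slot Ch v e))
      (N.reduced Ch i (N.neighbor v e) (N.slot Ch v e)) := by
  have : {y | ∃ e', N.graph.Inc e' v ∧ (Ch v e' ∧ N.slot Ch v e' = N.slot Ch v e) ∧
      N.reduced Ch i (N.neighbor v e') (N.slot Ch v e) = y} =
        {N.reduced Ch i (N.neighbor v e) (N.slot Ch v e)} := by
    ext y
    constructor
    · rintro ⟨e', h1, ⟨h2, h3⟩, h4⟩
      obtain rfl := slot_injOn h1 he h2 hc h3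
      exact h4.symm
    · rintro rfl
      exact ⟨e, he, ⟨hc, rfl⟩, rfl⟩
  simp only [reduced]
  rw [this, csSup_singleton]

theorem reduced_ne [Finite V] [Finite E] {v : V} {e : E} (he : N.graph.Inc e v) (hc : Ch v e) (i : ℕ) :
    N.reduced Ch i v (N.slot Ch v e) ≠ N.reduced Ch i (N.neighbor v e) (N.slot Ch v e) := by
  induction i with
  | zero =>
    intro h
    exact N.ne_of_isLink (N.isLink_neighbor he) (N.id_injective h)
  | succ i ih =>
    rw [reduced_succ_eq he hc]
    exact reduceColor_ne ih _

/-- Each step saves at least one bit until three are left. This slow rate suffices, because a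
logarithmic number of rounds is available anyway. -/
theorem reduced_lt [Finite V] [Finite E] {m : ℕ} (hid : ∀ v, N.id v < 2 ^ m) (i : ℕ) (v : V)
    (s : ℕ) :
    N.reduced Ch i v s < 2 ^ (max 3 (m - i)) := by
  induction i generalizing v with
  | zero =>
    exact (hid v).trans_le (Nat.pow_le_pow_right (by norm_num) (by omega))
  | succ i ih =>
    refine (reduceColor_lt_pow (m := max 3 (m - i)) (by omega) (ih v) ?_).trans_le
      (Nat.pow_le_pow_right (by norm_num) (by omega))
    by_cases hS : {y | ∃ e, N.graph.Inc e v ∧ (Ch v e ∧ N.slot Ch v e = s) ∧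
        N.reduced Ch i (N.neighbor v e) s = y}.Nonempty
    · obtain ⟨e, h1, ⟨h2, rfl⟩, h4⟩ := Nat.sSup_mem hS (by
        refine ⟨2 ^ (max 3 (m - i)), ?_⟩
        rintro _ ⟨e, _, _, rfl⟩
        exact (ih _).le)
      rw [← h4]
      exact ih _
    · rw [Set.not_nonempty_iff_eq_empty.1 hS]
      simp

variable (N Ch)

open Classical in
/-- The value that is given to a charged edge by the endpoint to which it is charged. -/
noncomputable def chargeValue (f : V → E → γ) (e : E) : Option γ :=
  if h : ∃ v, N.graph.Inc e v ∧ Ch v e then some (f h.choose e) else none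

/-- No edge is charged to both endpoints. -/
def ExclusiveCharge : Prop := ∀ v e, N.graph.Inc e v → Ch v e → ¬ Ch (N.neighbor v e) e

variable {N Ch}

theorem chargeValue_eq (hex : N.ExclusiveCharge Ch) (f : V → E → γ) {v : V} {e : E}
    (he : N.graph.Inc e v) (hc : Ch v e) : N.chargeValue Ch f e = some (f v e) := by
  have h : ∃ v, N.graph.Inc e v ∧ Ch v e := ⟨v, he, hc⟩
  have : h.choose = v := by
    rcases h.choose_spec.1.eq_or_eq_of_isLink (N.isLink_neighbor he) with h1 | h1
    · exact h1
    · exact absurd (h1 ▸ h.choose_spec.2) (hex v e he hc)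
  unfold chargeValue
  rw [dif_pos h, this]

theorem chargeValue_eq_none {f : V → E → γ} {e : E} :
    N.chargeValue Ch f e = none ↔ ∀ v, N.graph.Inc e v → ¬ Ch v e := by
  unfold chargeValue
  split_ifs with h
  · obtain ⟨v, hv⟩ := h
    exact ⟨fun h => (by cases h), fun h => (h v hv.1 hv.2).elim⟩
  · exact ⟨fun _ v h1 h2 => h ⟨v, h1, h2⟩, fun _ => rfl⟩

theorem exists_of_chargeValue_eq_some {f : V → E → γ} {x : γ} {e : E}
    (h : N.chargeValue Ch f e = some x) : ∃ v, N.graph.Inc e v ∧ Ch v e ∧ f v e = x := by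
  unfold chargeValue at h
  split_ifs at h with h'
  exact ⟨_, h'.choose_spec.1, h'.choose_spec.2, Option.some.inj h⟩

theorem chargeValue_local {r : ℕ} {Ch : (I : Inst Ω) → I.V → I.E → Prop}
    {f : (I : Inst Ω) → I.V → I.E → γ} (hex : ∀ I : Inst Ω, I.N.ExclusiveCharge (Ch I))
    (h : DartLocal r Ch) (hf : DartLocal r f) :
    EdgeLocal (r + 1) (fun (I : Inst Ω) e => I.N.chargeValue (Ch I) (f I) e) := by
  classical
  have h1 := h.map₂ hf (fun p x => if p then some x else none)
  refine h1.edgeLocal_of_symm (fun x y => x.or y) fun I v e he => ?_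
  by_cases hv : Ch I v e
  · simp only [if_pos hv, chargeValue_eq (hex I) _ he hv, Option.some_or]
  · simp only [if_neg hv, Option.none_or]
    by_cases hw : Ch I (I.N.neighbor v e) e
    · rw [chargeValue_eq (hex I) _ (I.N.inc_neighbor he) hw, if_pos hw]
    · rw [if_neg hw, chargeValue_eq_none]
      intro u hu hcu
      rcases hu.eq_or_eq_of_isLink (I.N.isLink_neighbor he) with rfl | rfl
      · exact hv hcu
      · exact hw hcu

variable (N Ch)

/-- The color of an edge that is charged to one of its endpoints. -/
noncomputable def chargeColor (m : ℕ) : E → Option ℕ :=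
  N.chargeValue Ch fun v e =>
    N.slot Ch v e * 8 + N.reduced Ch m (N.neighbor v e) (N.slot Ch v e)

variable {N Ch}

theorem chargeColor_local {r : ℕ} {Ch : (I : Inst Ω) → I.V → I.E → Prop}
    (hex : ∀ I : Inst Ω, I.N.ExclusiveCharge (Ch I)) (h : DartLocal r Ch) (m : ℕ) :
    EdgeLocal (r + m + 2) (fun (I : Inst Ω) e => I.N.chargeColor (Ch I) m e) :=
  chargeValue_local hex (h.mono (by omega)) (((slot_local h).mono (by omega)).map₂
    (DartLocal.ofVertex (reduced_local h m)).swap (fun x f => x * 8 + f x))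

theorem chargeColor_lt [Finite V] [Finite E] {m q T : ℕ} {e : E} (hid : ∀ v, N.id v < 2 ^ m)
    (hT : ∀ v, {e | N.graph.Inc e v ∧ Ch v e}.ncard ≤ T)
    (h : N.chargeColor Ch m e = some q) : q < 8 * T := by
  obtain ⟨v, he, hc, rfl⟩ := exists_of_chargeValue_eq_some h
  have h1 := (slot_lt he hc).trans_le (hT v)
  have h2 := reduced_lt (Ch := Ch) hid m (N.neighbor v e) (N.slot Ch v e)
  simp at h2
  omega

/-- Each color class is a star forest. -/
theorem forestClass_chargeColor [Finite V] [Finite E] (hex : N.ExclusiveCharge Ch)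
    {m : ℕ} (hid : ∀ v, N.id v < 2 ^ m) (q : ℕ) :
    N.ForestClass (N.chargeColor Ch m) (some q) ∧
      (N.colorGraph (N.chargeColor Ch m) (some q)).DiamLE 2 := by
  have hlt : ∀ v s, N.reduced Ch m v s < 8 := fun v s => by
    simpa using reduced_lt (Ch := Ch) hid m v s
  have key : ∀ e v, N.graph.Inc e v → Ch v e → N.chargeColor Ch m e = some q →
      N.slot Ch v e = q / 8 ∧ N.reduced Ch m (N.neighbor v e) (q / 8) = q % 8 ∧
        N.reduced Ch m v (q / 8) ≠ q % 8 := by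
    intro e v he hc hq
    have hne := reduced_ne he hc m
    rw [chargeColor, chargeValue_eq hex _ he hc, Option.some.injEq] at hq
    have := hlt (N.neighbor v e) (N.slot Ch v e)
    have h1 : N.slot Ch v e = q / 8 := by omega
    rw [← h1]
    refine ⟨rfl, by omega, by omega⟩
  have hinc : ∀ e v w, N.graph.IsLink e v w → N.chargeColor Ch m e = some q →
      Ch v e ∨ Ch w e := by
    intro e v w hl hq
    obtain ⟨u, hu, hc, _⟩ := exists_of_chargeValue_eq_some hq
    rcases hu.eq_or_eq_of_isLink hl with rfl | rfl
    · exact Or.inl hc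
    · exact Or.inr hc
  -- In slot q / 8, the head of each edge of the class has reduced color q % 8 and its tail has
  -- another one. So the tails are the leaves, and a tail has only one edge in the slot.
  refine PortNetwork.forestClass_of_stars (fun v => N.reduced Ch m v (q / 8) ≠ q % 8) ?_ ?_
  · intro e v w hl hq
    rcases hinc e v w hl hq with hc | hc
    · obtain ⟨_, h2, h3⟩ := key e v hl.inc_left hc hq
      rw [N.neighbor_eq hl] at h2
      simp [h2, h3]
    · obtain ⟨_, h2, h3⟩ := key e w hl.inc_right hc hq
      rw [N.neighbor_eq hl.symm] at h2
      simp [h2, h3]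
  · intro v e f hv he hf hqe hqf
    have hc : ∀ e, N.graph.Inc e v → N.chargeColor Ch m e = some q → Ch v e := by
      intro e he hq
      rcases hinc e v _ (N.isLink_neighbor he) hq with hc | hc
      · exact hc
      · have := (key e _ (N.inc_neighbor he) hc hq).2.1
        rw [N.neighbor_neighbor he] at this
        exact absurd this hv
    exact slot_injOn he hf (hc e he hqe) (hc f hf hqf)
      ((key e v he (hc e he hqe) hqe).1.trans (key f v hf (hc f hf hqf) hqf).1.symm)

end PortNetwork

/-! ### Finite probability -/

/-- The probability of an event under the uniform distribution. -/
noncomputable def prob {W : Type*} (P : W → Prop) : ℝ := (Nat.card {w // P w} : ℝ) / Nat.card W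

section

variable {W : Type*} {P Q : W → Prop}

open Classical in
theorem prob_eq_sum [Fintype W] (P : W → Prop) :
    prob P = (∑ w, if P w then (1 : ℝ) else 0) / Fintype.card W := by
  unfold prob
  rw [Nat.card_eq_fintype_card, Nat.card_eq_fintype_card, Fintype.card_subtype,
    Finset.sum_boole]

theorem prob_nonneg : 0 ≤ prob P := by unfold prob; positivity

theorem prob_mono [Finite W] (h : ∀ w, P w → Q w) : prob P ≤ prob Q := by
  unfold prob
  gcongr
  exact Nat.card_le_card_of_injective (fun w : {w // P w} => (⟨w.1, h _ w.2⟩ : {w // Q w}))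
    fun x y hxy => Subtype.ext (Subtype.mk.inj hxy)

theorem prob_congr (h : ∀ w, P w ↔ Q w) : prob P = prob Q := by
  rw [show P = Q from funext fun w => propext (h w)]

theorem prob_le_one [Finite W] : prob P ≤ 1 := by
  unfold prob
  refine div_le_one_of_le₀ (Nat.cast_le.2 (Finite.card_subtype_le P)) (by positivity)

theorem prob_true [Finite W] [Nonempty W] : prob (fun _ : W => True) = 1 := by
  have : (Nat.card W : ℝ) ≠ 0 := by exact_mod_cast Nat.card_pos.ne'
  unfold prob
  rw [Nat.card_congr (Equiv.subtypeUnivEquiv fun _ => trivial), div_self this]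

theorem prob_eq_zero (h : ∀ w, ¬ P w) : prob P = 0 := by
  have : IsEmpty {w // P w} := ⟨fun w => h w.1 w.2⟩
  simp [prob]

theorem prob_add_not [Finite W] (P Q : W → Prop) :
    prob (fun w => Q w ∧ P w) + prob (fun w => ¬ Q w ∧ P w) = prob P := by
  classical
  have := Fintype.ofFinite W
  rw [prob_eq_sum, prob_eq_sum, prob_eq_sum, ← add_div, ← Finset.sum_add_distrib]
  congr 1
  refine Finset.sum_congr rfl fun w _ => ?_
  by_cases h : Q w <;> by_cases h' : P w <;> simp [h, h']

theorem prob_not [Finite W] [Nonempty W] (P : W → Prop) : prob (fun w => ¬ P w) = 1 - prob P := by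
  have := prob_add_not (fun _ : W => True) P
  rw [prob_true] at this
  simp only [and_true] at this
  linarith

theorem prob_exists_le [Finite W] {ι : Type*} (s : Finset ι) (P : ι → W → Prop) :
    prob (fun w => ∃ i ∈ s, P i w) ≤ ∑ i ∈ s, prob (P i) := by
  classical
  have := Fintype.ofFinite W
  simp_rw [prob_eq_sum]
  rw [← Finset.sum_div, Finset.sum_comm]
  gcongr with w
  split_ifs with h
  · obtain ⟨i, hi, hP⟩ := h
    refine le_trans ?_ (Finset.single_le_sum (f := fun i => if P i w then (1 : ℝ) else 0)
      (fun j _ => by positivity) hi)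
    simp [hP]
  · exact Finset.sum_nonneg fun j _ => by positivity

theorem prob_exists_le_card [Finite W] {ι : Type*} [Finite ι] (P : ι → W → Prop) {p : ℝ}
    (h : ∀ i, prob (P i) ≤ p) : prob (fun w => ∃ i, P i w) ≤ Nat.card ι * p := by
  have := Fintype.ofFinite ι
  refine le_trans (prob_mono fun w => ?_) ((prob_exists_le Finset.univ P).trans
    ((Finset.sum_le_card_nsmul _ _ p fun i _ => h i).trans ?_))
  · rintro ⟨i, hi⟩
    exact ⟨i, Finset.mem_univ i, hi⟩
  · rw [nsmul_eq_mul, Finset.card_univ, Nat.card_eq_fintype_card]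

theorem prob_or_le [Finite W] : prob (fun w => P w ∨ Q w) ≤ prob P + prob Q := by
  rw [← prob_add_not (fun w => P w ∨ Q w) P]
  exact add_le_add (prob_mono fun w h => h.1) (prob_mono fun w h => h.2.resolve_left h.1)

/-- Markov's inequality for the number of events that occur. -/
theorem prob_lt_ncard_le [Finite W] {ι : Type*} [Finite ι] (P : ι → W → Prop) (s : Set ι)
    (T : ℕ) {p : ℝ}
    (h : ∀ i ∈ s, prob (P i) ≤ p) :
    prob (fun w => T < {i | i ∈ s ∧ P i w}.ncard) ≤ s.ncard * p / (T + 1) := by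
  classical
  have := Fintype.ofFinite W
  have := Fintype.ofFinite ι
  rw [le_div_iff₀ (by positivity)]
  have h1 : ∑ i ∈ s.toFinset, prob (P i) ≤ s.ncard * p := by
    refine (Finset.sum_le_card_nsmul _ _ p fun i hi => h i (Set.mem_toFinset.1 hi)).trans ?_
    rw [nsmul_eq_mul, Set.ncard_eq_toFinset_card']
  refine le_trans ?_ h1
  simp_rw [prob_eq_sum]
  rw [← Finset.sum_div, Finset.sum_comm, div_mul_eq_mul_div, Finset.sum_mul]
  gcongr with w
  rw [Finset.sum_boole]
  have h2 : {i | i ∈ s ∧ P i w}.ncard = (s.toFinset.filter fun i => P i w).card := by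
    rw [Set.ncard_eq_toFinset_card']
    congr 1
    ext i
    simp
  rw [h2]
  split_ifs with h3
  · rw [one_mul]
    exact_mod_cast h3
  · simp

theorem rareFailure_of_prob_le {W : Type} [Finite W] {P : W → Prop} {n c : ℕ}
    (h : prob P ≤ 1 / (n : ℝ) ^ c) : RareFailure n c P := by
  unfold RareFailure
  rcases isEmpty_or_nonempty W with hW | hW
  · simp
  · have : (0 : ℝ) < Nat.card W := by exact_mod_cast Nat.card_pos
    rwa [← div_le_iff₀ this]

end

/-! ### Independence -/

section

variable {V Ω : Type*}

theorem DependsOn.not {P : (V → Ω) → Prop} {S : Set V} (hP : DependsOn P S) :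
    DependsOn (fun ω => ¬ P ω) S :=
  fun _ _ hxy => congrArg Not (hP hxy)

theorem DependsOn.forall_mem {ι : Type*} {P : ι → (V → Ω) → Prop} {S : ι → Set V} (s : Finset ι)
    (hP : ∀ i, DependsOn (P i) (S i)) :
    DependsOn (fun ω => ∀ i ∈ s, P i ω) (⋃ i ∈ s, S i) := by
  intro x y hxy
  refine propext (forall₂_congr fun i hi => ?_)
  rw [hP i fun v hv => hxy v (Set.mem_biUnion hi hv)]

variable [Finite V] [Finite Ω]

-- Take two independent copies of the labeling and exchange their coordinates in `S`. This bijection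
-- turns "P and Q hold for the first copy" into "P holds for the first copy and Q for the second".
open Classical in
theorem prob_and {P Q : (V → Ω) → Prop} {S T : Set V} (hP : DependsOn P S) (hQ : DependsOn Q T)
    (hST : Disjoint S T) : prob (fun ω => P ω ∧ Q ω) = prob P * prob Q := by
  let sw : (V → Ω) × (V → Ω) → (V → Ω) × (V → Ω) :=
    fun x => (S.piecewise x.1 x.2, S.piecewise x.2 x.1)
  have hsw : ∀ x, sw (sw x) = x := by
    intro x
    refine Prod.ext (funext fun v => ?_) (funext fun v => ?_) <;>
    by_cases hv : v ∈ S <;> simp [sw, hv]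
  have hinj : Function.Injective sw := Function.LeftInverse.injective hsw
  have hP' : ∀ x y : V → Ω, P (S.piecewise x y) = P x := fun x y =>
    hP fun v hv => by simp [hv]
  have hQ' : ∀ x y : V → Ω, Q (S.piecewise x y) = Q y := fun x y =>
    hQ fun v hv => by simp [Set.disjoint_right.1 hST hv]
  have h1 : Nat.card {x : (V → Ω) × (V → Ω) // (P x.1 ∧ Q x.1)} =
      Nat.card {x : (V → Ω) × (V → Ω) // P x.1 ∧ Q x.2} := by
    refine Nat.card_congr ⟨fun x => ⟨sw x.1, ?_⟩, fun x => ⟨sw x.1, ?_⟩,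
      fun x => Subtype.ext (hsw _), fun x => Subtype.ext (hsw _)⟩
    · exact ⟨(hP' _ _).symm ▸ x.2.1, (hQ' _ _).symm ▸ x.2.2⟩
    · exact ⟨(hP' _ _).symm ▸ x.2.1, (hQ' _ _).symm ▸ x.2.2⟩
  have h2 : Nat.card {x : (V → Ω) × (V → Ω) // (P x.1 ∧ Q x.1)} =
      Nat.card {ω // P ω ∧ Q ω} * Nat.card (V → Ω) := by
    rw [← Nat.card_prod]
    exact Nat.card_congr ⟨fun x => (⟨x.1.1, x.2⟩, x.1.2), fun x => ⟨(x.1.1, x.2), x.1.2⟩,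
      fun x => rfl, fun x => rfl⟩
  have h3 : Nat.card {x : (V → Ω) × (V → Ω) // P x.1 ∧ Q x.2} =
      Nat.card {ω // P ω} * Nat.card {ω // Q ω} := by
    rw [← Nat.card_prod]
    exact Nat.card_congr ⟨fun x => (⟨x.1.1, x.2.1⟩, ⟨x.1.2, x.2.2⟩),
      fun x => ⟨(x.1.1, x.2.1), x.1.2, x.2.2⟩, fun x => rfl, fun x => rfl⟩
  rcases isEmpty_or_nonempty (V → Ω) with hW | hW
  · simp [prob]
  have h0 : (Nat.card (V → Ω) : ℝ) ≠ 0 := by exact_mod_cast Nat.card_pos.ne'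
  have h4 : (Nat.card {ω // P ω ∧ Q ω} : ℝ) * Nat.card (V → Ω) =
      Nat.card {ω // P ω} * Nat.card {ω // Q ω} := by
    exact_mod_cast h2.symm.trans (h1.trans h3)
  unfold prob
  field_simp
  linarith

theorem prob_forall_mem_le {ι : Type*} {P : ι → (V → Ω) → Prop} {S : ι → Set V} {q : ℝ}
    (hP : ∀ i, DependsOn (P i) (S i)) (s : Finset ι)
    (hS : ∀ i ∈ s, ∀ j ∈ s, i ≠ j → Disjoint (S i) (S j)) (hq : ∀ i ∈ s, prob (P i) ≤ q)
    (hq0 : 0 ≤ q) :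
    prob (fun ω => ∀ i ∈ s, P i ω) ≤ q ^ s.card := by
  classical
  induction s using Finset.induction_on with
  | empty =>
    rw [Finset.card_empty, pow_zero]
    exact prob_le_one
  | insert a s ha ih =>
    have h1 : prob (fun ω => ∀ i ∈ insert a s, P i ω) =
        prob (P a) * prob (fun ω => ∀ i ∈ s, P i ω) := by
      rw [← prob_and (hP a) (DependsOn.forall_mem s hP)]
      · exact prob_congr fun ω => by simp
      · refine Set.disjoint_iUnion₂_right.2 fun j hj => ?_
        exact hS a (Finset.mem_insert_self a s) j (Finset.mem_insert_of_mem hj)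
          (fun h => ha (h ▸ hj))
    rw [h1, Finset.card_insert_of_notMem ha, pow_succ']
    exact mul_le_mul (hq a (Finset.mem_insert_self a s))
      (ih (fun i hi j hj => hS i (Finset.mem_insert_of_mem hi) j (Finset.mem_insert_of_mem hj))
        fun i hi => hq i (Finset.mem_insert_of_mem hi)) prob_nonneg hq0

/-- The symmetric Lovász local lemma. -/
theorem exists_forall_not_of_prob_le [Nonempty Ω] {ι : Type*} [Finite ι]
    {A : ι → (V → Ω) → Prop} {S : ι → Set V} {p : ℝ} {D : ℕ} (hA : ∀ i, DependsOn (A i) (S i))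
    (hp : ∀ i, prob (A i) ≤ p) (hD : ∀ i, {j | ¬ Disjoint (S i) (S j)}.ncard ≤ D)
    (h4 : 4 * p * D ≤ 1) (h4' : 4 * p ≤ 1) : ∃ ω, ∀ i, ¬ A i ω := by
  classical
  have := Fintype.ofFinite ι
  rcases isEmpty_or_nonempty ι with hι | ⟨⟨i₀⟩⟩
  · exact ⟨fun _ => Classical.arbitrary Ω, fun i => isEmptyElim i⟩
  have hp0 : 0 ≤ p := prob_nonneg.trans (hp i₀)
  let G : Finset ι → (V → Ω) → Prop := fun s ω => ∀ j ∈ s, ¬ A j ω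
  have hG : ∀ s, DependsOn (G s) (⋃ j ∈ s, S j) := fun s =>
    DependsOn.forall_mem s fun j => (hA j).not
  -- Induction on the number of avoided events: conditioned on avoiding them, a further event has
  -- probability at most 2p. The events of `s` split into `s₂`, independent of `A i`, and the at
  -- most `D` events of `s₁`.
  have key : ∀ m : ℕ, ∀ s : Finset ι, s.card = m → ∀ i,
      prob (fun ω => A i ω ∧ G s ω) ≤ 2 * p * prob (G s) := by
    intro m
    induction m using Nat.strong_induction_on with
    | _ m ih =>
    intro s hs i
    let s₂ := s.filter fun j => Disjoint (S i) (S j)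
    let s₁ := s.filter fun j => ¬ Disjoint (S i) (S j)
    have h1 : prob (fun ω => A i ω ∧ G s ω) ≤ p * prob (G s₂) := by
      calc _ ≤ prob (fun ω => A i ω ∧ G s₂ ω) :=
            prob_mono fun ω h => ⟨h.1, fun j hj => h.2 j (Finset.mem_filter.1 hj).1⟩
        _ = prob (A i) * prob (G s₂) := by
            refine prob_and (hA i) (hG s₂) (Set.disjoint_iUnion₂_right.2 fun j hj => ?_)
            exact (Finset.mem_filter.1 hj).2
        _ ≤ _ := mul_le_mul_of_nonneg_right (hp i) prob_nonneg
    have h2 : prob (G s₂) ≤ prob (G s) + ∑ j ∈ s₁, prob (fun ω => A j ω ∧ G s₂ ω) := by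
      refine le_trans ?_ (add_le_add_right (prob_exists_le s₁ fun j ω => A j ω ∧ G s₂ ω) _)
      refine le_trans (prob_mono fun ω h => ?_) prob_or_le
      by_cases hex : ∃ j ∈ s₁, A j ω
      · obtain ⟨j, hj, hjA⟩ := hex
        exact Or.inr ⟨j, hj, hjA, h⟩
      · refine Or.inl fun j hj hjA => ?_
        by_cases hd : Disjoint (S i) (S j)
        · exact h j (Finset.mem_filter.2 ⟨hj, hd⟩) hjA
        · exact hex ⟨j, Finset.mem_filter.2 ⟨hj, hd⟩, hjA⟩
    have h3 : ∑ j ∈ s₁, prob (fun ω => A j ω ∧ G s₂ ω) ≤ D * (2 * p * prob (G s₂)) := by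
      refine (Finset.sum_le_card_nsmul _ _ (2 * p * prob (G s₂)) fun j hj => ?_).trans ?_
      · refine ih s₂.card ?_ s₂ rfl j
        rw [← hs]
        refine Finset.card_lt_card (Finset.filter_ssubset.2 ⟨j, (Finset.mem_filter.1 hj).1, ?_⟩)
        exact (Finset.mem_filter.1 hj).2
      · rw [nsmul_eq_mul]
        refine mul_le_mul_of_nonneg_right (Nat.cast_le.2 (le_trans ?_ (hD i)))
          (mul_nonneg (by positivity) prob_nonneg)
        rw [Set.ncard_eq_toFinset_card']
        refine Finset.card_le_card fun j hj => ?_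
        simpa using (Finset.mem_filter.1 hj).2
    -- The sum in `h2` is at most half of prob (G s₂), since 2pD ≤ 1/2.
    have h5 : prob (G s₂) ≤ 2 * prob (G s) := by
      have h6 : 0 ≤ prob (G s₂) := prob_nonneg
      nlinarith
    calc _ ≤ _ := h1
      _ ≤ p * (2 * prob (G s)) := mul_le_mul_of_nonneg_left h5 hp0
      _ = _ := by ring
  have hpos : ∀ s : Finset ι, 0 < prob (G s) := by
    intro s
    induction s using Finset.induction_on with
    | empty =>
      have : prob (G ∅) = 1 := (prob_congr fun ω => by simp [G]).trans prob_true
      rw [this]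
      exact one_pos
    | insert a s ha ih =>
      have h1 := prob_add_not (G s) (A a)
      have h2 := key _ s rfl a
      have h3 : prob (G (insert a s)) = prob (fun ω => ¬ A a ω ∧ G s ω) :=
        prob_congr fun ω => by simp [G]
      rw [h3]
      nlinarith
  by_contra hcon
  push Not at hcon
  have h1 := hpos Finset.univ
  have h2 : prob (G Finset.univ) = 0 := by
    unfold prob
    have : IsEmpty {ω // G Finset.univ ω} := ⟨fun ω => by
      obtain ⟨i, hi⟩ := hcon ω.1
      exact ω.2 i (Finset.mem_univ i) hi⟩
    simp
  exact h1.ne' h2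

/-- The law of the value at one point is uniform. -/
theorem prob_apply (v : V) (X : Ω → Prop) [Nonempty Ω] :
    prob (fun ω : V → Ω => X (ω v)) = (Nat.card {x // X x} : ℝ) / Nat.card Ω := by
  classical
  have h1 : Nat.card (V → Ω) = Nat.card Ω * Nat.card ({j // j ≠ v} → Ω) := by
    rw [← Nat.card_prod]
    exact Nat.card_congr (Equiv.funSplitAt v Ω)
  have h2 : Nat.card {ω : V → Ω // X (ω v)} =
      Nat.card {x // X x} * Nat.card ({j // j ≠ v} → Ω) := by
    rw [← Nat.card_prod]
    exact Nat.card_congr (((Equiv.funSplitAt v Ω).subtypeEquiv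
      (q := fun x => X x.1) fun ω => Iff.rfl).trans
      ⟨fun x => (⟨x.1.1, x.2⟩, x.1.2), fun x => ⟨(x.1.1, x.2), x.1.2⟩, fun x => rfl, fun x => rfl⟩)
  have h3 : (Nat.card ({j // j ≠ v} → Ω) : ℝ) ≠ 0 := by exact_mod_cast Nat.card_pos.ne'
  unfold prob
  rw [h1, h2, Nat.cast_mul, Nat.cast_mul, mul_div_mul_right _ _ h3]

/-- A two-stage experiment. -/
theorem prob_prod_le {Ω₁ Ω₂ : Type*} [Finite Ω₁] [Finite Ω₂] [Nonempty Ω₂]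
    (P : (V → Ω₁ × Ω₂) → Prop) (B : (V → Ω₁) → Prop) {p₁ p₂ : ℝ} (hB : prob B ≤ p₁)
    (hp₂ : 0 ≤ p₂)
    (h : ∀ ω₁, ¬ B ω₁ → prob (fun ω₂ : V → Ω₂ => P fun v => (ω₁ v, ω₂ v)) ≤ p₂) :
    prob P ≤ p₁ + p₂ := by
  classical
  have := Fintype.ofFinite V
  have := Fintype.ofFinite Ω₁
  have := Fintype.ofFinite Ω₂
  have h1 : prob P = (∑ ω₁ : V → Ω₁, prob (fun ω₂ : V → Ω₂ => P fun v => (ω₁ v, ω₂ v))) /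
      Fintype.card (V → Ω₁) := by
    simp_rw [prob_eq_sum]
    rw [← Finset.sum_div, div_div]
    congr 1
    · rw [← Fintype.sum_prod_type',
        ← (Equiv.arrowProdEquivProdArrow V (fun _ => Ω₁) (fun _ => Ω₂)).sum_comp]
      rfl
    · rw [← Nat.cast_mul, mul_comm, ← Fintype.card_prod]
      exact_mod_cast Fintype.card_congr (Equiv.arrowProdEquivProdArrow V (fun _ => Ω₁) (fun _ => Ω₂))
  rcases isEmpty_or_nonempty (V → Ω₁) with hW | hW
  · rw [h1]
    simp only [Finset.univ_eq_empty, Finset.sum_empty, zero_div]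
    exact add_nonneg (prob_nonneg.trans hB) hp₂
  have h0 : (0 : ℝ) < Fintype.card (V → Ω₁) := by exact_mod_cast Fintype.card_pos
  rw [h1, div_le_iff₀ h0]
  have h2 : ∑ ω₁ : V → Ω₁, prob (fun ω₂ : V → Ω₂ => P fun v => (ω₁ v, ω₂ v)) ≤
      ∑ ω₁ : V → Ω₁, ((if B ω₁ then (1 : ℝ) else 0) + p₂) := by
    refine Finset.sum_le_sum fun ω₁ _ => ?_
    split_ifs with hω
    · exact prob_le_one.trans (by linarith)
    · simpa using h ω₁ hω
  refine h2.trans ?_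
  rw [Finset.sum_add_distrib, add_mul]
  refine add_le_add ?_ ?_
  · rw [prob_eq_sum, div_le_iff₀ h0] at hB
    exact hB
  · rw [Finset.sum_const, Finset.card_univ, nsmul_eq_mul, mul_comm]

end

/-! ### Tail bounds and sparse sets of bad vertices -/

section

variable {V : Type*} [Finite V]

open Classical in
/-- A Chernoff bound: each of `K` independent events of probability at most `1 / R`. -/
theorem prob_lt_ncard_hits_le {K R : ℕ} (hR : 0 < R) (anc : Fin K → V)
    (lev : Fin K → Option (Fin R)) (t : ℕ) :
    prob (fun ω : V → Fin K → Fin R => t < {c | lev c = some (ω (anc c) c)}.ncard) ≤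
      (1 + 1 / (R : ℝ)) ^ K / 2 ^ (t + 1) := by
  have := Fintype.ofFinite V
  have : NeZero R := ⟨hR.ne'⟩
  have hR' : (0 : ℝ) < R := by exact_mod_cast hR
  -- The exponential moment with base 2: the product of `F` over all coordinates is 2 to the number
  -- of hits. Its sum factorizes over the coordinates, of which only the pairs (anc c, c) contribute
  -- more than a factor R.
  let F : V × Fin K → Fin R → ℝ := fun x y => if x.1 = anc x.2 ∧ lev x.2 = some y then 2 else 1
  have hF : ∀ ω : V → Fin K → Fin R, ∏ x, F x (ω x.1 x.2) =
      2 ^ {c | lev c = some (ω (anc c) c)}.ncard := by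
    intro ω
    rw [Fintype.prod_prod_type_right, Set.ncard_eq_toFinset_card']
    have : ∀ c, ∏ v, F (v, c) (ω v c) = if lev c = some (ω (anc c) c) then 2 else 1 := by
      intro c
      rw [Finset.prod_eq_single (anc c)]
      · simp [F]
      · intro v _ hv
        simp [F, hv]
      · simp
    simp_rw [this]
    rw [Finset.prod_ite, Finset.prod_const, Finset.prod_const_one, mul_one]
    congr 2
    ext c
    simp
  have hsum : ∑ ω : V → Fin K → Fin R, ∏ x, F x (ω x.1 x.2) = ∏ x, ∑ y, F x y := by
    rw [Finset.prod_univ_sum, Fintype.piFinset_univ, ← (Equiv.curry V (Fin K) (Fin R)).sum_comp]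
    rfl
  have hle : ∏ x, ∑ y, F x y ≤ (Fintype.card (V → Fin K → Fin R) : ℝ) * (1 + 1 / (R : ℝ)) ^ K := by
    have h1 : ∀ x : V × Fin K, ∑ y, F x y ≤ R * (if x.1 = anc x.2 then 1 + 1 / (R : ℝ) else 1) := by
      intro x
      by_cases hx : x.1 = anc x.2
      · rw [if_pos hx]
        have : ∀ y, F x y = 1 + if lev x.2 = some y then 1 else 0 := by
          intro y
          by_cases hy : lev x.2 = some y
          · simp [F, hx, hy]
            norm_num
          · simp [F, hy]
        simp_rw [this, Finset.sum_add_distrib]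
        have h2 : ∑ y, (if lev x.2 = some y then (1 : ℝ) else 0) ≤ 1 := by
          rw [Finset.sum_boole]
          have : (Finset.univ.filter fun y => lev x.2 = some y).card ≤ 1 :=
            Finset.card_le_one.2 fun a ha b hb => by
              have h1 := (Finset.mem_filter.1 ha).2
              have h2 := (Finset.mem_filter.1 hb).2
              exact Option.some.inj (h1.symm.trans h2)
          exact_mod_cast this
        have h3 : (R : ℝ) * (1 + 1 / R) = R + 1 := by field_simp
        rw [h3]
        simp only [Finset.sum_const, Finset.card_univ, Fintype.card_fin, nsmul_eq_mul, mul_one]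
        linarith
      · simp [F, hx]
    refine (Finset.prod_le_prod (fun x _ => Finset.sum_nonneg fun y _ => by
      dsimp only [F]; split_ifs <;> norm_num) fun x _ => h1 x).trans (le_of_eq ?_)
    rw [Finset.prod_mul_distrib]
    congr 1
    · rw [Finset.prod_const, Finset.card_univ, Fintype.card_prod, ← Nat.cast_pow]
      congr 1
      simp [pow_mul, mul_comm]
    · rw [Fintype.prod_prod_type_right]
      simp
  have hpos : (0 : ℝ) < Fintype.card (V → Fin K → Fin R) := by exact_mod_cast Fintype.card_pos
  rw [prob_eq_sum, div_le_div_iff₀ hpos (by positivity), Finset.sum_mul]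
  calc _ ≤ ∑ ω : V → Fin K → Fin R, ∏ x, F x (ω x.1 x.2) := by
        refine Finset.sum_le_sum fun ω _ => ?_
        rw [hF]
        split_ifs with h
        · rw [one_mul]
          exact pow_le_pow_right₀ (by norm_num) h
        · simp
    _ = _ := hsum
    _ ≤ _ := hle
    _ = _ := mul_comm _ _

/-- The numerator is at most exp(K/R) ≤ exp(t/4), and 2^(t+1) is at least exp(t/2). -/
theorem prob_lt_ncard_hits_le_exp {K R : ℕ} (hR : 0 < R) (anc : Fin K → V)
    (lev : Fin K → Option (Fin R)) (t : ℕ) (h : 4 * K ≤ R * t) :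
    prob (fun ω : V → Fin K → Fin R => t < {c | lev c = some (ω (anc c) c)}.ncard) ≤
      Real.exp (-(t / 4)) := by
  have hR' : (0 : ℝ) < R := by exact_mod_cast hR
  refine (prob_lt_ncard_hits_le hR anc lev t).trans ?_
  have h1 : (1 + 1 / (R : ℝ)) ^ K ≤ Real.exp (t / 4) := by
    calc _ ≤ Real.exp (1 / R) ^ K := by
          gcongr
          rw [add_comm]
          exact Real.add_one_le_exp _
      _ = Real.exp (K / R) := by
          rw [← Real.exp_nat_mul]
          congr 1
          ring
      _ ≤ _ := by
          rw [Real.exp_le_exp, div_le_div_iff₀ hR' (by norm_num)]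
          have : (4 : ℝ) * K ≤ R * t := by exact_mod_cast h
          linarith
  have h2 : Real.exp (t / 2) ≤ 2 ^ (t + 1) := by
    have h3 : Real.exp (1 / 2) ≤ 2 := by
      rw [← Real.le_log_iff_exp_le (by norm_num)]
      have := Real.log_two_gt_d9
      linarith
    calc Real.exp (t / 2) = Real.exp (1 / 2) ^ t := by
          rw [← Real.exp_nat_mul]
          congr 1
          ring
      _ ≤ 2 ^ t := by gcongr
      _ ≤ 2 ^ (t + 1) := pow_le_pow_right₀ (by norm_num) (by omega)
  rw [div_le_iff₀ (by positivity)]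
  calc _ ≤ Real.exp (t / 4) := h1
    _ = Real.exp (-(t / 4)) * Real.exp (t / 2) := by
        rw [← Real.exp_add]
        congr 1
        ring
    _ ≤ _ := by gcongr

/-- The union bound over chains of independent bad events. -/
theorem prob_exists_chain_le {Ω : Type*} [Finite Ω] {Bad : V → (V → Ω) → Prop} {S : V → Set V}
    (hdep : ∀ v, DependsOn (Bad v) (S v)) {N : V → Set V} {D : ℕ} (s : ℕ)
    (hD : ∀ v, (N v).ncard ≤ D) {p : ℝ} (hp : ∀ v, prob (Bad v) ≤ p) :
    prob (fun ω => ∃ f : ℕ → V, (∀ i < s, f (i + 1) ∈ N (f i)) ∧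
      (∀ i ≤ s, ∀ j ≤ s, i ≠ j → Disjoint (S (f i)) (S (f j))) ∧ ∀ i ≤ s, Bad (f i) ω) ≤
      Nat.card V * D ^ s * p ^ (s + 1) := by
  classical
  have hnb : ∀ v, ∃ g : Fin D → V, N v ⊆ Set.range g := by
    intro v
    have := Fintype.ofFinite (N v)
    rcases isEmpty_or_nonempty (N v) with hN | hN
    · refine ⟨fun _ => v, fun x hx => (hN.false ⟨x, hx⟩).elim⟩
    · have h1 : Fintype.card (N v) ≤ Fintype.card (Fin D) := by
        rw [Fintype.card_fin, ← Nat.card_eq_fintype_card, Nat.card_coe_set_eq]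
        exact hD v
      obtain ⟨g⟩ := Function.Embedding.nonempty_of_card_le h1
      refine ⟨fun i => (Function.invFun g i).1, fun x hx => ⟨g ⟨x, hx⟩, ?_⟩⟩
      dsimp only
      rw [Function.leftInverse_invFun g.injective]
  choose nb hnb using hnb
  -- A chain is encoded by its first vertex and `s` indices into neighborhoods, which leaves |V| D^s
  -- chains for the union bound.
  let dec : V × (Fin s → Fin D) → ℕ → V := fun x i =>
    Nat.rec x.1 (fun i v => if h : i < s then nb v (x.2 ⟨i, h⟩) else v) i
  have hdec : ∀ f : ℕ → V, (∀ i < s, f (i + 1) ∈ N (f i)) →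
      ∃ x, ∀ i ≤ s, dec x i = f i := by
    intro f hf
    have : ∀ i : Fin s, ∃ j, nb (f i) j = f (i + 1) := fun i => hnb _ (hf i i.2)
    choose g hg using this
    refine ⟨(f 0, g), fun i hi => ?_⟩
    induction i with
    | zero => rfl
    | succ i ih =>
      have h1 : i < s := hi
      change (if h : i < s then nb (dec (f 0, g) i) (g ⟨i, h⟩) else dec (f 0, g) i) = _
      rw [dif_pos h1, ih h1.le]
      exact hg ⟨i, h1⟩
  have hp0 : ∀ v : V, 0 ≤ p := fun v => prob_nonneg.trans (hp v)
  refine (prob_mono (Q := fun ω => ∃ x : V × (Fin s → Fin D),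
    (∀ i ≤ s, ∀ j ≤ s, i ≠ j → Disjoint (S (dec x i)) (S (dec x j))) ∧
      ∀ i ≤ s, Bad (dec x i) ω) ?_).trans
    ((prob_exists_le_card (p := p ^ (s + 1)) _ fun x => ?_).trans (le_of_eq ?_))
  · rintro ω ⟨f, h1, h2, h3⟩
    obtain ⟨x, hx⟩ := hdec f h1
    refine ⟨x, fun i hi j hj hij => ?_, fun i hi => ?_⟩
    · rw [hx i hi, hx j hj]
      exact h2 i hi j hj hij
    · rw [hx i hi]
      exact h3 i hi
  · by_cases hx : ∀ i ≤ s, ∀ j ≤ s, i ≠ j → Disjoint (S (dec x i)) (S (dec x j))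
    · have h1 := prob_forall_mem_le (P := fun i => Bad (dec x i)) (S := fun i => S (dec x i))
        (q := p) (fun i => hdep _) (Finset.range (s + 1))
        (fun i hi j hj hij => hx i (Nat.lt_succ_iff.1 (Finset.mem_range.1 hi)) j
          (Nat.lt_succ_iff.1 (Finset.mem_range.1 hj)) hij) (fun i _ => hp _) (hp0 x.1)
      rw [Finset.card_range] at h1
      refine le_trans (prob_mono fun ω h i hi => ?_) h1
      exact h.2 i (Nat.lt_succ_iff.1 (Finset.mem_range.1 hi))
    · exact (prob_eq_zero fun ω h => hx h.1).trans_le (pow_nonneg (hp0 x.1) (s + 1))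
  · rw [Nat.card_prod]
    simp

end

namespace SimpleGraph

variable {V : Type*}

/-- The graph on a set of marked vertices that joins those at distance at most `ρ`. -/
def closeGraph (H : SimpleGraph V) (B : V → Prop) (ρ : ℕ) : SimpleGraph V where
  Adj x y := x ≠ y ∧ B x ∧ B y ∧ y ∈ H.closedBall ρ x
  symm := ⟨fun _ _ h => ⟨h.1.symm, h.2.2.1, h.2.1, mem_closedBall_comm.1 h.2.2.2⟩⟩
  loopless := ⟨fun _ h => h.1 rfl⟩

/-- A component of large diameter contains a long chain of vertices that are pairwise far apart. -/
theorem exists_chain_of_closeGraph {H : SimpleGraph V} {B : V → Prop} {ρ s : ℕ}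
    {x y : V} (hxy : (H.closeGraph B ρ).Reachable x y)
    (hy : y ∉ (H.closeGraph B ρ).closedBall (2 * s) x) :
    ∃ f : ℕ → V, (∀ i < s, f (i + 1) ∈ H.closedBall (2 * ρ) (f i)) ∧
      (∀ i ≤ s, ∀ j ≤ s, i ≠ j → f j ∉ H.closedBall ρ (f i)) ∧ ∀ i ≤ s, B (f i) := by
  obtain ⟨p, hp⟩ := hxy.exists_walk_length_eq_dist
  have hm : 2 * s < p.length := by
    by_contra h
    exact hy ⟨p, not_lt.1 h⟩
  have hstep : ∀ i < p.length, (H.closeGraph B ρ).Adj (p.getVert i) (p.getVert (i + 1)) :=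
    fun i hi => p.adj_getVert_succ hi
  have hB : ∀ i ≤ s, B (p.getVert (2 * i)) := fun i hi => (hstep (2 * i) (by omega)).2.1
  -- Two vertices of a geodesic that are at least two steps apart are neither equal nor adjacent, as
  -- this would give a shortcut. So every second vertex of the geodesic can be used.
  have hfar : ∀ i j, i + 2 ≤ j → j ≤ p.length →
      ¬ ((p.getVert i) = p.getVert j ∨ (H.closeGraph B ρ).Adj (p.getVert i) (p.getVert j)) := by
    intro i j hij hj h
    obtain ⟨q, hq⟩ : ∃ q : (H.closeGraph B ρ).Walk (p.getVert i) (p.getVert j), q.length ≤ 1 := by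
      rcases h with h | h
      · exact ⟨Walk.nil.copy rfl h, by simp⟩
      · exact ⟨h.toWalk, le_rfl⟩
    have h1 := dist_le (((p.take i).append q).append (p.drop j))
    rw [Walk.length_append, Walk.length_append, Walk.take_length, Walk.drop_length] at h1
    omega
  refine ⟨fun i => p.getVert (2 * i), fun i hi => ?_, ?_, hB⟩
  · have h1 := (hstep (2 * i) (by omega)).2.2.2
    have h2 := (hstep (2 * i + 1) (by omega)).2.2.2
    have h3 := mem_closedBall_trans h1 h2
    rw [← two_mul] at h3
    exact h3
  · have key : ∀ i ≤ s, ∀ j ≤ s, i < j → p.getVert (2 * j) ∉ H.closedBall ρ (p.getVert (2 * i)) := by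
      intro i hi j hj hij h
      refine hfar (2 * i) (2 * j) (by omega) (by omega) ?_
      by_cases he : p.getVert (2 * i) = p.getVert (2 * j)
      · exact Or.inl he
      · exact Or.inr ⟨he, hB i hi, hB j hj, h⟩
    intro i hi j hj hij h
    rcases lt_or_gt_of_ne hij with h1 | h1
    · exact key i hi j hj h1 h
    · exact key j hj i hi h1 (mem_closedBall_comm.1 h)

end SimpleGraph

/-! ### Components of large radius and good colorings -/

namespace SimpleGraph

variable {V : Type*}

/-- Some vertex is at distance exactly `L + 1` from `v`. -/
def Far (H : SimpleGraph V) (L : ℕ) (v : V) : Prop :=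
  H.closedBall (L + 1) v ≠ H.closedBall L v

theorem Far.exists_isPath {H : SimpleGraph V} {L : ℕ} {v : V} (h : H.Far L v) :
    ∃ x, ∃ p : H.Walk v x, p.IsPath ∧ p.length = L + 1 := by
  classical
  have : ∃ x, x ∈ H.closedBall (L + 1) v ∧ x ∉ H.closedBall L v := by
    by_contra hcon
    push Not at hcon
    exact h (Set.Subset.antisymm hcon (closedBall_mono (Nat.le_succ L) v))
  obtain ⟨x, ⟨p, hp⟩, hx⟩ := this
  refine ⟨x, p.bypass, p.bypass_isPath, le_antisymm (p.length_bypass_le_length.trans hp) ?_⟩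
  by_contra hlt
  exact hx ⟨p.bypass, by omega⟩

/-- Paths in a forest are unique, so a path of length L + 1 realizes a distance. -/
theorem IsAcyclic.far_of_isPath {H : SimpleGraph V} (hH : H.IsAcyclic) {L : ℕ} {v x : V}
    {p : H.Walk v x} (hp : p.IsPath) (hL : p.length = L + 1) : H.Far L v := by
  classical
  intro h
  have h1 : x ∈ H.closedBall (L + 1) v := ⟨p, hL.le⟩
  rw [h] at h1
  obtain ⟨q, hq⟩ := h1
  have h2 := (hH.subsingleton_path v x).elim ⟨p, hp⟩ ⟨q.bypass, q.bypass_isPath⟩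
  have h3 : p.length = q.bypass.length := congrArg (fun p => p.1.length) h2
  have := q.length_bypass_le_length
  omega

end SimpleGraph

namespace PortNetwork

variable {V E : Type} {N : PortNetwork V E}

theorem colorGraph_congr {ψ : E → α} {ψ' : E → β} {c : α} {c' : β}
    (h : ∀ e ∈ N.graph.edgeSet, ψ e = c ↔ ψ' e = c') : N.colorGraph ψ c = N.colorGraph ψ' c' := by
  ext v w
  exact ⟨fun ⟨e, he, hc⟩ => ⟨e, he, (h e he.edge_mem).1 hc⟩,
    fun ⟨e, he, hc⟩ => ⟨e, he, (h e he.edge_mem).2 hc⟩⟩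

variable (N)

/-- A forest decomposition with `k` colors and diameter at most `D`. -/
def GoodColoring (k D : ℕ) (ψ : E → ℕ) : Prop :=
  (∀ e ∈ N.graph.edgeSet, ψ e < k) ∧ ∀ c, N.ForestClass ψ c ∧ (N.colorGraph ψ c).DiamLE D

variable {N}

theorem GoodColoring.mono {k D k' D' : ℕ} {ψ : E → ℕ} (h : N.GoodColoring k D ψ) (hk : k ≤ k')
    (hD : D ≤ D') : N.GoodColoring k' D' ψ :=
  ⟨fun e he => (h.1 e he).trans_le hk, fun c => ⟨(h.2 c).1, (h.2 c).2.mono hD⟩⟩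

/-! ### Random cuts into stars -/

variable (N) {M : ℕ} (Own : V → E → Prop) (lab : V → Bool × Fin M) (φ : E → ℕ)

/-- A random set of owned edges, each of which is directed from a vertex marked `true` to a vertex
marked `false`. -/
def Cut (v : V) (e : E) : Prop :=
  Own v e ∧ (lab v).1 = true ∧ (lab (N.neighbor v e)).1 = false ∧
    N.slot Own v e % M = (lab v).2

/-- The color of the star forest to which a cut edge belongs. -/
noncomputable def cutColor : E → Option ℕ :=
  N.chargeValue (N.Cut Own lab) fun v e => N.slot Own v e / M

/-- The color of an edge, if it is not cut. -/
noncomputable def survivor (e : E) : Option ℕ := (N.cutColor Own lab e).elim (some (φ e)) fun _ => none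

/-- The owned edges that remain in a component of large radius. -/
def Residual (L : ℕ) (v : V) (e : E) : Prop :=
  Own v e ∧ N.survivor Own lab φ e ≠ none ∧
    ((N.colorGraph (N.survivor Own lab φ) (N.survivor Own lab φ e)).Far L v ∨
      (N.colorGraph (N.survivor Own lab φ) (N.survivor Own lab φ e)).Far L (N.neighbor v e))

/-- The coloring after cutting, where the residual edges are colored separately. -/
noncomputable def cutColoring (k t L m : ℕ) (e : E) : ℕ :=
  (N.cutColor Own lab e).elim
    ((N.chargeColor (N.Residual Own lab φ L) m e).elim (φ e) fun q => k + t + q) fun s => k + s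

variable {N Own lab φ}

theorem survivor_eq_some {c : ℕ} {e : E} {v w : V} (he : N.graph.IsLink e v w) :
    N.survivor Own lab φ e = some c ↔
      φ e = c ∧ ¬ N.Cut Own lab v e ∧ ¬ N.Cut Own lab w e := by
  unfold survivor
  have key : N.cutColor Own lab e = none ↔ ¬ N.Cut Own lab v e ∧ ¬ N.Cut Own lab w e := by
    unfold cutColor
    rw [chargeValue_eq_none]
    constructor
    · exact fun h => ⟨h v he.inc_left, h w he.inc_right⟩
    · rintro ⟨h1, h2⟩ u hu
      rcases hu.eq_or_eq_of_isLink he with rfl | rfl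
      · exact h1
      · exact h2
  rw [← key]
  cases hc : N.cutColor Own lab e <;> simp

theorem exclusiveCharge_cut (hex : N.ExclusiveCharge Own) :
    N.ExclusiveCharge (N.Cut Own lab) := fun v e he h h' => hex v e he h.1 h'.1

theorem exclusiveCharge_residual (hex : N.ExclusiveCharge Own) {L : ℕ} :
    N.ExclusiveCharge (N.Residual Own lab φ L) := fun v e he h h' => hex v e he h.1 h'.1

/-- The colors fall into three ranges: below k the remaining input classes, then t colors for cut
edges, then 8T colors for residual edges. Only the first range can have diameter above 2. -/
theorem goodColoring_cutColoring [Finite V] [Finite E] {k t L m T T₀ : ℕ}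
    (hφ : ∀ e ∈ N.graph.edgeSet, φ e < k) (hF : ∀ c, N.ForestClass φ c)
    (hex : N.ExclusiveCharge Own)
    (hown : ∀ v e, N.graph.Inc e v → Own v e ∨ Own (N.neighbor v e) e)
    (hT₀ : ∀ v, {e | N.graph.Inc e v ∧ Own v e}.ncard ≤ T₀) (ht : T₀ ≤ t * M)
    (hid : ∀ v, N.id v < 2 ^ m)
    (hT : ∀ v, {e | N.graph.Inc e v ∧ N.Residual Own lab φ L v e}.ncard ≤ T) :
    N.GoodColoring (k + t + 8 * T) (max 2 L) (N.cutColoring Own lab φ k t L m) := by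
  have hcut : ∀ e s, N.cutColor Own lab e = some s → s < t := by
    intro e s h
    obtain ⟨v, he, hc, rfl⟩ := exists_of_chargeValue_eq_some h
    refine Nat.div_lt_of_lt_mul ?_
    rw [mul_comm]
    exact ((slot_lt he hc.1).trans_le (hT₀ v)).trans_le ht
  have hcol : ∀ e q, N.chargeColor (N.Residual Own lab φ L) m e = some q → q < 8 * T :=
    fun e q h => chargeColor_lt hid hT h
  have hdisj : ∀ e q, N.chargeColor (N.Residual Own lab φ L) m e = some q →
      N.cutColor Own lab e = none := by
    intro e q h
    obtain ⟨v, he, hc, _⟩ := exists_of_chargeValue_eq_some h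
    have := hc.2.1
    unfold survivor at this
    cases h : N.cutColor Own lab e <;> simp_all
  set out := N.cutColoring Own lab φ k t L m with hout
  have hcases : ∀ e, (∃ s, s < t ∧ N.cutColor Own lab e = some s ∧ out e = k + s) ∨
      (∃ q, q < 8 * T ∧ N.chargeColor (N.Residual Own lab φ L) m e = some q ∧
        out e = k + t + q) ∨
      (N.cutColor Own lab e = none ∧ N.chargeColor (N.Residual Own lab φ L) m e = none ∧
        out e = φ e) := by
    intro e
    rw [hout]
    unfold cutColoring
    cases h1 : N.cutColor Own lab e with
    | some s => exact Or.inl ⟨s, hcut e s h1, rfl, rfl⟩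
    | none =>
      cases h2 : N.chargeColor (N.Residual Own lab φ L) m e with
      | some q => exact Or.inr (Or.inl ⟨q, hcol e q h2, rfl, rfl⟩)
      | none => exact Or.inr (Or.inr ⟨rfl, rfl, rfl⟩)
  refine ⟨fun e he => ?_, fun c => ?_⟩
  · have := hφ e he
    rcases hcases e with ⟨s, h1, _, h2⟩ | ⟨q, h1, _, h2⟩ | ⟨_, _, h2⟩ <;> omega
  rcases lt_or_ge c k with hck | hck
  · have hsub : ∀ e ∈ N.graph.edgeSet, out e = c → φ e = c ∧
        N.survivor Own lab φ e = some c ∧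
        N.chargeColor (N.Residual Own lab φ L) m e = none := by
      intro e he hec
      rcases hcases e with ⟨s, _, _, h2⟩ | ⟨q, _, _, h2⟩ | ⟨h1, h3, h2⟩
      · omega
      · omega
      · refine ⟨h2 ▸ hec, ?_, h3⟩
        unfold survivor
        rw [h1, Option.elim_none, ← h2, hec]
    refine ⟨(hF c).anti fun e he hec => (hsub e he hec).1, ?_⟩
    have hle : N.colorGraph out c ≤ N.colorGraph (N.survivor Own lab φ) (some c) :=
      fun v w ⟨e, he, hec⟩ => ⟨e, he, (hsub e he.edge_mem hec).2.1⟩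
    have hle' : N.colorGraph (N.survivor Own lab φ) (some c) ≤ N.colorGraph φ c :=
      fun v w ⟨e, he, hec⟩ => ⟨e, he, ((survivor_eq_some he).1 hec).1⟩
    have hac := (hF c).2.anti hle'
    refine SimpleGraph.DiamLE.mono ?_ (le_max_right 2 L)
    intro u v huv
    obtain ⟨p, hp, hpd⟩ := huv.exists_path_of_dist
    by_contra hfar
    have hlen : L + 1 ≤ p.length := by
      by_contra h
      exact hfar ⟨p, by omega⟩
    -- A path longer than L in a remaining class would start at a far vertex. Its first edge would
    -- then be residual and could not have kept its color.
    have hfar' : (N.colorGraph (N.survivor Own lab φ) (some c)).Far L u := by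
      refine hac.far_of_isPath (p := (p.take (L + 1)).mapLe hle) ?_ ?_
      · exact (hp.take (L + 1)).mapLe hle
      · rw [SimpleGraph.Walk.length_mapLe, SimpleGraph.Walk.take_length]
        omega
    cases p with
    | nil => simp at hlen
    | cons h p =>
      obtain ⟨e, he, hec⟩ := h
      obtain ⟨_, h2, h3⟩ := hsub e he.edge_mem hec
      have h4 := chargeValue_eq_none.1 h3
      rcases hown u e he.inc_left with h5 | h5
      · refine h4 u he.inc_left ⟨h5, by rw [h2]; simp, Or.inl ?_⟩
        rw [h2]
        exact hfar'
      · refine h4 _ (N.inc_neighbor he.inc_left) ⟨h5, by rw [h2]; simp, Or.inr ?_⟩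
        rw [h2, N.neighbor_neighbor he.inc_left]
        exact hfar'
  rcases lt_or_ge c (k + t) with hct | hct
  · have hsub : ∀ e ∈ N.graph.edgeSet, out e = c → ∃ v, N.graph.Inc e v ∧ N.Cut Own lab v e ∧
        N.slot Own v e / M = c - k := by
      intro e he hec
      have := hφ e he
      rcases hcases e with ⟨s, _, h1, h2⟩ | ⟨q, _, _, h2⟩ | ⟨_, _, h2⟩
      · obtain ⟨v, h3, h4, h5⟩ := exists_of_chargeValue_eq_some h1
        exact ⟨v, h3, h4, by omega⟩
      · omega
      · omega
    -- Vertices marked `true` are the leaves. They own all their cut edges, whose slots share one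
    -- residue mod M, so the quotient determines the edge.
    have hst := forestClass_of_stars (N := N) (ψ := out) (c := c) (fun v => (lab v).1 = true) ?_ ?_
    · exact ⟨hst.1, hst.2.mono (le_max_left _ _)⟩
    · intro e v w he hec
      obtain ⟨u, hu, hc, _⟩ := hsub e he.edge_mem hec
      have h1 : (lab u).1 = true := hc.2.1
      have h2 := hc.2.2.1
      rcases hu.eq_or_eq_of_isLink he with rfl | rfl
      · rw [N.neighbor_eq he] at h2
        simp [h1, h2]
      · rw [N.neighbor_eq he.symm] at h2
        simp [h1, h2]
    · have key : ∀ v e, (lab v).1 = true → N.graph.Inc e v → out e = c → N.Cut Own lab v e ∧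
          N.slot Own v e / M = c - k := by
        intro v e hv he hec
        obtain ⟨u, hu, hc, h1⟩ := hsub e he.edge_mem hec
        rcases he.eq_or_eq_of_isLink (N.isLink_neighbor hu) with rfl | rfl
        · exact ⟨hc, h1⟩
        · rw [hc.2.2.1] at hv
          cases hv
      intro v e f hv he hf hec hfc
      obtain ⟨h1, h2⟩ := key v e hv he hec
      obtain ⟨h3, h4⟩ := key v f hv hf hfc
      refine slot_injOn he hf h1.1 h3.1 ?_
      rw [← Nat.div_add_mod (N.slot Own v e) M, ← Nat.div_add_mod (N.slot Own v f) M, h2, h4,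
        h1.2.2.2, h3.2.2.2]
  · have hiff : ∀ e ∈ N.graph.edgeSet, out e = c ↔
        N.chargeColor (N.Residual Own lab φ L) m e = some (c - (k + t)) := by
      intro e he
      have := hφ e he
      rcases hcases e with ⟨s, _, h1, h2⟩ | ⟨q, _, h1, h2⟩ | ⟨_, h1, h2⟩
      · refine ⟨fun h => by omega, fun h => ?_⟩
        have := hdisj e _ h
        rw [h1] at this
        cases this
      · rw [h1, Option.some.injEq]
        omega
      · rw [h1]
        simp
        omega
    obtain ⟨h1, h2⟩ := forestClass_chargeColor (exclusiveCharge_residual (lab := lab) (φ := φ)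
      (L := L) hex) hid (c - (k + t))
    refine ⟨h1.anti fun e he => (hiff e he).1, ?_⟩
    rw [colorGraph_congr hiff]
    exact h2.mono (le_max_left _ _)

end PortNetwork

namespace PortNetwork

variable {V E : Type} {N : PortNetwork V E} {M : ℕ} {Own : V → E → Prop} {φ : E → ℕ}

/-! ### Long paths are unlikely to survive -/

theorem dependsOn_cut {v : V} {e : E} :
    DependsOn (fun lab : V → Bool × Fin M => N.Cut Own lab v e) {v, N.neighbor v e} := by
  intro x y hxy
  have h1 := hxy v (by simp)
  have h2 := hxy (N.neighbor v e) (by simp)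
  simp only [Cut, h1, h2]

theorem dependsOn_survivor_adj {c : ℕ} {v w : V} :
    DependsOn (fun lab : V → Bool × Fin M =>
      (N.colorGraph (N.survivor Own lab φ) (some c)).Adj v w) {v, w} := by
  intro x y hxy
  refine propext (exists_congr fun e => and_congr_right fun he => ?_)
  rw [survivor_eq_some he, survivor_eq_some he]
  have h1 : N.Cut Own x v e = N.Cut Own y v e := dependsOn_cut fun u hu => hxy u (by
    rwa [N.neighbor_eq he] at hu)
  have h2 : N.Cut Own x w e = N.Cut Own y w e := dependsOn_cut fun u hu => hxy u (by
    rwa [N.neighbor_eq he.symm, Set.pair_comm] at hu)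
  rw [h1, h2]

variable [Finite V]

/-- The label of the owner has one prescribed value, with probability 1/(2M), and independently the
other endpoint is marked `false`, with probability 1/2. -/
theorem le_prob_cut [NeZero M] {v : V} {e : E} (he : N.graph.Inc e v) (hv : Own v e) :
    1 / (4 * (M : ℝ)) ≤ prob (fun lab : V → Bool × Fin M => N.Cut Own lab v e) := by
  have hM : (M : ℝ) ≠ 0 := by exact_mod_cast NeZero.ne M
  let x : Fin M := ⟨N.slot Own v e % M, Nat.mod_lt _ (NeZero.pos M)⟩
  have h1 := prob_and (V := V) (Ω := Bool × Fin M) (P := fun lab => lab v = (true, x))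
    (Q := fun lab => (lab (N.neighbor v e)).1 = false) (S := {v}) (T := {N.neighbor v e})
    (fun a b h => by simp only [h v rfl])
    (fun a b h => by simp only [h (N.neighbor v e) rfl])
    (Set.disjoint_singleton.2 (N.ne_of_isLink (N.isLink_neighbor he)))
  rw [prob_apply v (fun y => y = (true, x)),
    prob_apply (N.neighbor v e) (fun y : Bool × Fin M => y.1 = false)] at h1
  have h2 : Nat.card {y : Bool × Fin M // y = (true, x)} = 1 := by simp
  have h3 : Nat.card {y : Bool × Fin M // y.1 = false} = M := by
    rw [Nat.card_congr (β := Fin M) ⟨fun y => y.1.2, fun z => ⟨(false, z), rfl⟩, ?_, fun z => rfl⟩]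
    · simp
    · rintro ⟨⟨a, b⟩, h⟩
      obtain rfl : a = false := h
      rfl
  have h4 : Nat.card (Bool × Fin M) = 2 * M := by simp
  rw [h2, h3, h4] at h1
  have h5 : ((1 : ℕ) : ℝ) / ((2 * M : ℕ) : ℝ) * ((M : ℝ) / ((2 * M : ℕ) : ℝ)) = 1 / (4 * M) := by
    push_cast
    field_simp
    norm_num
  rw [← h5, ← h1]
  refine prob_mono fun lab h => ⟨hv, ?_, h.2, ?_⟩
  · rw [h.1]
  · rw [h.1]

theorem prob_survivor_adj_le [NeZero M] {c : ℕ} {v w : V} (hF : N.ForestClass φ c)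
    (hown : ∀ v e, N.graph.Inc e v → Own v e ∨ Own (N.neighbor v e) e)
    (hvw : (N.colorGraph φ c).Adj v w) :
    prob (fun lab : V → Bool × Fin M => (N.colorGraph (N.survivor Own lab φ) (some c)).Adj v w) ≤
      1 - 1 / (4 * (M : ℝ)) := by
  obtain ⟨e, he, hec⟩ := hvw
  have h1 : ∀ lab : V → Bool × Fin M, (N.colorGraph (N.survivor Own lab φ) (some c)).Adj v w →
      ¬ N.Cut Own lab v e ∧ ¬ N.Cut Own lab w e := by
    rintro lab ⟨f, hf, hfc⟩
    obtain ⟨h1, h2⟩ := (survivor_eq_some hf).1 hfc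
    rwa [hF.1 f e v w hf he h1 hec] at h2
  have key : ∀ u, N.graph.Inc e u → Own u e → prob (fun lab : V → Bool × Fin M =>
      ¬ N.Cut Own lab u e) ≤ 1 - 1 / (4 * (M : ℝ)) := by
    intro u hu hown
    rw [prob_not]
    linarith [le_prob_cut (M := M) hu hown]
  rcases hown v e he.inc_left with h | h
  · exact (prob_mono fun lab hl => (h1 lab hl).1).trans (key v he.inc_left h)
  · rw [N.neighbor_eq he] at h
    exact (prob_mono fun lab hl => (h1 lab hl).2).trans (key w he.inc_right h)

/-- A far vertex starts a surviving path of length L + 1. For each possible endpoint the forest has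
only one path, and every second edge of it survives independently because these edges are disjoint.
-/
theorem prob_far_le [NeZero M] {c L : ℕ} (v : V) (hF : N.ForestClass φ c)
    (hown : ∀ v e, N.graph.Inc e v → Own v e ∨ Own (N.neighbor v e) e) :
    prob (fun lab : V → Bool × Fin M =>
      (N.colorGraph (N.survivor Own lab φ) (some c)).Far L v) ≤
      Nat.card V * (1 - 1 / (4 * (M : ℝ))) ^ ((L + 1) / 2) := by
  have hM : (1 : ℝ) ≤ M := by exact_mod_cast NeZero.one_le
  have hq0 : 0 ≤ 1 - 1 / (4 * (M : ℝ)) := by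
    rw [sub_nonneg, div_le_one (by positivity)]
    linarith
  let G := N.colorGraph φ c
  refine (prob_mono (Q := fun lab => ∃ x, ∃ p : G.Walk v x, p.IsPath ∧ p.length = L + 1 ∧
    ∀ i ∈ Finset.range ((L + 1) / 2), (N.colorGraph (N.survivor Own lab φ) (some c)).Adj
      (p.getVert (2 * i)) (p.getVert (2 * i + 1))) fun lab h => ?_).trans
    (prob_exists_le_card _ fun x => ?_)
  · obtain ⟨x, p, hp, hL⟩ := h.exists_isPath
    have hle : N.colorGraph (N.survivor Own lab φ) (some c) ≤ G :=
      fun v w ⟨e, he, hec⟩ => ⟨e, he, ((survivor_eq_some he).1 hec).1⟩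
    refine ⟨x, p.mapLe hle, hp.mapLe hle, by rw [SimpleGraph.Walk.length_mapLe, hL], ?_⟩
    intro i hi
    have hi' := Finset.mem_range.1 hi
    have := p.adj_getVert_succ (i := 2 * i) (by omega)
    simpa [SimpleGraph.Walk.mapLe, SimpleGraph.Walk.getVert_map] using this
  · by_cases hex : ∃ p : G.Walk v x, p.IsPath ∧ p.length = L + 1
    · obtain ⟨p, hp, hL⟩ := hex
      have h1 := prob_forall_mem_le (V := V) (Ω := Bool × Fin M)
        (P := fun (i : ℕ) lab => (N.colorGraph (N.survivor Own lab φ) (some c)).Adj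
          (p.getVert (2 * i)) (p.getVert (2 * i + 1)))
        (S := fun i => {p.getVert (2 * i), p.getVert (2 * i + 1)})
        (q := 1 - 1 / (4 * (M : ℝ))) (fun i => dependsOn_survivor_adj)
        (Finset.range ((L + 1) / 2)) ?_ ?_ hq0
      · rw [Finset.card_range] at h1
        refine le_trans (prob_mono fun lab h => ?_) h1
        obtain ⟨p', hp', _, h⟩ := h
        have : p = p' := congrArg Subtype.val ((hF.2.subsingleton_path v x).elim ⟨p, hp⟩ ⟨p', hp'⟩)
        rwa [this]
      · intro i hi j hj hij
        have hi' := Finset.mem_range.1 hi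
        have hj' := Finset.mem_range.1 hj
        have hne : ∀ a b, a ≤ L + 1 → b ≤ L + 1 → a ≠ b → p.getVert a ≠ p.getVert b := by
          intro a b ha hb hab h
          exact hab (hp.getVert_injOn (by simpa [hL] using ha) (by simpa [hL] using hb) h)
        rw [Set.disjoint_left]
        intro u hu hu'
        simp only [Set.mem_insert_iff, Set.mem_singleton_iff] at hu hu'
        rcases hu with rfl | rfl <;> rcases hu' with h | h <;>
          exact hne _ _ (by omega) (by omega) (by omega) h
      · intro i hi
        have hi' := Finset.mem_range.1 hi
        exact prob_survivor_adj_le hF hown (p.adj_getVert_succ (by omega))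
    · refine le_trans (le_of_eq ?_) (pow_nonneg hq0 ((L + 1) / 2))
      unfold prob
      rw [Nat.cast_eq_zero.2, zero_div]
      rw [Nat.card_eq_zero]
      exact Or.inl ⟨fun lab => hex ⟨lab.2.choose, lab.2.choose_spec.1, lab.2.choose_spec.2.1⟩⟩

/-- With high probability, all vertices own few residual edges. -/
theorem prob_residual_le [Finite E] [NeZero M] {L T T₀ : ℕ} (hF : ∀ c, N.ForestClass φ c)
    (hown : ∀ v e, N.graph.Inc e v → Own v e ∨ Own (N.neighbor v e) e)
    (hT₀ : ∀ v, {e | N.graph.Inc e v ∧ Own v e}.ncard ≤ T₀) :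
    prob (fun lab : V → Bool × Fin M =>
      ∃ v, T < {e | N.graph.Inc e v ∧ N.Residual Own lab φ L v e}.ncard) ≤
      Nat.card V * (T₀ * (2 * (Nat.card V * (1 - 1 / (4 * (M : ℝ))) ^ ((L + 1) / 2))) /
        (T + 1)) := by
  have hM : (1 : ℝ) ≤ M := by exact_mod_cast NeZero.one_le
  have hq0 : 0 ≤ 1 - 1 / (4 * (M : ℝ)) := by
    rw [sub_nonneg, div_le_one (by positivity)]
    linarith
  set q := (Nat.card V : ℝ) * (1 - 1 / (4 * (M : ℝ))) ^ ((L + 1) / 2) with hq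
  refine prob_exists_le_card _ fun v => ?_
  have h1 := prob_lt_ncard_le (W := V → Bool × Fin M)
    (fun e lab => N.Residual Own lab φ L v e) {e | N.graph.Inc e v ∧ Own v e} T (p := 2 * q)
    fun e he => ?_
  · refine le_trans (prob_mono fun lab h => ?_) (h1.trans ?_)
    · refine h.trans_le (Set.ncard_le_ncard ?_ (Set.toFinite _))
      rintro e ⟨he, hr⟩
      exact ⟨⟨he, hr.1⟩, hr⟩
    · have : (({e | N.graph.Inc e v ∧ Own v e}.ncard : ℕ) : ℝ) ≤ T₀ := by exact_mod_cast hT₀ v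
      gcongr
  -- A surviving edge has its input color, so only that class matters: two events per edge, one for
  -- each endpoint, instead of a union over all colors.
  · have h2 : ∀ lab : V → Bool × Fin M, N.Residual Own lab φ L v e →
        (N.colorGraph (N.survivor Own lab φ) (some (φ e))).Far L v ∨
        (N.colorGraph (N.survivor Own lab φ) (some (φ e))).Far L (N.neighbor v e) := by
      rintro lab ⟨_, h1, h2⟩
      obtain ⟨c, hc⟩ := Option.ne_none_iff_exists'.1 h1
      obtain ⟨rfl, _⟩ := (survivor_eq_some (N.isLink_neighbor he.1)).1 hc
      rwa [hc] at h2
    rw [two_mul]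
    exact (prob_mono h2).trans (prob_or_le.trans (add_le_add (prob_far_le v (hF _) hown)
      (prob_far_le _ (hF _) hown)))

end PortNetwork

/-! ### The cut coloring is local -/

section

variable {M r : ℕ} {Own : (I : Inst Ω) → I.V → I.E → Prop} {lab : (I : Inst Ω) → I.V → Bool × Fin M}
  {φ : (I : Inst Ω) → I.E → ℕ}

theorem PortNetwork.cut_local (hown : DartLocal r Own) (hlab : VertexLocal r lab) :
    DartLocal (r + 1) (fun I v e => I.N.Cut (Own I) (lab I) v e) := by
  have h1 := (hown.map₂ (slot_local hown) Prod.mk).succ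
  have h2 := (DartLocal.ofVertex hlab).succ
  have h3 := (DartLocal.ofVertex hlab).swap
  exact (h1.map₂ (h2.map₂ h3 Prod.mk) fun x y => x.1 ∧ y.1.1 = true ∧ y.2.1 = false ∧
    x.2 % M = y.1.2)

theorem PortNetwork.cutColor_local (hex : ∀ I : Inst Ω, I.N.ExclusiveCharge (Own I))
    (hown : DartLocal r Own) (hlab : VertexLocal r lab) :
    EdgeLocal (r + 2) (fun I => I.N.cutColor (Own I) (lab I)) :=
  chargeValue_local (fun I => exclusiveCharge_cut (hex I)) (cut_local hown hlab)
    (((slot_local hown).mono (by omega)).map fun x => x / M)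

theorem PortNetwork.survivor_local (hex : ∀ I : Inst Ω, I.N.ExclusiveCharge (Own I))
    (hown : DartLocal r Own) (hlab : VertexLocal r lab) (hφ : EdgeLocal r φ) :
    EdgeLocal (r + 2) (fun I => I.N.survivor (Own I) (lab I) (φ I)) :=
  DartLocal.map₂ (cutColor_local hex hown hlab) (DartLocal.mono hφ (by omega))
    fun o x => o.elim (some x) fun _ => none

/-- Vertices recognize each other by their identifiers. -/
theorem VertexLocal.far {ψ : (I : Inst Ω) → I.E → α} (hψ : EdgeLocal r ψ) (L : ℕ) :
    VertexLocal (r + (L + 1)) (fun I v c => (I.N.colorGraph (ψ I) c).Far L v) := by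
  have h := (VertexLocal.id (Ω := Ω) (r := r)).image_closedBall hψ
  convert (h (L + 1)).map₂ ((h L).mono (by omega : r + L ≤ r + (L + 1)))
    (fun f g c => f c ≠ g c) using 4 with I v c
  rw [SimpleGraph.Far, ne_eq, ne_eq, Set.image_eq_image I.N.id_injective]

theorem PortNetwork.residual_local (hex : ∀ I : Inst Ω, I.N.ExclusiveCharge (Own I))
    (hown : DartLocal r Own) (hlab : VertexLocal r lab) (hφ : EdgeLocal r φ) (L : ℕ) :
    DartLocal (r + L + 4) (fun I => I.N.Residual (Own I) (lab I) (φ I) L) := by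
  have h1 := survivor_local hex hown hlab hφ
  have h2 := DartLocal.ofVertex (VertexLocal.far h1 L)
  have h3 := (h2.succ.map₂ h2.swap Prod.mk).map₂ (hown.mono (by omega : r ≤ r + 2 + (L + 1) + 1))
    Prod.mk
  refine DartLocal.mono ((h3.map₂ (DartLocal.mono h1 (by omega : r + 2 ≤ r + 2 + (L + 1) + 1))
    (fun x o => x.2 ∧ o ≠ none ∧ (x.1.1 o ∨ x.1.2 o)))) (by omega)

theorem PortNetwork.cutColoring_local (hex : ∀ I : Inst Ω, I.N.ExclusiveCharge (Own I))
    (hown : DartLocal r Own) (hlab : VertexLocal r lab) (hφ : EdgeLocal r φ) (k t L m : ℕ) :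
    EdgeLocal (r + L + m + 6) (fun I => I.N.cutColoring (Own I) (lab I) (φ I) k t L m) := by
  have h1 := chargeColor_local (fun I => exclusiveCharge_residual (lab := lab I) (φ := φ I)
    (L := L) (hex I)) (residual_local hex hown hlab hφ L) m
  have h2 := DartLocal.map₂ (DartLocal.mono (r' := r + L + m + 6) h1 (by omega))
    (DartLocal.mono hφ (by omega)) (fun o x => o.elim x fun q => k + t + q)
  exact DartLocal.map₂ (DartLocal.mono (cutColor_local hex hown hlab) (by omega)) h2
    fun o x => o.elim x fun s => k + s

end

/-! ### Parameters of the first stage -/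

/-- A power of two of order `1 / ε`. -/
noncomputable def dyadicAbove (x : ℝ) : ℕ := 2 ^ Nat.clog 2 ⌈x⌉₊

theorem le_dyadicAbove (x : ℝ) : x ≤ dyadicAbove x :=
  (Nat.le_ceil x).trans (Nat.cast_le.2 (Nat.le_pow_clog (by norm_num) _))

theorem dyadicAbove_pos (x : ℝ) : 0 < dyadicAbove x := by unfold dyadicAbove; positivity

instance (x : ℝ) : NeZero (dyadicAbove x) := ⟨(dyadicAbove_pos x).ne'⟩

theorem dyadicAbove_le {x : ℝ} (hx : 1 < x) : (dyadicAbove x : ℝ) ≤ 2 * (x + 1) := by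
  have h1 : 1 < ⌈x⌉₊ := Nat.lt_ceil.2 (by simpa using hx)
  have h2 := Nat.pow_pred_clog_lt_self (b := 2) (by norm_num) h1
  have h3 : dyadicAbove x = 2 * 2 ^ (Nat.clog 2 ⌈x⌉₊).pred := by
    have := Nat.clog_pos (b := 2) (by norm_num) h1
    unfold dyadicAbove
    rw [← pow_succ']
    congr 1
    rw [Nat.pred_eq_sub_one]
    omega
  have h4 : (⌈x⌉₊ : ℝ) < x + 1 := Nat.ceil_lt_add_one (by linarith)
  have h5 : ((2 ^ (Nat.clog 2 ⌈x⌉₊).pred : ℕ) : ℝ) < ⌈x⌉₊ := by exact_mod_cast h2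
  rw [h3, Nat.cast_mul, Nat.cast_ofNat]
  linarith

/-- The radius of the components after the first stage. -/
noncomputable def stageRadius (n c : ℕ) (ε : ℝ) : ℕ := ⌈136 * (c + 10) * (Real.log n / ε)⌉₊

section

variable {n : ℕ} {ε : ℝ}

theorem log_two_le_log (hn : 2 ≤ n) : Real.log 2 ≤ Real.log n :=
  Real.log_le_log (by norm_num) (by exact_mod_cast hn)

theorem one_le_log_div (hn : 2 ≤ n) (hε : 0 < ε) (hε' : ε < 1 / 2) : 1 ≤ Real.log n / ε := by
  rw [le_div_iff₀ hε]
  linarith [log_two_le_log hn, Real.log_two_gt_d9]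

theorem natLog_le (hn : 2 ≤ n) (hε : 0 < ε) (hε' : ε < 1 / 2) :
    (Nat.log 2 n : ℝ) ≤ Real.log n / ε := by
  have h1 : (Nat.log 2 n : ℝ) * Real.log 2 ≤ Real.log n := by
    rw [← Real.log_pow]
    refine Real.log_le_log (by positivity) ?_
    exact_mod_cast Nat.pow_log_le_self 2 (by omega)
  have h2 := Real.log_two_gt_d9
  have h3 : (0 : ℝ) ≤ Nat.log 2 n := by positivity
  rw [le_div_iff₀ hε]
  nlinarith

theorem stageRadius_le (hn : 2 ≤ n) (c : ℕ) (hε : 0 < ε) (hε' : ε < 1 / 2) :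
    (stageRadius n c ε : ℝ) ≤ (136 * (c + 10) + 1) * (Real.log n / ε) := by
  have h1 := one_le_log_div hn hε hε'
  have h2 := Nat.ceil_lt_add_one (a := 136 * ((c : ℝ) + 10) * (Real.log n / ε)) (by positivity)
  unfold stageRadius
  linarith

theorem le_stageRadius (n c : ℕ) (ε : ℝ) :
    136 * ((c : ℝ) + 10) * (Real.log n / ε) ≤ stageRadius n c ε := Nat.le_ceil _

/-- Since M ≤ 17/ε, and the path contains at least L/2 disjoint edges, survival has probability at
most exp(-(L/2)ε/68). This explains the factor 136 in `stageRadius`. -/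
theorem survival_le (hn : 2 ≤ n) (c : ℕ) (hε : 0 < ε) (hε' : ε < 1 / 2) :
    (1 - 1 / (4 * (dyadicAbove (8 / ε) : ℝ))) ^ ((stageRadius n c ε + 1) / 2) ≤
      1 / (n : ℝ) ^ (c + 10) := by
  set M := dyadicAbove (8 / ε)
  set L := stageRadius n c ε
  have hM0 : (1 : ℝ) ≤ M := by exact_mod_cast dyadicAbove_pos (8 / ε)
  have hM : (M : ℝ) ≤ 17 / ε := by
    have h8 : 1 < 8 / ε := by rw [lt_div_iff₀ hε]; linarith
    refine (dyadicAbove_le h8).trans ?_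
    have : 2 ≤ 1 / ε := by rw [le_div_iff₀ hε]; linarith
    have h1 : 17 / ε = 2 * (8 / ε) + 1 / ε := by ring
    linarith
  have hn0 : (0 : ℝ) < n := by exact_mod_cast (by omega : 0 < n)
  have hL : (L : ℝ) / 2 ≤ ((L + 1) / 2 : ℕ) := by
    rw [div_le_iff₀ (by norm_num)]
    exact_mod_cast (by omega : L ≤ (L + 1) / 2 * 2)
  have hq0 : 0 ≤ 1 - 1 / (4 * (M : ℝ)) := by
    rw [sub_nonneg, div_le_one (by positivity)]
    linarith
  calc (1 - 1 / (4 * (M : ℝ))) ^ ((L + 1) / 2) ≤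
        Real.exp (-(1 / (4 * (M : ℝ)))) ^ ((L + 1) / 2) := by
        refine pow_le_pow_left₀ hq0 ?_ _
        linarith [Real.add_one_le_exp (-(1 / (4 * (M : ℝ))))]
    _ = Real.exp (-(((L + 1) / 2 : ℕ) / (4 * (M : ℝ)))) := by
        rw [← Real.exp_nat_mul]
        congr 1
        ring
    _ ≤ Real.exp (-((c + 10 : ℕ) * Real.log n)) := by
        rw [Real.exp_le_exp, neg_le_neg_iff, le_div_iff₀ (by positivity)]
        have h1 := le_stageRadius n c ε
        have hlog : 0 ≤ Real.log n := Real.log_natCast_nonneg n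
        calc ((c + 10 : ℕ) : ℝ) * Real.log n * (4 * M) ≤
              ((c + 10 : ℕ) : ℝ) * Real.log n * (4 * (17 / ε)) := by gcongr
          _ = 136 * ((c : ℝ) + 10) * (Real.log n / ε) / 2 := by
              push_cast
              ring
          _ ≤ (L : ℝ) / 2 := by linarith
          _ ≤ _ := hL
    _ = 1 / (n : ℝ) ^ (c + 10) := by
        rw [Real.exp_neg, Real.exp_nat_mul, Real.exp_log hn0, one_div]

/-- The ratio 4a/(T + 1) is at most 64/ε ≤ 64n, so `a` cancels. What remains is at most 128
n³/n^(c+10), and 128 ≤ n^7. -/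
theorem failure_le {N a : ℕ} (hN : N ≤ n) (hn : 2 ≤ n) (c : ℕ) (hε : 0 < ε) (hε' : ε < 1 / 2)
    (hεn : 1 / ε < n) :
    (N : ℝ) * ((4 * a : ℕ) * (2 * (N * (1 - 1 / (4 * (dyadicAbove (8 / ε) : ℝ))) ^
      ((stageRadius n c ε + 1) / 2))) / (⌊ε * a / 16⌋₊ + 1)) ≤ 1 / (n : ℝ) ^ c := by
  have hn2 : (2 : ℝ) ≤ n := by exact_mod_cast hn
  have hn0 : (0 : ℝ) < n := by linarith
  have hN' : (N : ℝ) ≤ n := by exact_mod_cast hN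
  have hT : ε * a / 16 ≤ ⌊ε * a / 16⌋₊ + 1 := (Nat.lt_floor_add_one _).le
  have hT0 : (0 : ℝ) < ⌊ε * a / 16⌋₊ + 1 := by positivity
  have h1 : ((4 * a : ℕ) : ℝ) / (⌊ε * a / 16⌋₊ + 1) ≤ 64 * n := by
    rw [div_le_iff₀ hT0]
    have h2 : (a : ℝ) ≤ n * (ε * a) := by
      have : 1 ≤ n * ε := by
        rw [div_lt_iff₀ hε] at hεn
        exact hεn.le
      have ha : (0 : ℝ) ≤ a := by positivity
      nlinarith
    push_cast
    nlinarith
  have hq := survival_le hn c hε hε'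
  set q := (1 - 1 / (4 * (dyadicAbove (8 / ε) : ℝ))) ^ ((stageRadius n c ε + 1) / 2)
  have hq0 : 0 ≤ q := by
    have hM : (1 : ℝ) ≤ dyadicAbove (8 / ε) := by exact_mod_cast dyadicAbove_pos (8 / ε)
    refine pow_nonneg ?_ _
    rw [sub_nonneg, div_le_one (by positivity)]
    linarith
  calc (N : ℝ) * ((4 * a : ℕ) * (2 * (N * q)) / (⌊ε * a / 16⌋₊ + 1)) =
        N * N * 2 * q * ((4 * a : ℕ) / (⌊ε * a / 16⌋₊ + 1)) := by ring
    _ ≤ n * n * 2 * (1 / (n : ℝ) ^ (c + 10)) * (64 * n) := by gcongr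
    _ = 2 ^ 7 * (n : ℝ) ^ 3 / (n : ℝ) ^ (c + 10) := by ring
    _ ≤ (n : ℝ) ^ 7 * (n : ℝ) ^ 3 / (n : ℝ) ^ (c + 10) := by gcongr
    _ = 1 / (n : ℝ) ^ c := by
        rw [← pow_add, pow_add _ c 10, div_eq_div_iff (by positivity) (by positivity)]
        ring

end

/-! ### Analysis of the first stage -/

namespace SimpleGraph

theorem diamLE_card {V : Type*} [Finite V] (H : SimpleGraph V) : H.DiamLE (Nat.card V) := by
  classical
  have := Fintype.ofFinite V
  intro u v huv
  obtain ⟨p, hp, _⟩ := huv.exists_path_of_dist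
  refine ⟨p, ?_⟩
  rw [Nat.card_eq_fintype_card]
  exact hp.length_lt.le

end SimpleGraph

namespace PortNetwork

variable {V E : Type} (N : PortNetwork V E)

open Classical in
/-- The coloring computed in the first stage. -/
noncomputable def stageOne (n a k d c : ℕ) (ε : ℝ)
    (lab : V → Bool × Fin (dyadicAbove (8 / ε))) (φ : E → ℕ) : E → ℕ :=
  if 1 / ε < n then
    N.cutColoring (N.Owns (4 * a) (Nat.log 2 n + 1)) lab φ k ⌈ε * a / 2⌉₊ (stageRadius n c ε)
      (d * (Nat.log 2 n + 1))
  else φ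

variable {N}

theorem pow_le_two_pow (n d : ℕ) : n ^ d ≤ 2 ^ (d * (Nat.log 2 n + 1)) := by
  rw [mul_comm, pow_mul]
  exact Nat.pow_le_pow_left (Nat.lt_pow_succ_log_self (by norm_num) n).le d

/-- The budget ⌈εa⌉ is shared by ⌈εa/2⌉ colors for cut edges and 8⌊εa/16⌋ for residual ones. If 1/ε
≥ n, the trivial diameter bound n is below `stageRadius`, and the input is returned unchanged. -/
theorem prob_not_goodColoring_stageOne_le [Finite V] [Finite E] {n a k d c : ℕ} {ε : ℝ}
    {φ : E → ℕ} (hn : 2 ≤ n) (hε : 0 < ε) (hε' : ε < 1 / 2) (hV : Nat.card V ≤ n)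
    (ha : N.graph.arboricity ≤ a) (hid : ∀ v, N.id v < n ^ d)
    (hφ : N.graph.IsForestDecomposition k φ) :
    prob (fun lab : V → Bool × Fin (dyadicAbove (8 / ε)) =>
      ¬ N.GoodColoring (k + ⌈ε * a⌉₊) (stageRadius n c ε) (N.stageOne n a k d c ε lab φ)) ≤
      1 / (n : ℝ) ^ c := by
  have hX := one_le_log_div hn hε hε'
  have hR := le_stageRadius n c ε
  have hF : ∀ c, N.ForestClass φ c := fun c => forestClass_iff.2 (hφ.2 c)
  have hc0 : (0 : ℝ) ≤ c := by positivity
  have hR2 : 2 ≤ stageRadius n c ε := by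
    have : (2 : ℝ) ≤ stageRadius n c ε := by nlinarith
    exact_mod_cast this
  by_cases hεn : 1 / ε < n
  · have hex : N.ExclusiveCharge (N.Owns (4 * a) (Nat.log 2 n + 1)) := fun v e he h h' =>
      (N.owns_neighbor_iff he).1 h' h
    have hown : ∀ v e, N.graph.Inc e v → N.Owns (4 * a) (Nat.log 2 n + 1) v e ∨
        N.Owns (4 * a) (Nat.log 2 n + 1) (N.neighbor v e) e := fun v e he => by
      by_cases h : N.Owns (4 * a) (Nat.log 2 n + 1) v e
      · exact Or.inl h
      · exact Or.inr ((N.owns_neighbor_iff he).2 h)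
    have hT₀ := N.ncard_owns_le hV ha hφ
    refine le_trans (prob_mono fun lab h => ?_)
      ((prob_residual_le (φ := φ) (M := dyadicAbove (8 / ε)) (L := stageRadius n c ε)
        (T := ⌊ε * a / 16⌋₊) hF hown hT₀).trans (failure_le hV hn c hε hε' hεn))
    by_contra hcon
    push Not at hcon
    refine h ?_
    unfold stageOne
    rw [if_pos hεn]
    refine (goodColoring_cutColoring hφ.1 hF hex hown hT₀ ?_
      (fun v => (hid v).trans_le (pow_le_two_pow n d)) hcon).mono ?_ (max_le hR2 le_rfl)
    · have h1 : ε * a / 2 ≤ ⌈ε * a / 2⌉₊ := Nat.le_ceil _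
      have h2 := le_dyadicAbove (8 / ε)
      have h3 : ((4 * a : ℕ) : ℝ) ≤ ((⌈ε * a / 2⌉₊ * dyadicAbove (8 / ε) : ℕ) : ℝ) := by
        push_cast
        calc (4 : ℝ) * a = ε * a / 2 * (8 / ε) := by field_simp; ring
          _ ≤ _ := by gcongr
      exact_mod_cast h3
    · have h1 : 8 * ⌊ε * a / 16⌋₊ ≤ ⌊ε * a / 2⌋₊ := by
        refine Nat.le_floor ?_
        have := Nat.floor_le (a := ε * a / 16) (by positivity)
        push_cast
        linarith
      have h2 : ⌈ε * a / 2⌉₊ + ⌊ε * a / 2⌋₊ ≤ ⌈ε * a⌉₊ := by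
        have h3 := Nat.ceil_lt_add_one (a := ε * a / 2) (by positivity)
        have h4 := Nat.floor_le (a := ε * a / 2) (by positivity)
        have h5 := Nat.le_ceil (ε * a)
        have h6 : ((⌈ε * a / 2⌉₊ + ⌊ε * a / 2⌋₊ : ℕ) : ℝ) < ((⌈ε * a⌉₊ + 1 : ℕ) : ℝ) := by
          push_cast
          linarith
        exact Nat.lt_succ_iff.1 (by exact_mod_cast h6)
      omega
  · have hgood : ∀ lab, N.GoodColoring (k + ⌈ε * a⌉₊) (stageRadius n c ε)
        (N.stageOne n a k d c ε lab φ) := by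
      intro lab
      unfold stageOne
      rw [if_neg hεn]
      refine ⟨fun e he => (hφ.1 e he).trans_le (Nat.le_add_right _ _), fun c' => ⟨hF c',
        SimpleGraph.DiamLE.mono (SimpleGraph.diamLE_card _) (hV.trans ?_)⟩⟩
      have h1 : (n : ℝ) ≤ stageRadius n c ε := by
        have h2 : 1 / ε / 2 ≤ Real.log n / ε := by
          rw [div_div, div_le_div_iff₀ (by positivity) hε]
          nlinarith [log_two_le_log hn, Real.log_two_gt_d9]
        have h3 := not_lt.1 hεn
        nlinarith
      exact_mod_cast h1
    exact (prob_eq_zero fun lab h => h (hgood lab)).trans_le (by positivity)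

theorem stageOne_local (n a k d c : ℕ) (ε : ℝ)
    {lab : (I : Inst Ω) → I.V → Bool × Fin (dyadicAbove (8 / ε))} (hlab : VertexLocal 0 lab) :
    EdgeLocal (Nat.log 2 n + 2 + stageRadius n c ε + d * (Nat.log 2 n + 1) + 6)
      (fun I => I.N.stageOne n a k d c ε (lab I) I.φ) := by
  unfold stageOne
  split_ifs with h
  · refine cutColoring_local (fun I v e he h h' => (I.N.owns_neighbor_iff he).1 h' h)
      (owns_local _ _) (hlab.mono (Nat.zero_le _)) DartLocal.input _ _ _ _
  · exact DartLocal.input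

end PortNetwork

/-! ### Repairing overloaded vertices -/

namespace PortNetwork

variable {V E : Type} (N : PortNetwork V E) {K R : ℕ} (lev : V → Fin K → Option (Fin R))
  (anc : V → Fin K → V) (t s : ℕ)

/-- More than `t` of the classes are hit at `v`. -/
def Overloaded (ω : V → Fin K → Fin R) (v : V) : Prop :=
  t < {c | lev v c = some (ω (anc v c) c)}.ncard

/-- All that has to be known about a vertex to decide which of its classes are hit. -/
def profile (v : V) (c : Fin K) : Option (Fin R) × ℕ := (lev v c, N.id (anc v c))

/-- Values, indexed by identifiers, for which no vertex with a profile in `S` is overloaded. -/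
def Relieves (S : Set (Fin K → Option (Fin R) × ℕ)) (J : ℕ → Fin K → Fin R) : Prop :=
  ∀ ℓ ∈ S, {c | (ℓ c).1 = some (J (ℓ c).2 c)}.ncard ≤ t

variable {N lev anc t s}

theorem dependsOn_overloaded (v : V) :
    DependsOn (fun ω => Overloaded lev anc t ω v) (Set.range (anc v)) := by
  intro ω ω' h
  unfold Overloaded
  simp only [h _ (Set.mem_range_self _)]

/-- Whether a vertex is overloaded depends only on labels within distance R, so vertices more than
2R apart are overloaded independently. -/
theorem disjoint_range_anc (hanc : ∀ v c, anc v c ∈ N.baseGraph.closedBall R v) {x y : V}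
    (h : y ∉ N.baseGraph.closedBall (2 * R) x) : Disjoint (Set.range (anc x)) (Set.range (anc y)) := by
  rw [Set.disjoint_left]
  rintro _ ⟨c, rfl⟩ ⟨c', hc⟩
  refine h ?_
  rw [two_mul]
  refine SimpleGraph.mem_closedBall_trans (hanc x c) (SimpleGraph.mem_closedBall_comm.1 ?_)
  rw [← hc]
  exact hanc y c'

/-- A cluster of larger diameter contains s + 1 overloaded vertices that are pairwise more than 2R
apart, with successive ones at distance at most 4R. The union bound runs over such chains. -/
theorem prob_not_diamLE_le [Finite V] (hanc : ∀ v c, anc v c ∈ N.baseGraph.closedBall R v) {D : ℕ}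
    (hD : ∀ v, (N.baseGraph.closedBall (2 * (2 * R)) v).ncard ≤ D) {p : ℝ}
    (hp : ∀ v, prob (fun ω => Overloaded lev anc t ω v) ≤ p) :
    prob (fun ω => ¬ (N.baseGraph.closeGraph (Overloaded lev anc t ω) (2 * R)).DiamLE (2 * s)) ≤
      Nat.card V * D ^ s * p ^ (s + 1) := by
  refine le_trans (prob_mono fun ω h => ?_) (prob_exists_chain_le dependsOn_overloaded s hD hp)
  unfold SimpleGraph.DiamLE at h
  push Not at h
  obtain ⟨x, y, hxy, hy⟩ := h
  obtain ⟨f, h1, h2, h3⟩ := SimpleGraph.exists_chain_of_closeGraph hxy hy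
  exact ⟨f, h1, fun i hi j hj hij => disjoint_range_anc hanc (h2 i hi j hj hij), h3⟩

variable (N lev anc t s) [NeZero R]

/-- Values that relieve all the vertices at distance at most `(2 * s + 1) * (2 * R)` from `v`. -/
noncomputable def patch (v : V) : ℕ → Fin K → Fin R :=
  Classical.epsilon (Relieves t
    (N.profile lev anc '' N.baseGraph.closedBall ((2 * s + 1) * (2 * R)) v))

variable (ω : V → Fin K → Fin R)

/-- The values on which a component of overloaded vertices agrees. -/
noncomputable def agreedPatch (v : V) : ℕ → Fin K → Fin R :=
  Classical.epsilon fun J => J ∈ N.patch lev anc t s ''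
    (N.baseGraph.closeGraph (Overloaded lev anc t ω) (2 * R)).closedBall (2 * s) v

/-- The classes in which `v` is cut from its parent. -/
def Selected (v : V) (c : Fin K) : Prop :=
  (¬ Overloaded lev anc t ω v ∧ lev v c = some (ω (anc v c) c)) ∨
    ∃ x ∈ N.baseGraph.closedBall R v, Overloaded lev anc t ω x ∧
      lev v c = some (N.agreedPatch lev anc t s ω x (N.id (anc v c)) c)

variable {N lev anc t s ω}

/-- A global choice without overload, rewritten in terms of identifiers, shows that the local
requirement can be met. The choice itself need not be computed: any solution on the ball will do,
and the ball determines the one picked by `Classical.epsilon`. -/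
theorem relieves_patch {ω₀ : V → Fin K → Fin R} (h₀ : ∀ v, ¬ Overloaded lev anc t ω₀ v) (v : V) :
    Relieves t (N.profile lev anc '' N.baseGraph.closedBall ((2 * s + 1) * (2 * R)) v)
      (N.patch lev anc t s v) := by
  have : Nonempty V := ⟨v⟩
  refine Classical.epsilon_spec (p := Relieves t _) ⟨fun i => ω₀ (Function.invFun N.id i), ?_⟩
  rintro _ ⟨y, _, rfl⟩
  have := not_lt.1 (h₀ y)
  simp only [profile, Function.leftInverse_invFun N.id_injective _]
  exact this

theorem agreedPatch_mem (v : V) : N.agreedPatch lev anc t s ω v ∈ N.patch lev anc t s ''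
    (N.baseGraph.closeGraph (Overloaded lev anc t ω) (2 * R)).closedBall (2 * s) v :=
  Classical.epsilon_spec (p := fun J => J ∈ N.patch lev anc t s ''
    (N.baseGraph.closeGraph (Overloaded lev anc t ω) (2 * R)).closedBall (2 * s) v)
    ⟨_, v, SimpleGraph.mem_closedBall_self _ v, rfl⟩

theorem mem_closedBall_of_closeGraph {H : SimpleGraph V} {B : V → Prop} {ρ i : ℕ} {x y : V}
    (h : y ∈ (H.closeGraph B ρ).closedBall i x) : y ∈ H.closedBall (i * ρ) x := by
  induction i generalizing x with
  | zero =>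
    rw [SimpleGraph.closedBall_zero] at h
    rw [Set.mem_singleton_iff.1 h]
    exact SimpleGraph.mem_closedBall_self _ _
  | succ i ih =>
    rcases SimpleGraph.mem_closedBall_succ.1 h with rfl | ⟨w, hw, hy⟩
    · exact SimpleGraph.mem_closedBall_self _ _
    · have := SimpleGraph.mem_closedBall_trans hw.2.2.2 (ih hy)
      rwa [Nat.succ_mul, add_comm]

/-- The random choice contributes at most t classes, and none at an overloaded vertex. All
overloaded vertices near v belong to one cluster and use one patch, which contributes at most t
more. -/
theorem ncard_selected_le {ω₀ : V → Fin K → Fin R} (h₀ : ∀ v, ¬ Overloaded lev anc t ω₀ v)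
    (hs : (N.baseGraph.closeGraph (Overloaded lev anc t ω) (2 * R)).DiamLE (2 * s)) (v : V) :
    {c | N.Selected lev anc t s ω v c}.ncard ≤ 2 * t := by
  have h1 : {c | ¬ Overloaded lev anc t ω v ∧ lev v c = some (ω (anc v c) c)}.ncard ≤ t := by
    by_cases h : Overloaded lev anc t ω v
    · simp [h]
    · simpa only [h, not_false_eq_true, true_and] using not_lt.1 h
  have h2 : {c | ∃ x ∈ N.baseGraph.closedBall R v, Overloaded lev anc t ω x ∧
      lev v c = some (N.agreedPatch lev anc t s ω x (N.id (anc v c)) c)}.ncard ≤ t := by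
    by_cases hx : ∃ x ∈ N.baseGraph.closedBall R v, Overloaded lev anc t ω x
    · obtain ⟨x, hx, hxo⟩ := hx
      have hagree : ∀ y ∈ N.baseGraph.closedBall R v, Overloaded lev anc t ω y →
          N.agreedPatch lev anc t s ω y = N.agreedPatch lev anc t s ω x := by
        intro y hy hyo
        have hxy : (N.baseGraph.closeGraph (Overloaded lev anc t ω) (2 * R)).Reachable x y := by
          by_cases he : x = y
          · exact he ▸ SimpleGraph.Reachable.refl _
          · refine SimpleGraph.Adj.reachable ⟨he, hxo, hyo, ?_⟩
            rw [two_mul]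
            exact SimpleGraph.mem_closedBall_trans (SimpleGraph.mem_closedBall_comm.1 hx) hy
        -- By the diameter bound both balls are the whole cluster, so both vertices choose from the
        -- same set of patches.
        have hball : (N.baseGraph.closeGraph (Overloaded lev anc t ω) (2 * R)).closedBall (2 * s) y =
            (N.baseGraph.closeGraph (Overloaded lev anc t ω) (2 * R)).closedBall (2 * s) x := by
          ext z
          exact ⟨fun ⟨p, _⟩ => hs _ _ (hxy.trans ⟨p⟩), fun ⟨p, _⟩ => hs _ _ (hxy.symm.trans ⟨p⟩)⟩
        unfold agreedPatch
        rw [hball]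
      obtain ⟨z, hz, hJ⟩ := agreedPatch_mem (N := N) (lev := lev) (anc := anc) (t := t) (s := s)
        (ω := ω) x
      refine le_trans (Set.ncard_le_ncard ?_ (Set.toFinite _))
        (relieves_patch (N := N) (s := s) h₀ z (N.profile lev anc v) ⟨v, ?_, rfl⟩)
      · rintro c ⟨y, hy, hyo, hc⟩
        rw [hagree y hy hyo, ← hJ] at hc
        exact hc
      -- The patch may come from a vertex z at the other end of the cluster. From z to x the
      -- distance is at most 2s · 2R, and from x to v at most R; the radius in `patch` covers this.
      · have h3 := SimpleGraph.mem_closedBall_comm.1 (mem_closedBall_of_closeGraph hz)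
        refine SimpleGraph.closedBall_mono ?_ _
          (SimpleGraph.mem_closedBall_trans h3 (SimpleGraph.mem_closedBall_comm.1 hx))
        have : (2 * s + 1) * (2 * R) = 2 * s * (2 * R) + 2 * R := Nat.succ_mul _ _
        omega
    · refine le_of_eq_of_le ?_ (Nat.zero_le _)
      rw [Set.ncard_eq_zero (Set.toFinite _)]
      ext c
      simp only [Set.mem_ofPred_eq, Set.mem_empty_iff_false, iff_false]
      rintro ⟨x, h1, h2, _⟩
      exact hx ⟨x, h1, h2⟩
  rw [two_mul]
  exact (Set.ncard_union_le _ _).trans (add_le_add h1 h2)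

/-- If a vertex is responsible for all the levels on a path, then the path is cut. -/
theorem exists_selected {c : Fin K} {z : V} (w : Fin R → V) (hlev : ∀ i, lev (w i) c = some i)
    (hanc : ∀ i, anc (w i) c = z) (hw : ∀ i j, w j ∈ N.baseGraph.closedBall R (w i)) :
    ∃ i, N.Selected lev anc t s ω (w i) c := by
  -- One overloaded vertex on the path suffices: its patch is followed by all vertices within
  -- distance R, hence on the entire path. Otherwise the random value at z cuts the path.
  by_cases h : ∃ i, Overloaded lev anc t ω (w i)
  · obtain ⟨i, hi⟩ := h
    refine ⟨N.agreedPatch lev anc t s ω (w i) (N.id z) c, Or.inr ⟨w i, hw _ _, hi, ?_⟩⟩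
    rw [hlev, hanc]
  · push Not at h
    refine ⟨ω z c, Or.inl ⟨h _, ?_⟩⟩
    rw [hlev, hanc]

variable [Finite V]

/-- Events with overlapping dependence sets are at distance at most 2R. The larger ball is used so
that the same D also bounds the steps of the chains. -/
theorem exists_not_overloaded (hanc : ∀ v c, anc v c ∈ N.baseGraph.closedBall R v) {D : ℕ}
    (hD : ∀ v, (N.baseGraph.closedBall (2 * (2 * R)) v).ncard ≤ D) {p : ℝ}
    (hp : ∀ v, prob (fun ω => Overloaded lev anc t ω v) ≤ p) (h4 : 4 * p * D ≤ 1)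
    (h4' : 4 * p ≤ 1) : ∃ ω₀, ∀ v, ¬ Overloaded lev anc t ω₀ v := by
  refine exists_forall_not_of_prob_le (D := D) dependsOn_overloaded hp (fun v => ?_) h4 h4'
  refine le_trans (Set.ncard_le_ncard (fun y hy => ?_) (Set.toFinite _)) (hD v)
  by_contra h
  exact hy (disjoint_range_anc hanc fun h' =>
    h (SimpleGraph.closedBall_mono (by omega) v h'))

end PortNetwork

/-! ### Locality of the repair -/

theorem VertexLocal.closeGraph {r : ℕ} {F : (I : Inst Ω) → I.V → α} {B : (I : Inst Ω) → I.V → Prop}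
    (hF : VertexLocal r F) (hB : VertexLocal r B) (ρ i : ℕ) :
    VertexLocal (r + i * ρ)
      (fun I v => F I '' (I.N.baseGraph.closeGraph (B I) ρ).closedBall i v) := by
  induction i with
  | zero =>
    convert (hF.map (fun x => ({x} : Set α))).mono (Nat.le_add_right r (0 * ρ)) using 3 with I v
    rw [SimpleGraph.closedBall_zero, Set.image_singleton]
  | succ i ih =>
    have h1 := ((hB.mono (Nat.le_add_right r (i * ρ))).map₂ ih Prod.mk).image_baseBall ρ
    have h2 := h1.map₂ ((hF.map₂ hB Prod.mk).mono (by omega : r ≤ r + i * ρ + ρ))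
      (fun S x => insert x.1 {y | x.2 ∧ ∃ q ∈ S, q.1 ∧ y ∈ q.2})
    rw [Nat.succ_mul, ← add_assoc]
    convert h2 using 3 with I v
    ext y
    simp only [Set.mem_image, SimpleGraph.mem_closedBall_succ, Set.mem_insert_iff,
      Set.mem_ofPred_eq]
    constructor
    · rintro ⟨z, rfl | ⟨w, hw, hz⟩, rfl⟩
      · exact Or.inl rfl
      · exact Or.inr ⟨hw.2.1, _, ⟨w, hw.2.2.2, rfl⟩, hw.2.2.1, z, hz, rfl⟩
    · rintro (rfl | ⟨hv, _, ⟨w, hw, rfl⟩, hBw, z, hz, rfl⟩)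
      · exact ⟨v, Or.inl rfl, rfl⟩
      -- The collected data do not distinguish v from a close overloaded vertex. This is harmless,
      -- as the smaller ball around v lies in the larger one.
      · by_cases he : v = w
        · subst he
          refine ⟨z, ?_, rfl⟩
          have := SimpleGraph.closedBall_mono (Nat.le_succ i) v hz
          exact SimpleGraph.mem_closedBall_succ.1 this
        · exact ⟨z, Or.inr ⟨w, ⟨he, hv, hBw, hw⟩, hz⟩, rfl⟩

namespace PortNetwork

variable {K R r t s : ℕ} {lev : (I : Inst Ω) → I.V → Fin K → Option (Fin R)}
  {anc : (I : Inst Ω) → I.V → Fin K → I.V} {ω : (I : Inst Ω) → I.V → Fin K → Fin R}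

theorem overloaded_local (hlev : VertexLocal (r + R) lev)
    (hanc : ∀ c, VertexLocal (r + R) fun I v => I.N.id (anc I v c))
    (hball : ∀ I v c, anc I v c ∈ I.N.baseGraph.closedBall R v) (hω : VertexLocal r ω) :
    VertexLocal (r + R) fun I => Overloaded (lev I) (anc I) t (ω I) := by
  have h1 : VertexLocal (r + R) fun I v c => ω I (anc I v c) :=
    VertexLocal.pi fun c => hω.lookup (hanc c) fun I v => hball I v c
  exact hlev.map₂ h1 fun l w => t < {c | l c = some (w c c)}.ncard

theorem selected_local [NeZero R] (hlev : VertexLocal (r + R) lev)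
    (hanc : ∀ c, VertexLocal (r + R) fun I v => I.N.id (anc I v c))
    (hball : ∀ I v c, anc I v c ∈ I.N.baseGraph.closedBall R v) (hω : VertexLocal r ω) :
    VertexLocal (r + R + (2 * s + 1) * (2 * R) + 2 * s * (2 * R) + R)
      fun I => I.N.Selected (lev I) (anc I) t s (ω I) := by
  have hprof : VertexLocal (r + R) fun I => I.N.profile (lev I) (anc I) :=
    hlev.map₂ (VertexLocal.pi hanc) fun l a c => (l c, a c)
  have hpatch : VertexLocal (r + R + (2 * s + 1) * (2 * R)) fun I =>
      I.N.patch (lev I) (anc I) t s :=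
    (hprof.image_baseBall _).map fun S => Classical.epsilon (Relieves t S)
  have hover := overloaded_local (t := t) hlev hanc hball hω
  have hagree : VertexLocal (r + R + (2 * s + 1) * (2 * R) + 2 * s * (2 * R)) fun I =>
      I.N.agreedPatch (lev I) (anc I) t s (ω I) :=
    (hpatch.closeGraph (hover.mono (Nat.le_add_right _ _)) (2 * R) (2 * s)).map
      fun S => Classical.epsilon fun J => J ∈ S
  have h1 := ((hover.mono (by omega :
    r + R ≤ r + R + (2 * s + 1) * (2 * R) + 2 * s * (2 * R))).map₂ hagree Prod.mk).image_baseBall R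
  have h2 : VertexLocal (r + R) fun I v c => ω I (anc I v c) :=
    VertexLocal.pi fun c => hω.lookup (hanc c) fun I v => hball I v c
  have h3 := (hover.map₂ (hprof.map₂ h2 Prod.mk) Prod.mk).mono (by omega :
    r + R ≤ r + R + (2 * s + 1) * (2 * R) + 2 * s * (2 * R) + R)
  convert h3.map₂ h1 (fun x S c => (¬ x.1 ∧ (x.2.1 c).1 = some (x.2.2 c c)) ∨
    ∃ q ∈ S, q.1 ∧ (x.2.1 c).1 = some (q.2 (x.2.1 c).2 c)) using 4 with I v c
  simp [Selected, profile]

end PortNetwork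

/-! ### Rooted trees -/

namespace SimpleGraph

variable {V : Type*} {H : SimpleGraph V}

/-- In a forest, the first step of the path to `z` leads to the neighbor that is not farther away
from `z`. -/
theorem IsAcyclic.getVert_one_of_dist_le (hH : H.IsAcyclic) {v w z : V} (hvw : H.Adj v w)
    (hz : H.Reachable v z) (hd : H.dist w z ≤ H.dist v z) {q : H.Walk v z} (hq : q.IsPath) :
    q.getVert 1 = w ∧ H.dist v z = H.dist w z + 1 := by
  classical
  have hwz : H.Reachable w z := hvw.symm.reachable.trans hz
  obtain ⟨p, hp, hpl⟩ := hwz.exists_path_of_dist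
  have hv : v ∉ p.support := by
    intro hv
    have h1 := dist_le (p.dropUntil v hv)
    have h2 := congrArg Walk.length (p.take_spec hv)
    rw [Walk.length_append] at h2
    have h3 : (p.takeUntil v hv).length ≠ 0 := fun h =>
      hvw.ne (Walk.eq_of_length_eq_zero h).symm
    omega
  have hc : (Walk.cons hvw p).IsPath := hp.cons hv
  have huniq : ∀ q : H.Walk v z, q.IsPath → q = Walk.cons hvw p := fun q hq =>
    congrArg Subtype.val ((hH.subsingleton_path v z).elim ⟨q, hq⟩ ⟨_, hc⟩)
  refine ⟨by rw [huniq q hq]; simp, ?_⟩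
  obtain ⟨q', hq', hl⟩ := hz.exists_path_of_dist
  rw [← hl, huniq q' hq', Walk.length_cons, hpl]

/-- A height function on the vertices of a forest for which each vertex has at most one neighbor
below it. -/
structure IsDepth (H : SimpleGraph V) (dep : V → ℕ) : Prop where
  adj : ∀ v w, H.Adj v w → dep v = dep w + 1 ∨ dep w = dep v + 1
  unique : ∀ v w w', H.Adj v w → H.Adj v w' → dep w < dep v → dep w' < dep v → w = w'

theorem IsAcyclic.isDepth_dist (hH : H.IsAcyclic) (root : V → V) (hr : ∀ v, H.Reachable v (root v))
    (hadj : ∀ v w, H.Adj v w → root v = root w) : H.IsDepth fun v => H.dist v (root v) where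
  adj v w h := by
    have h1 := hr v
    have h2 := hr w
    have h3 := hadj v w h
    rw [← h3] at h2 ⊢
    obtain ⟨p, hp, _⟩ := h1.exists_path_of_dist
    obtain ⟨q, hq, _⟩ := h2.exists_path_of_dist
    rcases le_total (H.dist w (root v)) (H.dist v (root v)) with h4 | h4
    · exact Or.inl (hH.getVert_one_of_dist_le h h1 h4 hp).2
    · exact Or.inr (hH.getVert_one_of_dist_le h.symm h2 h4 hq).2
  unique v w w' h h' hl hl' := by
    have h1 := hr v
    rw [← hadj v w h] at hl
    rw [← hadj v w' h'] at hl'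
    obtain ⟨p, hp, _⟩ := h1.exists_path_of_dist
    rw [← (hH.getVert_one_of_dist_le h h1 hl.le hp).1, (hH.getVert_one_of_dist_le h' h1 hl'.le hp).1]

theorem mem_closedBall_iff_dist {v z : V} (h : H.Reachable v z) {i : ℕ} :
    z ∈ H.closedBall i v ↔ H.dist v z ≤ i := by
  constructor
  · rintro ⟨p, hp⟩
    exact (dist_le p).trans hp
  · intro hi
    obtain ⟨p, hp⟩ := h.exists_walk_length_eq_dist
    exact ⟨p, hp.trans_le hi⟩

end SimpleGraph

namespace PortNetwork

variable {V E : Type} (N : PortNetwork V E) (ψ : E → ℕ) (D : ℕ)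

/-- The distance to the vertex of smallest identifier in the tree of color `c`. -/
noncomputable def depth (v : V) (c : ℕ) : ℕ :=
  sInf {i | i ≤ D ∧ sInf (N.id '' (N.colorGraph ψ c).closedBall D v) ∈
    N.id '' (N.colorGraph ψ c).closedBall i v}

/-- The neighbors of smaller depth. -/
def lowerNeighbors (v : V) (c : ℕ) : Set V :=
  {w | w ∈ (N.colorGraph ψ c).closedBall 1 v ∧ N.depth ψ D w c < N.depth ψ D v c}

open Classical in
/-- The parent of `v` in the tree of color `c`. -/
noncomputable def parent (c : ℕ) (v : V) : V :=
  if h : ∃ w ∈ N.lowerNeighbors ψ D v c, N.id w = sInf (N.id '' N.lowerNeighbors ψ D v c) then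
    h.choose else v

variable {N ψ D}

/-- Under the diameter bound the ball of radius D is the whole tree. All its vertices therefore see
the same smallest identifier, and `depth` is the distance to one common root. -/
theorem isDepth_depth {c : ℕ} (hF : (N.colorGraph ψ c).IsAcyclic)
    (hD : (N.colorGraph ψ c).DiamLE D) : (N.colorGraph ψ c).IsDepth fun v => N.depth ψ D v c := by
  set H := N.colorGraph ψ c
  have hne : ∀ v, (N.id '' H.closedBall D v).Nonempty := fun v =>
    ⟨_, v, SimpleGraph.mem_closedBall_self _ v, rfl⟩
  choose root hroot hid using fun v => Nat.sInf_mem (hne v)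
  have hreach : ∀ v, H.Reachable v (root v) := fun v => by
    obtain ⟨p, _⟩ := hroot v
    exact ⟨p⟩
  have hball : ∀ v w, H.Adj v w → H.closedBall D v = H.closedBall D w := fun v w h => by
    ext z
    exact ⟨fun ⟨p, _⟩ => hD _ _ (h.symm.reachable.trans ⟨p⟩),
      fun ⟨p, _⟩ => hD _ _ (h.reachable.trans ⟨p⟩)⟩
  have hadj : ∀ v w, H.Adj v w → root v = root w := fun v w h =>
    N.id_injective (by rw [hid, hid, hball v w h])
  convert hF.isDepth_dist root hreach hadj using 2 with v
  unfold depth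
  rw [← hid v]
  have hset : {i | i ≤ D ∧ N.id (root v) ∈ N.id '' H.closedBall i v} =
      {i | i ≤ D ∧ H.dist v (root v) ≤ i} := by
    ext i
    simp only [Set.mem_ofPred_eq, N.id_injective.mem_set_image,
      SimpleGraph.mem_closedBall_iff_dist (hreach v)]
  have hd : H.dist v (root v) ≤ D :=
    (SimpleGraph.mem_closedBall_iff_dist (hreach v)).1 (hroot v)
  change sInf {i | i ≤ D ∧ N.id (root v) ∈ N.id '' H.closedBall i v} = _
  rw [hset]
  exact le_antisymm (Nat.sInf_le ⟨hd, le_rfl⟩) (le_csInf ⟨_, hd, le_rfl⟩ fun i hi => hi.2)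

theorem parent_mem_closedBall (c : ℕ) (v : V) :
    N.parent ψ D c v ∈ (N.colorGraph ψ c).closedBall 1 v := by
  unfold parent
  split_ifs with h
  · exact h.choose_spec.1.1
  · exact SimpleGraph.mem_closedBall_self _ _

theorem iterate_parent_mem_closedBall (c i : ℕ) (v : V) :
    (N.parent ψ D c)^[i] v ∈ (N.colorGraph ψ c).closedBall i v := by
  induction i generalizing v with
  | zero => exact SimpleGraph.mem_closedBall_self _ _
  | succ i ih =>
    rw [Function.iterate_succ_apply, add_comm]
    exact SimpleGraph.mem_closedBall_trans (parent_mem_closedBall c v) (ih _)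

theorem parent_eq {c : ℕ} (h : (N.colorGraph ψ c).IsDepth fun v => N.depth ψ D v c) {v w : V}
    (hvw : (N.colorGraph ψ c).Adj v w) (hd : N.depth ψ D w c < N.depth ψ D v c) :
    N.parent ψ D c v = w := by
  have hw : w ∈ N.lowerNeighbors ψ D v c :=
    ⟨SimpleGraph.mem_closedBall_succ.2 (Or.inr ⟨w, hvw, SimpleGraph.mem_closedBall_self _ _⟩), hd⟩
  have hex : ∃ w ∈ N.lowerNeighbors ψ D v c, N.id w = sInf (N.id '' N.lowerNeighbors ψ D v c) :=
    Nat.sInf_mem (s := N.id '' N.lowerNeighbors ψ D v c) ⟨_, w, hw, rfl⟩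
  unfold parent
  rw [dif_pos hex]
  obtain ⟨hu, hud⟩ := hex.choose_spec.1
  refine h.unique v _ _ ?_ hvw hud hd
  rcases SimpleGraph.mem_closedBall_succ.1 hu with he | ⟨x, hx, hu'⟩
  · rw [he] at hud
    exact (lt_irrefl _ hud).elim
  · rw [SimpleGraph.closedBall_zero] at hu'
    rw [Set.mem_singleton_iff.1 hu']
    exact hx

end PortNetwork

namespace PortNetwork

variable {r D : ℕ} {ψ : (I : Inst Ω) → I.E → ℕ}

theorem depth_local (hψ : EdgeLocal r ψ) (D : ℕ) :
    VertexLocal (r + D) fun I => I.N.depth (ψ I) D := by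
  have h1 : ∀ i : Fin (D + 1), VertexLocal (r + D) fun (I : Inst Ω) v c =>
      I.N.id '' (I.N.colorGraph (ψ I) c).closedBall i v := fun i =>
    (VertexLocal.id.image_closedBall hψ i).mono (by omega)
  convert (VertexLocal.pi h1).map fun f c => sInf {i : ℕ | ∃ j : Fin (D + 1), (j : ℕ) = i ∧
    sInf (f (Fin.last D) c) ∈ f j c} using 4 with I v c
  unfold depth
  congr 1
  ext i
  constructor
  · rintro ⟨h2, h3⟩
    exact ⟨⟨i, Nat.lt_succ_of_le h2⟩, rfl, h3⟩
  · rintro ⟨j, rfl, h3⟩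
    exact ⟨Nat.le_of_lt_succ j.2, h3⟩

/-- Locality is required on all instances, even if the classes are not forests and a vertex has
several lower neighbors. Taking the smallest identifier makes the parent a function of the view in
every case. -/
theorem parent_local (hψ : EdgeLocal r ψ) (D c : ℕ) :
    VertexLocal (r + D + 1) fun I v => I.N.id (I.N.parent (ψ I) D c v) := by
  classical
  have h1 := depth_local hψ D
  have h2 := (VertexLocal.id.map₂ h1 Prod.mk).image_closedBall
    (hψ.mono (by omega : r ≤ r + D)) 1
  have h3 := ((VertexLocal.id (Ω := Ω)).map₂ (h1.mono (by omega : r + D ≤ r + D + 1)) Prod.mk).map₂ h2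
    fun x f => if ∃ i d, (i, d) ∈ f c ∧ d c < x.2 c then
      sInf {i | ∃ d, (i, d) ∈ f c ∧ d c < x.2 c} else x.1
  convert h3 using 3 with I v
  have hS : I.N.id '' I.N.lowerNeighbors (ψ I) D v c = {i | ∃ d, (i, d) ∈
      (fun v => (I.N.id v, I.N.depth (ψ I) D v)) '' (I.N.colorGraph (ψ I) c).closedBall 1 v ∧
        d c < I.N.depth (ψ I) D v c} := by
    ext i
    constructor
    · rintro ⟨w, ⟨hw, hd⟩, rfl⟩
      exact ⟨_, ⟨w, hw, rfl⟩, hd⟩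
    · rintro ⟨d, ⟨w, hw, he⟩, hd⟩
      rw [Prod.mk.injEq] at he
      obtain ⟨rfl, rfl⟩ := he
      exact ⟨w, ⟨hw, hd⟩, rfl⟩
  dsimp only
  rw [← hS]
  by_cases hne : (I.N.id '' I.N.lowerNeighbors (ψ I) D v c).Nonempty
  · have hex : ∃ w ∈ I.N.lowerNeighbors (ψ I) D v c,
        I.N.id w = sInf (I.N.id '' I.N.lowerNeighbors (ψ I) D v c) := Nat.sInf_mem hne
    rw [if_pos]
    · unfold parent
      rw [dif_pos hex]
      exact hex.choose_spec.2
    · rw [hS] at hne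
      obtain ⟨i, d, h⟩ := hne
      exact ⟨i, d, h⟩
  · rw [if_neg]
    · unfold parent
      rw [dif_neg]
      rintro ⟨w, hw, _⟩
      exact hne ⟨_, w, hw, rfl⟩
    · rintro ⟨i, d, h⟩
      rw [hS] at hne
      exact hne ⟨i, d, h⟩

theorem iterate_parent_local (hψ : EdgeLocal r ψ) (D c i : ℕ) :
    VertexLocal (r + D + 1 + i) fun I v => I.N.id ((I.N.parent (ψ I) D c)^[i] v) := by
  induction i with
  | zero => exact VertexLocal.id
  | succ i ih =>
    have h := (parent_local hψ D c).lookup ih fun I v =>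
      SimpleGraph.closedBall_mono_graph (colorGraph_le_baseGraph _ _ _) _ _
        (iterate_parent_mem_closedBall c i v)
    change VertexLocal (r + D + 1 + i + 1) _
    refine VertexLocal.succ ?_
    simpa only [Function.iterate_succ_apply'] using h

end PortNetwork

/-! ### Cutting rooted trees -/

namespace SimpleGraph

variable {V : Type*} {H H' : SimpleGraph V} {dep : V → ℕ}

theorem IsDepth.anti (h : H.IsDepth dep) (hle : H' ≤ H) : H'.IsDepth dep where
  adj v w hvw := h.adj v w (hle hvw)
  unique v w w' hw hw' := h.unique v w w' (hle hw) (hle hw')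

open Classical in
/-- If there are no long descending paths, then the diameter is small. -/
theorem IsDepth.diamLE (h : H.IsDepth dep) (L : ℕ)
    (hL : ∀ x : ℕ → V, ¬ ∀ j < L, H.Adj (x j) (x (j + 1)) ∧ dep (x (j + 1)) < dep (x j)) :
    H.DiamLE (L + L) := by
  let up : V → V := fun v => if h : ∃ w, H.Adj v w ∧ dep w < dep v then h.choose else v
  have hup : ∀ v w, H.Adj v w → dep w < dep v → up v = w := by
    intro v w hvw hd
    have hex : ∃ w, H.Adj v w ∧ dep w < dep v := ⟨w, hvw, hd⟩
    simp only [up, dif_pos hex]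
    exact h.unique v _ _ hex.choose_spec.1 hvw hex.choose_spec.2 hd
  have hup' : ∀ v, up v ≠ v → H.Adj v (up v) ∧ dep (up v) < dep v := by
    intro v hv
    by_cases hex : ∃ w, H.Adj v w ∧ dep w < dep v
    · obtain ⟨w, hw⟩ := hex
      rw [hup v w hw.1 hw.2]
      exact hw
    · exact (hv (dif_neg hex)).elim
  -- If the pointers were still moving after L steps, they would trace a descending path of L edges.
  have hfix : ∀ v, up (up^[L] v) = up^[L] v := by
    intro v
    by_contra hne
    refine hL (fun j => up^[j] v) fun j hj => ?_
    rw [Function.iterate_succ_apply']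
    refine hup' _ fun heq => hne ?_
    have h1 : up^[L] v = up^[j] v := by
      rw [← Nat.sub_add_cancel hj.le, Function.iterate_add_apply]
      exact Function.iterate_fixed heq _
    rw [h1, heq]
  refine diamLE_of_representative up^[L] (fun v => ?_) ?_
  · clear hfix hL
    induction L generalizing v with
    | zero => exact mem_closedBall_self _ _
    | succ L ih =>
      rw [Function.iterate_succ_apply, mem_closedBall_succ]
      by_cases hv : up v = v
      · rw [hv]
        exact mem_closedBall_succ.1 (closedBall_mono (Nat.le_succ L) v (ih v))
      · exact Or.inr ⟨_, (hup' v hv).1, ih _⟩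
  · have key : ∀ v w, H.Adj v w → dep w < dep v → up^[L] v = up^[L] w := fun v w hvw hd => by
      rw [← hfix v, ← Function.iterate_succ_apply' up L v, Function.iterate_succ_apply, hup v w hvw hd]
    intro v w hvw
    rcases h.adj v w hvw with h1 | h1
    · exact key v w hvw (by omega)
    · exact (key w v hvw.symm (by omega)).symm

end SimpleGraph

namespace PortNetwork

variable {V E : Type} (N : PortNetwork V E) (ψ : E → ℕ) (D K R : ℕ) [NeZero R]

/-- The depth below the block of `R` consecutive levels to which the edge to the parent belongs. -/
noncomputable def level (v : V) (c : Fin K) : Option (Fin R) :=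
  if N.depth ψ D v c = 0 then none else some (Fin.ofNat R (N.depth ψ D v c - 1))

/-- The ancestor at the top of the block. -/
noncomputable def ancestor (v : V) (c : Fin K) : V :=
  (N.parent ψ D c)^[(N.depth ψ D v c - 1) % R + 1] v

variable (t s : ℕ) (ω : V → Fin K → Fin R)

/-- The edges to the parent that are cut. -/
def TreeCut (v : V) (e : E) : Prop :=
  N.depth ψ D (N.neighbor v e) (ψ e) < N.depth ψ D v (ψ e) ∧ ∃ h : ψ e < K,
    N.Selected (N.level ψ D K R) (N.ancestor ψ D K R) t s ω v ⟨ψ e, h⟩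

/-- The coloring in which the cut edges get new colors. -/
noncomputable def treeCutColoring (m : ℕ) (e : E) : ℕ :=
  (N.chargeColor (N.TreeCut ψ D K R t s ω) m e).elim (ψ e) fun q => K + q

variable {N ψ D K R t s ω}

theorem ancestor_mem_closedBall (v : V) (c : Fin K) :
    N.ancestor ψ D K R v c ∈ N.baseGraph.closedBall R v :=
  SimpleGraph.closedBall_mono (Nat.mod_lt _ (Nat.pos_of_ne_zero (NeZero.ne R))) _
    (SimpleGraph.closedBall_mono_graph (colorGraph_le_baseGraph _ _ _) _ _
      (iterate_parent_mem_closedBall _ _ v))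

theorem exclusiveCharge_treeCut : N.ExclusiveCharge (N.TreeCut ψ D K R t s ω) := by
  intro v e he h h'
  have h2 := h'.1
  rw [N.neighbor_neighbor he] at h2
  exact lt_asymm h.1 h2

/-- In each class a vertex has at most one lower neighbor and no parallel edges to it, so cut edges
inject into selected classes. -/
theorem ncard_treeCut_le [Finite V] [Finite E] (hψ : N.GoodColoring K D ψ)
    {ω₀ : V → Fin K → Fin R}
    (h₀ : ∀ v, ¬ Overloaded (N.level ψ D K R) (N.ancestor ψ D K R) t ω₀ v)
    (hs : (N.baseGraph.closeGraph (Overloaded (N.level ψ D K R) (N.ancestor ψ D K R) t ω)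
      (2 * R)).DiamLE (2 * s)) (v : V) :
    {e | N.graph.Inc e v ∧ N.TreeCut ψ D K R t s ω v e}.ncard ≤ 2 * t := by
  refine le_trans ?_ (ncard_selected_le h₀ hs v)
  rw [← Set.ncard_image_of_injective _ Fin.val_injective]
  refine Set.ncard_le_ncard_of_injOn ψ ?_ ?_ (Set.toFinite _)
  · rintro e ⟨_, _, h, hsel⟩
    exact ⟨⟨ψ e, h⟩, hsel, rfl⟩
  · rintro e ⟨he, hed, _⟩ f ⟨hf, hfd, _⟩ hef
    have h1 := isDepth_depth (hψ.2 (ψ e)).1.2 (hψ.2 (ψ e)).2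
    have h2 := h1.unique v _ _ ⟨e, N.isLink_neighbor he, rfl⟩ ⟨f, N.isLink_neighbor hf, hef.symm⟩
      hed (hef ▸ hfd)
    exact (hψ.2 (ψ e)).1.1 e f v _ (N.isLink_neighbor he) (h2 ▸ N.isLink_neighbor hf) rfl hef.symm

/-- Among the 2R consecutive levels of the path there are R that form a complete block. -/
theorem exists_selected_of_chain {c : Fin K}
    (h : (N.colorGraph ψ c).IsDepth fun v => N.depth ψ D v c) (x : ℕ → V)
    (hx : ∀ j < 2 * R, (N.colorGraph ψ c).Adj (x j) (x (j + 1)) ∧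
      N.depth ψ D (x (j + 1)) c < N.depth ψ D (x j) c) :
    ∃ j < 2 * R, N.Selected (N.level ψ D K R) (N.ancestor ψ D K R) t s ω (x j) c := by
  have hR : 0 < R := Nat.pos_of_ne_zero (NeZero.ne R)
  have hd : ∀ j ≤ 2 * R, N.depth ψ D (x j) c + j = N.depth ψ D (x 0) c := by
    intro j hj
    induction j with
    | zero => rfl
    | succ j ih =>
      have h1 := hx j hj
      have h2 := ih (Nat.le_of_succ_le hj)
      rcases h.adj _ _ h1.1 with h3 | h3 <;> omega
  have hp : ∀ i j, j + i ≤ 2 * R → (N.parent ψ D c)^[i] (x j) = x (j + i) := by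
    intro i
    induction i with
    | zero => exact fun j _ => rfl
    | succ i ih =>
      intro j hj
      have h1 := hx j (by omega)
      rw [Function.iterate_succ_apply, parent_eq h h1.1 h1.2, ih (j + 1) (by omega)]
      congr 1
      omega
  set d := N.depth ψ D (x 0) c
  have h2R := hd (2 * R) le_rfl
  -- The block consists of the depths b + 1, …, b + R with R dividing b. The path reaches depth b
  -- because d < b + 2R.
  obtain ⟨b, hb1, hb2, hb3⟩ : ∃ b, b % R = 0 ∧ b + R ≤ d ∧ d < b + 2 * R := by
    have h1 := Nat.div_add_mod d R
    have h2 := Nat.mod_lt d hR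
    refine ⟨R * (d / R - 1), Nat.mul_mod_right _ _, ?_⟩
    have h3 : 1 ≤ d / R := (Nat.one_le_div_iff hR).2 (by omega)
    have h4 : R * (d / R - 1) + R = R * (d / R) := by
      rw [← Nat.mul_succ]
      congr 1
      omega
    omega
  have hdep : ∀ i : Fin R, N.depth ψ D (x (d - b - 1 - i)) c = b + i + 1 := by
    intro i
    have := hd (d - b - 1 - i) (by omega)
    omega
  have hmod : ∀ i : Fin R, (b + i + 1 - 1) % R = i := by
    intro i
    rw [Nat.add_sub_cancel, Nat.add_mod, hb1, Nat.zero_add, Nat.mod_mod, Nat.mod_eq_of_lt i.2]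
  suffices h : ∃ i : Fin R, N.Selected (N.level ψ D K R) (N.ancestor ψ D K R) t s ω
      (x (d - b - 1 - i)) c by
    obtain ⟨i, hi⟩ := h
    exact ⟨_, by omega, hi⟩
  -- The vertex of depth b is the common `ancestor` of the whole block.
  refine exists_selected (z := x (d - b)) (fun i : Fin R => x (d - b - 1 - i)) ?_ ?_ ?_
  · intro i
    unfold level
    rw [hdep, if_neg (by omega)]
    exact congrArg some (Fin.ext (hmod i))
  · intro i
    unfold ancestor
    rw [hdep, hmod, hp _ _ (by omega)]
    congr 1
    omega
  · have key : ∀ i j : ℕ, i ≤ j → j ≤ i + R → j ≤ 2 * R → x j ∈ N.baseGraph.closedBall R (x i) := by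
      intro i j h1 h2 h3
      have h4 := iterate_parent_mem_closedBall (N := N) (ψ := ψ) (D := D) c (j - i) (x i)
      rw [hp _ _ (by omega), Nat.add_sub_cancel' h1] at h4
      exact SimpleGraph.closedBall_mono (by omega) _
        (SimpleGraph.closedBall_mono_graph (colorGraph_le_baseGraph _ _ _) _ _ h4)
    intro i j
    rcases le_total (d - b - 1 - (i : ℕ)) (d - b - 1 - j) with h1 | h1
    · exact key _ _ h1 (by omega) (by omega)
    · exact SimpleGraph.mem_closedBall_comm.1 (key _ _ h1 (by omega) (by omega))

/-- The at most 2t cut edges per vertex need 8 · 2t star colors. Descending paths have fewer than 2R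
edges, which gives diameter at most 2R + 2R. -/
theorem goodColoring_treeCutColoring [Finite V] [Finite E] {m : ℕ} (hψ : N.GoodColoring K D ψ)
    (hid : ∀ v, N.id v < 2 ^ m) {ω₀ : V → Fin K → Fin R}
    (h₀ : ∀ v, ¬ Overloaded (N.level ψ D K R) (N.ancestor ψ D K R) t ω₀ v)
    (hs : (N.baseGraph.closeGraph (Overloaded (N.level ψ D K R) (N.ancestor ψ D K R) t ω)
      (2 * R)).DiamLE (2 * s)) :
    N.GoodColoring (K + 16 * t) (4 * R) (N.treeCutColoring ψ D K R t s ω m) := by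
  have hR : 0 < R := Nat.pos_of_ne_zero (NeZero.ne R)
  have hT := ncard_treeCut_le hψ h₀ hs
  set out := N.treeCutColoring ψ D K R t s ω m with hout
  have hcases : ∀ e, (∃ q, q < 8 * (2 * t) ∧
      N.chargeColor (N.TreeCut ψ D K R t s ω) m e = some q ∧ out e = K + q) ∨
      (N.chargeColor (N.TreeCut ψ D K R t s ω) m e = none ∧ out e = ψ e) := by
    intro e
    rw [hout]
    unfold treeCutColoring
    cases h : N.chargeColor (N.TreeCut ψ D K R t s ω) m e with
    | some q => exact Or.inl ⟨q, chargeColor_lt hid hT h, rfl, rfl⟩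
    | none => exact Or.inr ⟨rfl, rfl⟩
  refine ⟨fun e he => ?_, fun c => ?_⟩
  · have := hψ.1 e he
    rcases hcases e with ⟨q, h1, _, h2⟩ | ⟨_, h2⟩ <;> omega
  rcases lt_or_ge c K with hc | hc
  · have hsub : ∀ e, out e = c → ψ e = c ∧
        N.chargeColor (N.TreeCut ψ D K R t s ω) m e = none := by
      intro e he
      rcases hcases e with ⟨q, _, _, h2⟩ | ⟨h1, h2⟩
      · omega
      · exact ⟨h2 ▸ he, h1⟩
    have hle : N.colorGraph out c ≤ N.colorGraph ψ c :=
      fun v w ⟨e, he, hec⟩ => ⟨e, he, (hsub e hec).1⟩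
    have hdep := isDepth_depth (hψ.2 c).1.2 (hψ.2 c).2
    refine ⟨(hψ.2 c).1.anti fun e _ he => (hsub e he).1,
      SimpleGraph.DiamLE.mono ((hdep.anti hle).diamLE (2 * R) fun x hx => ?_) (by omega)⟩
    obtain ⟨j, hj, hsel⟩ := exists_selected_of_chain (t := t) (s := s) (ω := ω) (c := ⟨c, hc⟩) hdep
      x fun j hj => ⟨hle (hx j hj).1, (hx j hj).2⟩
    obtain ⟨⟨e, he, hec⟩, hlt⟩ := hx j hj
    obtain ⟨rfl, hnone⟩ := hsub e hec
    refine chargeValue_eq_none.1 hnone _ he.inc_left ⟨?_, hc, hsel⟩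
    rwa [N.neighbor_eq he]
  · have hiff : ∀ e ∈ N.graph.edgeSet, out e = c ↔
        N.chargeColor (N.TreeCut ψ D K R t s ω) m e = some (c - K) := by
      intro e he
      have := hψ.1 e he
      rcases hcases e with ⟨q, _, h1, h2⟩ | ⟨h1, h2⟩
      · rw [h1, Option.some.injEq]
        omega
      · rw [h1]
        simp
        omega
    obtain ⟨h1, h2⟩ := forestClass_chargeColor (exclusiveCharge_treeCut (N := N) (ψ := ψ) (D := D)
      (t := t) (s := s) (ω := ω)) hid (c - K)
    refine ⟨h1.anti fun e he => (hiff e he).1, ?_⟩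
    rw [colorGraph_congr hiff]
    exact h2.mono (by omega)

end PortNetwork

/-! ### Locality of the tree cuts -/

namespace PortNetwork

variable {r D K R : ℕ} [NeZero R] {ψ : (I : Inst Ω) → I.E → ℕ}
  {ω : (I : Inst Ω) → I.V → Fin K → Fin R}

theorem level_local (hψ : EdgeLocal r ψ) :
    VertexLocal (r + D) fun I => I.N.level (ψ I) D K R :=
  (depth_local hψ D).map fun d (c : Fin K) =>
    if d c = 0 then none else some (Fin.ofNat R (d c - 1))

theorem ancestor_local (hψ : EdgeLocal r ψ) (c : Fin K) :
    VertexLocal (r + D + 1 + R) fun I v => I.N.id (I.N.ancestor (ψ I) D K R v c) := by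
  have h1 : ∀ i : Fin R, VertexLocal (r + D + 1 + R) fun I v =>
      I.N.id ((I.N.parent (ψ I) D c)^[i + 1] v) := fun i =>
    (iterate_parent_local hψ D c (i + 1)).mono (by omega)
  exact ((depth_local hψ D).mono (by omega)).map₂ (VertexLocal.pi h1)
    fun d f => f (Fin.ofNat R (d c - 1))

theorem treeCutColoring_local (hψ : EdgeLocal r ψ) (hω : VertexLocal 0 ω) (t s m : ℕ) :
    EdgeLocal (r + D + 1 + R + (2 * s + 1) * (2 * R) + 2 * s * (2 * R) + R + m + 3)
      fun I => I.N.treeCutColoring (ψ I) D K R t s (ω I) m := by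
  have h1 := selected_local (t := t) (s := s) ((level_local hψ (K := K) (R := R) (D := D)).mono
    (by omega : r + D ≤ r + D + 1 + R)) (ancestor_local hψ)
    (fun I v c => ancestor_mem_closedBall v c) (hω.mono (Nat.zero_le _))
  set ρ := r + D + 1 + R + (2 * s + 1) * (2 * R) + 2 * s * (2 * R) + R with hρ
  have h2 := DartLocal.ofVertex (depth_local hψ D)
  have h3 := (h2.succ.map₂ h2.swap Prod.mk).mono (by omega : r + D + 1 ≤ ρ)
  have h4 : DartLocal ρ fun I => I.N.TreeCut (ψ I) D K R t s (ω I) :=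
    (h3.map₂ ((DartLocal.ofVertex h1).map₂ (DartLocal.mono hψ (by omega : r ≤ ρ)) Prod.mk)
      Prod.mk).map fun x => x.1.2 x.2.2 < x.1.1 x.2.2 ∧ ∃ h : x.2.2 < K, x.2.1 ⟨x.2.2, h⟩
  exact DartLocal.map₂ ((chargeColor_local (fun I => exclusiveCharge_treeCut) h4 m).mono
    (by omega : ρ + m + 2 ≤ ρ + m + 3)) (DartLocal.mono hψ (by omega))
    fun o x => o.elim x fun q => K + q

end PortNetwork

/-! ### Parameters of the second stage -/

namespace PortNetwork

variable {V E : Type} {N : PortNetwork V E}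

theorem ncard_closedBall_le [Finite V] [Finite E] {Δ : ℕ} (hΔ : ∀ v, N.graph.multiDegree v ≤ Δ)
    (i : ℕ) (v : V) : (N.baseGraph.closedBall i v).ncard ≤ (Δ + 1) ^ i := by
  classical
  induction i generalizing v with
  | zero => simp [SimpleGraph.closedBall_zero]
  | succ i ih =>
    have hfin : (insert v (N.neighbor v '' N.graph.incidenceSet v)).Finite := Set.toFinite _
    have hsub : N.baseGraph.closedBall (i + 1) v ⊆
        ⋃ x ∈ hfin.toFinset, N.baseGraph.closedBall i x := by
      intro y hy
      simp only [Set.mem_iUnion, Set.Finite.mem_toFinset, exists_prop]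
      rcases SimpleGraph.mem_closedBall_succ.1 hy with rfl | ⟨w, ⟨e, he, _⟩, hw⟩
      · exact ⟨_, Set.mem_insert _ _, SimpleGraph.mem_closedBall_self _ _⟩
      · exact ⟨w, Or.inr ⟨e, he.inc_left, N.neighbor_eq he⟩, hw⟩
    have hcard : hfin.toFinset.card ≤ Δ + 1 := by
      rw [← Set.ncard_eq_toFinset_card _ hfin]
      exact (Set.ncard_insert_le _ _).trans
        (Nat.succ_le_succ ((Set.ncard_image_le (Set.toFinite _)).trans (hΔ v)))
    refine (Set.ncard_le_ncard hsub (Set.toFinite _)).trans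
      ((Finset.set_ncard_biUnion_le _ _).trans ?_)
    refine (Finset.sum_le_card_nsmul _ _ _ fun x _ => ih x).trans ?_
    rw [smul_eq_mul, pow_succ']
    exact Nat.mul_le_mul_right _ hcard

end PortNetwork

/-- The number of levels in a block. -/
noncomputable def blockLength (ε : ℝ) : ℕ := dyadicAbove (17408 / ε)

instance (ε : ℝ) : NeZero (blockLength ε) := ⟨(dyadicAbove_pos _).ne'⟩

section

variable {n a k Δ c : ℕ} {ε : ℝ}

theorem le_blockLength (ε : ℝ) : 17408 / ε ≤ blockLength ε := le_dyadicAbove _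

theorem blockLength_le (hε : 0 < ε) (hε' : ε < 1 / 2) : (blockLength ε : ℝ) ≤ 34817 / ε := by
  have h1 : 1 < 17408 / ε := by rw [lt_div_iff₀ hε]; linarith
  have h2 : 2 ≤ 1 / ε := by rw [le_div_iff₀ hε]; linarith
  have h3 : 34817 / ε = 2 * (17408 / ε) + 1 / ε := by ring
  have := dyadicAbove_le h1
  unfold blockLength
  linarith

theorem exp_neg_le_one_div_pow {D t : ℕ} (hD : 2 ≤ D) (h : 4 * ((c : ℝ) + 3) * Real.log D ≤ t) :
    Real.exp (-(t / 4)) ≤ 1 / (D : ℝ) ^ (c + 3) := by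
  have hD0 : (0 : ℝ) < D := by exact_mod_cast (by omega : 0 < D)
  have : 1 / (D : ℝ) ^ (c + 3) = Real.exp (-((c + 3 : ℕ) * Real.log D)) := by
    rw [Real.exp_neg, Real.exp_nat_mul, Real.exp_log hD0, one_div]
  rw [this, Real.exp_le_exp, neg_le_neg_iff]
  push_cast
  linarith

/-- With X = D^s ≥ n the chain bound is at most X² X^(-(c+3)) = X^(-(c+1)). The other two
inequalities are the conditions of the local lemma. -/
theorem chain_bound_le {D s : ℕ} {p : ℝ} (hn : 2 ≤ n) (hD : 2 ≤ D) (hs : n ≤ D ^ s) (hp0 : 0 ≤ p)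
    (hp : p ≤ 1 / (D : ℝ) ^ (c + 3)) {N : ℕ} (hN : N ≤ n) :
    (N : ℝ) * D ^ s * p ^ (s + 1) ≤ 1 / (n : ℝ) ^ (c + 1) ∧ 4 * p * D ≤ 1 ∧ 4 * p ≤ 1 := by
  have hD2 : (2 : ℝ) ≤ D := by exact_mod_cast hD
  have hD0 : (0 : ℝ) < D := by linarith
  have hn0 : (0 : ℝ) < n := by exact_mod_cast (by omega : 0 < n)
  have h4 : 4 * p * D ≤ 1 := by
    calc 4 * p * D ≤ 4 * (1 / (D : ℝ) ^ (c + 3)) * D := by gcongr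
      _ = 4 / (D : ℝ) ^ (c + 2) := by
        rw [pow_succ (D : ℝ) (c + 2)]
        field_simp
      _ ≤ 1 := by
        rw [div_le_one (by positivity)]
        calc (4 : ℝ) = 2 ^ 2 := by norm_num
          _ ≤ (D : ℝ) ^ 2 := by gcongr
          _ ≤ (D : ℝ) ^ (c + 2) := pow_le_pow_right₀ (by linarith) (by omega)
  have h4' : 4 * p ≤ 1 := by nlinarith
  refine ⟨?_, h4, h4'⟩
  have hX : (n : ℝ) ≤ (D : ℝ) ^ s := by exact_mod_cast hs
  have hN' : (N : ℝ) ≤ (D : ℝ) ^ s := (Nat.cast_le.2 hN).trans hX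
  calc (N : ℝ) * D ^ s * p ^ (s + 1) ≤ (D : ℝ) ^ s * D ^ s * (p ^ s * 1) := by
        rw [pow_succ p s]
        gcongr
        linarith
    _ ≤ (D : ℝ) ^ s * D ^ s * ((1 / (D : ℝ) ^ (c + 3)) ^ s * 1) := by gcongr
    _ = 1 / ((D : ℝ) ^ s) ^ (c + 1) := by
        rw [div_pow, one_pow, ← pow_mul, mul_comm (c + 3) s, pow_mul, mul_one,
          show c + 3 = c + 1 + 2 by omega, pow_add _ (c + 1) 2]
        field_simp
    _ ≤ 1 / (n : ℝ) ^ (c + 1) := by gcongr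

/-- The constant in the lower bound for the arboricity. -/
def arboricityConstant (c : ℕ) : ℝ := 200000000 * (c + 4)

theorem le_mul_of_min_le (hε : 0 < ε)
    (h : arboricityConstant c * min (Real.log n / ε) (Real.log Δ / ε ^ 2) ≤ a) :
    arboricityConstant c * Real.log n ≤ ε * a ∨
      arboricityConstant c * (Real.log Δ / ε) ≤ ε * a := by
  rcases min_choice (Real.log n / ε) (Real.log Δ / ε ^ 2) with h1 | h1
  · left
    rw [h1] at h
    calc arboricityConstant c * Real.log n =
          ε * (arboricityConstant c * (Real.log n / ε)) := by field_simp
      _ ≤ ε * a := by gcongr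
  · right
    rw [h1] at h
    calc arboricityConstant c * (Real.log Δ / ε) =
          ε * (arboricityConstant c * (Real.log Δ / ε ^ 2)) := by field_simp
      _ ≤ ε * a := by gcongr

theorem large_of_min_le (hn : 2 ≤ n) (hΔ : 2 ≤ Δ) (hε : 0 < ε) (hε' : ε < 1 / 2)
    (h : arboricityConstant c * min (Real.log n / ε) (Real.log Δ / ε ^ 2) ≤ a) :
    128 ≤ ε * a := by
  have hc : (0 : ℝ) ≤ c := by positivity
  have hl := Real.log_two_gt_d9
  have hC : 800000000 ≤ arboricityConstant c := by unfold arboricityConstant; linarith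
  rcases le_mul_of_min_le hε h with h1 | h1
  · have := log_two_le_log hn
    nlinarith
  · have := one_le_log_div hΔ hε hε'
    nlinarith

theorem le_floor_of_large (h : 128 ≤ ε * a) : ε * a / 128 ≤ ⌊ε * a / 64⌋₊ := by
  have := Nat.lt_floor_add_one (ε * a / 64)
  linarith

/-- There are at most 34a colors, and rounding t down costs at most a factor 2, so t ≥ εa/128. Hence
the constant 17408 = 128 · 4 · 34 in `blockLength`. -/
theorem four_mul_colors_le (hε : 0 < ε) (hε' : ε < 1 / 2) (h : 128 ≤ ε * a) (hk : k < 32 * a) :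
    4 * (k + ⌈ε / 4 * a⌉₊) ≤ blockLength ε * ⌊ε * a / 64⌋₊ := by
  have h1 := le_floor_of_large h
  have h2 := le_blockLength ε
  have h3 := Nat.ceil_lt_add_one (a := ε / 4 * a) (by positivity)
  have hk' : (k : ℝ) ≤ 32 * a := by exact_mod_cast hk.le
  have ha : (1 : ℝ) ≤ a := by
    have : a ≠ 0 := by
      rintro rfl
      simp at h
      linarith
    exact_mod_cast Nat.one_le_iff_ne_zero.2 this
  have h4 : (136 : ℝ) * a ≤ blockLength ε * ⌊ε * a / 64⌋₊ := by
    calc (136 : ℝ) * a = 17408 / ε * (ε * a / 128) := by field_simp; norm_num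
      _ ≤ _ := by gcongr
  have h5 : ((4 * (k + ⌈ε / 4 * a⌉₊) : ℕ) : ℝ) ≤ ((blockLength ε * ⌊ε * a / 64⌋₊ : ℕ) : ℝ) := by
    push_cast
    nlinarith
  exact_mod_cast h5

theorem colors_le (hε : 0 < ε) : ⌈ε / 4 * a⌉₊ + 16 * ⌊ε * a / 64⌋₊ ≤ ⌈ε * a⌉₊ := by
  have h1 := Nat.ceil_lt_add_one (a := ε / 4 * a) (by positivity)
  have h2 := Nat.floor_le (a := ε * a / 64) (by positivity)
  have h3 := Nat.le_ceil (ε * a)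
  have h4 : (0 : ℝ) ≤ ε * a := by positivity
  have h5 : ((⌈ε / 4 * a⌉₊ + 16 * ⌊ε * a / 64⌋₊ : ℕ) : ℝ) < ((⌈ε * a⌉₊ + 1 : ℕ) : ℝ) := by
    push_cast
    linarith
  exact Nat.lt_succ_iff.1 (by exact_mod_cast h5)

/-- If the minimum is log n/ε, balls are bounded by n. Otherwise they are bounded by (Δ + 1)^(4R),
whose logarithm is of order log Δ/ε. In the second case the factor needed is 128 · 1114144, below
the 200000000 in `arboricityConstant`. -/
theorem exists_ball_bound {V E : Type} [Finite V] [Finite E] {N : PortNetwork V E} (hn : 2 ≤ n)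
    (hΔ : 2 ≤ Δ) (hε : 0 < ε) (hε' : ε < 1 / 2)
    (h : arboricityConstant c * min (Real.log n / ε) (Real.log Δ / ε ^ 2) ≤ a)
    (hV : Nat.card V ≤ n) (hdeg : ∀ v, N.graph.multiDegree v ≤ Δ) :
    ∃ D, 2 ≤ D ∧ (∀ v, (N.baseGraph.closedBall (2 * (2 * blockLength ε)) v).ncard ≤ D) ∧
      Real.exp (-(⌊ε * a / 64⌋₊ / 4)) ≤ 1 / (D : ℝ) ^ (c + 1 + 3) := by
  have hc : (0 : ℝ) ≤ c := by positivity
  have ht := le_floor_of_large (large_of_min_le hn hΔ hε hε' h)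
  have hB := blockLength_le hε hε'
  rcases le_mul_of_min_le hε h with h1 | h1
  · refine ⟨n, hn, fun v => (Set.ncard_le_card _).trans hV, exp_neg_le_one_div_pow hn ?_⟩
    have hlog : 0 ≤ Real.log n := Real.log_natCast_nonneg n
    unfold arboricityConstant at h1
    push_cast
    nlinarith
  · have hD : 2 ≤ (Δ + 1) ^ (2 * (2 * blockLength ε)) := by
      have h2 := NeZero.ne (blockLength ε)
      exact (by omega : 2 ≤ Δ + 1).trans (Nat.le_self_pow (by omega) _)
    refine ⟨(Δ + 1) ^ (2 * (2 * blockLength ε)), hD, N.ncard_closedBall_le hdeg _,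
      exp_neg_le_one_div_pow hD ?_⟩
    have hlog : 0 ≤ Real.log Δ := Real.log_natCast_nonneg Δ
    have hlog2 : Real.log ((Δ : ℝ) + 1) ≤ 2 * Real.log Δ := by
      have : (0 : ℝ) < Δ := by exact_mod_cast (by omega : 0 < Δ)
      have h2 : (2 : ℝ) ≤ Δ := by exact_mod_cast hΔ
      rw [show (2 : ℝ) * Real.log Δ = Real.log ((Δ : ℝ) ^ 2) by rw [Real.log_pow]; norm_num]
      refine Real.log_le_log (by positivity) ?_
      nlinarith
    have hlog' : 0 ≤ Real.log ((Δ : ℝ) + 1) := by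
      exact_mod_cast Real.log_natCast_nonneg (Δ + 1)
    push_cast
    rw [Real.log_pow]
    push_cast
    calc 4 * ((c : ℝ) + 1 + 3) * (2 * (2 * blockLength ε) * Real.log (Δ + 1)) ≤
          4 * ((c : ℝ) + 1 + 3) * (2 * (2 * (34817 / ε)) * (2 * Real.log Δ)) := by gcongr
      _ = 1114144 * (c + 4) * (Real.log Δ / ε) := by ring
      _ ≤ arboricityConstant c * (Real.log Δ / ε) / 128 := by
        have : 0 ≤ Real.log Δ / ε := by positivity
        unfold arboricityConstant
        nlinarith [mul_nonneg hc this]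
      _ ≤ ε * a / 128 := by linarith
      _ ≤ _ := ht

end

/-! ### The algorithms -/

namespace PortNetwork

variable {V E : Type} (N : PortNetwork V E)

/-- The random choices of a vertex in the first stage. -/
abbrev StageOneLabel (ε : ℝ) : Type := Bool × Fin (dyadicAbove (8 / ε))

/-- The random choices of a vertex in both stages. -/
abbrev StageTwoLabel (a k : ℕ) (ε : ℝ) : Type :=
  StageOneLabel (ε / 4) × (Fin (k + ⌈ε / 4 * a⌉₊) → Fin (blockLength ε))

/-- The coloring computed in both stages. -/
noncomputable def stageTwo (n a k d c : ℕ) (ε : ℝ) (lab : V → StageTwoLabel a k ε) (φ : E → ℕ) :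
    E → ℕ :=
  N.treeCutColoring (N.stageOne n a k d (c + 1) (ε / 4) (fun v => (lab v).1) φ)
    (stageRadius n (c + 1) (ε / 4)) (k + ⌈ε / 4 * a⌉₊) (blockLength ε) ⌊ε * a / 64⌋₊
    (Nat.log 2 n + 1) (fun v => (lab v).2) (d * (Nat.log 2 n + 1))

variable {N}

/-- The second stage uses fresh randomness, so the first coloring can be fixed once it is good. Each
stage fails with probability at most n^(-(c+1)), and 2 ≤ n absorbs the sum. -/
theorem prob_not_goodColoring_stageTwo_le [Finite V] [Finite E] {n a Δ k d c : ℕ} {ε : ℝ}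
    {φ : E → ℕ} (hn : 2 ≤ n) (hΔ : 2 ≤ Δ) (hε : 0 < ε) (hε' : ε < 1 / 2) (hk : k < 32 * a)
    (h : arboricityConstant c * min (Real.log n / ε) (Real.log Δ / ε ^ 2) ≤ a)
    (hV : Nat.card V ≤ n) (ha : N.graph.arboricity ≤ a) (hdeg : ∀ v, N.graph.multiDegree v ≤ Δ)
    (hid : ∀ v, N.id v < n ^ d) (hφ : N.graph.IsForestDecomposition k φ) :
    prob (fun lab : V → StageTwoLabel a k ε => ¬ N.GoodColoring (k + ⌈ε * a⌉₊)
      (4 * blockLength ε) (N.stageTwo n a k d c ε lab φ)) ≤ 1 / (n : ℝ) ^ c := by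
  have hn2 : (2 : ℝ) ≤ n := by exact_mod_cast hn
  have hn0 : (0 : ℝ) < n := by linarith
  refine (prob_prod_le (p₁ := 1 / (n : ℝ) ^ (c + 1)) (p₂ := 1 / (n : ℝ) ^ (c + 1)) _ _
    (prob_not_goodColoring_stageOne_le hn (by linarith : 0 < ε / 4) (by linarith) hV ha hid hφ)
    (by positivity) fun lab₁ h₁ => ?_).trans ?_
  · have hψ := not_not.1 h₁
    set ψ := N.stageOne n a k d (c + 1) (ε / 4) lab₁ φ
    obtain ⟨D, hD, hball, hp⟩ := exists_ball_bound hn hΔ hε hε' h hV hdeg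
    have hs : n ≤ D ^ (Nat.log 2 n + 1) := (Nat.lt_pow_succ_log_self (by norm_num) n).le.trans
      (Nat.pow_le_pow_left hD _)
    obtain ⟨h1, h2, h3⟩ := chain_bound_le hn hD hs (Real.exp_pos _).le hp hV
    set L := stageRadius n (c + 1) (ε / 4)
    set K := k + ⌈ε / 4 * a⌉₊ with hK
    have hanc : ∀ v c, N.ancestor ψ L K (blockLength ε) v c ∈
        N.baseGraph.closedBall (blockLength ε) v := ancestor_mem_closedBall
    have hover : ∀ v, prob (fun ω : V → Fin K → Fin (blockLength ε) =>
        Overloaded (N.level ψ L K (blockLength ε)) (N.ancestor ψ L K (blockLength ε))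
          ⌊ε * a / 64⌋₊ ω v) ≤ Real.exp (-(⌊ε * a / 64⌋₊ / 4)) := fun v =>
      prob_lt_ncard_hits_le_exp (dyadicAbove_pos _) _ _ _
        (four_mul_colors_le hε hε' (large_of_min_le hn hΔ hε hε' h) hk)
    obtain ⟨ω₀, h₀⟩ := exists_not_overloaded hanc hball hover h2 h3
    have hfar := prob_not_diamLE_le (s := Nat.log 2 n + 1) hanc hball hover
    refine le_trans ?_ (hfar.trans ?_)
    · refine prob_mono fun ω hω hs => hω ?_
      have hgood := goodColoring_treeCutColoring hψ
        (fun v => (hid v).trans_le (pow_le_two_pow n d)) h₀ hs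
      refine hgood.mono ?_ le_rfl
      have := colors_le (a := a) hε
      omega
    · refine h1.trans (one_div_le_one_div_of_le (pow_pos hn0 _) ?_)
      exact pow_le_pow_right₀ (by linarith) (by omega)
  · rw [pow_succ]
    have : 1 / ((n : ℝ) ^ c * n) ≤ 1 / (n : ℝ) ^ c / 2 := by
      rw [div_div]
      gcongr
    linarith

theorem stageTwo_local (n a k d c : ℕ) (ε : ℝ) :
    EdgeLocal (Nat.log 2 n + 2 + stageRadius n (c + 1) (ε / 4) + d * (Nat.log 2 n + 1) + 6 +
      stageRadius n (c + 1) (ε / 4) + 1 + blockLength ε +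
      (2 * (Nat.log 2 n + 1) + 1) * (2 * blockLength ε) +
      2 * (Nat.log 2 n + 1) * (2 * blockLength ε) + blockLength ε + d * (Nat.log 2 n + 1) + 3)
      (fun I : Inst (StageTwoLabel a k ε) => I.N.stageTwo n a k d c ε I.ω I.φ) := by
  have : Inhabited (StageTwoLabel a k ε) := ⟨((true, 0), 0)⟩
  have h : VertexLocal 0 (fun (I : Inst (StageTwoLabel a k ε)) v => I.ω v) := VertexLocal.label
  exact treeCutColoring_local (stageOne_local n a k d (c + 1) (ε / 4) (h.map Prod.fst))
    (h.map Prod.snd) _ _ _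

variable (N) in
/-- The coloring by star forests that does not use the input coloring. -/
noncomputable def starColoring (n a d : ℕ) (e : E) : ℕ :=
  (N.chargeColor (N.Owns (4 * a) (Nat.log 2 n + 1)) (d * (Nat.log 2 n + 1)) e).getD 0

theorem exclusiveCharge_owns (t m : ℕ) : N.ExclusiveCharge (N.Owns t m) :=
  fun _ _ he h h' => (N.owns_neighbor_iff he).1 h' h

/-- Every edge is owned by an endpoint and every vertex owns at most 4a edges, hence 8 · 4a stars.
-/
theorem goodColoring_starColoring [Finite V] [Finite E] {n a k d : ℕ} {φ : E → ℕ}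
    (hV : Nat.card V ≤ n) (ha : N.graph.arboricity ≤ a) (hid : ∀ v, N.id v < n ^ d)
    (hφ : N.graph.IsForestDecomposition k φ) :
    N.GoodColoring (32 * a) 2 (N.starColoring n a d) := by
  have hid' := fun v => (hid v).trans_le (pow_le_two_pow n d)
  have hsome : ∀ e ∈ N.graph.edgeSet, ∃ q,
      N.chargeColor (N.Owns (4 * a) (Nat.log 2 n + 1)) (d * (Nat.log 2 n + 1)) e = some q := by
    intro e he
    obtain ⟨v, w, hvw⟩ := Graph.exists_isLink_of_mem_edgeSet he
    refine Option.ne_none_iff_exists'.1 fun hnone => ?_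
    have h1 := chargeValue_eq_none.1 hnone
    have h2 := h1 v hvw.inc_left
    exact h1 _ (N.inc_neighbor hvw.inc_left) ((N.owns_neighbor_iff hvw.inc_left).2 h2)
  have hiff : ∀ c, ∀ e ∈ N.graph.edgeSet, N.starColoring n a d e = c ↔
      N.chargeColor (N.Owns (4 * a) (Nat.log 2 n + 1)) (d * (Nat.log 2 n + 1)) e = some c := by
    intro c e he
    obtain ⟨q, hq⟩ := hsome e he
    simp [starColoring, hq]
  refine ⟨fun e he => ?_, fun c => ?_⟩
  · have := chargeColor_lt hid' (N.ncard_owns_le hV ha hφ) ((hiff _ e he).1 rfl)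
    omega
  · obtain ⟨h1, h2⟩ := forestClass_chargeColor (exclusiveCharge_owns (N := N) (4 * a)
      (Nat.log 2 n + 1)) hid' c
    refine ⟨h1.anti fun e he => (hiff c e he).1, ?_⟩
    rwa [colorGraph_congr (hiff c)]

theorem starColoring_local (n a d : ℕ) :
    EdgeLocal (Nat.log 2 n + 2 + d * (Nat.log 2 n + 1) + 2)
      (fun I : Inst Ω => I.N.starColoring n a d) :=
  DartLocal.map (chargeColor_local (fun _ => exclusiveCharge_owns _ _) (owns_local _ _) _)
    fun o => o.getD 0

theorem GoodColoring.goodOutput {I : Inst Ω} {k D : ℕ} {ψ : I.E → ℕ} {D' : ℝ}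
    (h : I.N.GoodColoring k D ψ) (hD : (D : ℝ) ≤ D') : LocalAlgorithm.GoodOutput I ψ k D' :=
  ⟨⟨h.1, fun c => forestClass_iff.1 (h.2 c).1⟩,
    decompositionDiameterLE_of_diamLE (fun c => (h.2 c).2) hD⟩

/-- A graph of maximum degree at most one has diameter at most one. -/
theorem diamLE_one_of_multiDegree_le [Finite E] (hdeg : ∀ v, N.graph.multiDegree v ≤ 1)
    {ψ : E → ℕ} {c : ℕ} : (N.colorGraph ψ c).DiamLE 1 := by
  have huniq : ∀ u v w, (N.colorGraph ψ c).Adj u v → (N.colorGraph ψ c).Adj u w → v = w := by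
    rintro u v w ⟨e, he, _⟩ ⟨f, hf, _⟩
    have h1 := (Set.ncard_le_one (Set.toFinite _)).1 (hdeg u) e he.inc_left f hf.inc_left
    subst h1
    exact he.right_unique hf
  rintro u v ⟨p⟩
  induction p with
  | nil => exact SimpleGraph.mem_closedBall_self _ _
  | @cons u v w h p ih =>
    rcases SimpleGraph.mem_closedBall_succ.1 ih with rfl | ⟨x, hx, hw⟩
    · exact ⟨h.toWalk, le_rfl⟩
    · rw [SimpleGraph.closedBall_zero, Set.mem_singleton_iff] at hw
      subst hw
      rw [huniq v _ u hx h.symm]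
      exact SimpleGraph.mem_closedBall_self _ _

end PortNetwork

/-- M and R were rounded up to powers of two so that labels correspond exactly to bit strings. -/
theorem exists_card_stageTwoLabel (a k : ℕ) (ε : ℝ) :
    ∃ b, Nat.card (PortNetwork.StageTwoLabel a k ε) = 2 ^ b := by
  refine ⟨1 + Nat.clog 2 ⌈8 / (ε / 4)⌉₊ + Nat.clog 2 ⌈17408 / ε⌉₊ * (k + ⌈ε / 4 * a⌉₊), ?_⟩
  unfold PortNetwork.StageTwoLabel PortNetwork.StageOneLabel
  unfold blockLength dyadicAbove
  rw [Nat.card_prod, Nat.card_prod, Nat.card_fun, Nat.card_fin, Nat.card_fin, Nat.card_fin]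
  simp only [Nat.card_eq_fintype_card, Fintype.card_bool]
  ring

namespace LocalAlgorithm

/-- A default algorithm for parameters outside the stated range. -/
instance : Nonempty LocalAlgorithm :=
  ⟨⟨Unit, Unit, 0, 0, fun _ => (), fun _ _ => (), fun _ _ => (), fun _ _ => 0⟩⟩

theorem exists_of_goodColoring [Finite Ω] {b r : ℕ} (hΩ : Nat.card Ω = 2 ^ b)
    {out : (I : Inst Ω) → I.E → ℕ} (hout : EdgeLocal r out) {n a Δ k d c k' D' : ℕ} {D : ℝ}
    (hD : (D' : ℝ) ≤ D)
    (h : ∀ (V E : Type) [hV : Finite V] [hE : Finite E] (N : PortNetwork V E) (φ : E → ℕ),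
      Nat.card V ≤ n → N.graph.arboricity ≤ a → (∀ v, N.graph.multiDegree v ≤ Δ) →
      (∀ v, N.id v < n ^ d) → N.graph.IsForestDecomposition k φ →
      prob (fun ω : V → Ω => ¬ N.GoodColoring k' D' (out ⟨V, E, hV, hE, N, φ, ω⟩)) ≤
        1 / (n : ℝ) ^ c) :
    ∃ A : LocalAlgorithm, A.rounds = r ∧ A.ConvertsForestDecompositions n a Δ k d c k' D := by
  refine exists_of_edgeLocal hΩ hout n a Δ k d c k' D fun V E hV hE N φ h1 h2 h3 h4 h5 => ?_
  refine rareFailure_of_prob_le ((prob_mono fun ω hω hgood => hω ?_).trans (h V E N φ h1 h2 h3 h4 h5))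
  exact PortNetwork.GoodColoring.goodOutput (I := ⟨V, E, hV, hE, N, φ, ω⟩) hgood hD

/-- If the diameter is small anyway, the input coloring can be the output. -/
theorem exists_of_diamLE {n a Δ k d c k' D' : ℕ} {D : ℝ} (hk : k ≤ k') (hD : (D' : ℝ) ≤ D)
    (h : ∀ (V E : Type) [Finite V] [Finite E] (N : PortNetwork V E) (φ : E → ℕ),
      Nat.card V ≤ n → (∀ v, N.graph.multiDegree v ≤ Δ) → ∀ q, (N.colorGraph φ q).DiamLE D') :
    ∃ A : LocalAlgorithm, A.rounds = 0 ∧ A.ConvertsForestDecompositions n a Δ k d c k' D := by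
  refine exists_of_goodColoring (Ω := Unit) (b := 0) (by simp) DartLocal.input hD
    fun V E hV hE N φ h1 h2 h3 h4 h5 => ?_
  refine (prob_eq_zero fun ω hω => hω ?_).trans_le (by positivity)
  exact ⟨fun e he => (h5.1 e he).trans_le hk,
    fun q => ⟨PortNetwork.forestClass_iff.2 (h5.2 q), h V E N φ h1 h3 q⟩⟩

theorem diamLE_zero_of_card_le {V : Type*} [Finite V] (hV : Nat.card V ≤ 1) (H : SimpleGraph V) :
    H.DiamLE 0 := by
  have := (Finite.card_le_one_iff_subsingleton).1 hV
  intro u v _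
  rw [Subsingleton.elim v u]
  exact SimpleGraph.mem_closedBall_self _ _

theorem exists_logarithmic_diameter (n a Δ k d c : ℕ) {ε : ℝ} (hε : 0 < ε) (hε' : ε < 1 / 2) :
    ∃ A : LocalAlgorithm, (A.rounds : ℝ) ≤ (136 * c + 2 * d + 1400) * (Real.log n / ε) ∧
      A.ConvertsForestDecompositions n a Δ k d c (k + ⌈ε * a⌉₊)
        ((136 * c + 2 * d + 1400) * (Real.log n / ε)) := by
  rcases lt_or_ge n 2 with hn | hn
  · have hX : 0 ≤ (136 * (c : ℝ) + 2 * d + 1400) * (Real.log n / ε) := by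
      have := Real.log_natCast_nonneg n
      positivity
    obtain ⟨A, h1, h2⟩ := exists_of_diamLE (n := n) (a := a) (Δ := Δ) (d := d) (c := c)
      (D' := 0) (D := (136 * c + 2 * d + 1400) * (Real.log n / ε))
      (Nat.le_add_right k ⌈ε * a⌉₊) (by exact_mod_cast hX) fun V E _ _ N φ hV _ q =>
        diamLE_zero_of_card_le (by omega) _
    exact ⟨A, by rw [h1]; exact_mod_cast hX, h2⟩
  · have hX := one_le_log_div hn hε hε'
    have hl := natLog_le hn hε hε'
    have hr := stageRadius_le hn c hε hε'
    have hd : (0 : ℝ) ≤ d := by positivity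
    have : Inhabited (PortNetwork.StageOneLabel ε) := ⟨(true, 0)⟩
    obtain ⟨A, h1, h2⟩ := exists_of_goodColoring (Ω := PortNetwork.StageOneLabel ε)
      (b := 1 + Nat.clog 2 ⌈8 / ε⌉₊) (n := n) (a := a) (Δ := Δ) (k := k) (d := d) (c := c)
      (k' := k + ⌈ε * a⌉₊) (D := (136 * c + 2 * d + 1400) * (Real.log n / ε)) (by
        unfold PortNetwork.StageOneLabel dyadicAbove
        rw [Nat.card_prod, Nat.card_fin, Nat.card_eq_fintype_card, Fintype.card_bool, pow_add,
          pow_one])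
      (PortNetwork.stageOne_local n a k d c ε VertexLocal.label) (D' := stageRadius n c ε)
      (by nlinarith) fun V E _ _ N φ g1 g2 _ g4 g5 =>
        PortNetwork.prob_not_goodColoring_stageOne_le hn hε hε' g1 g2 g4 g5
    refine ⟨A, ?_, h2⟩
    rw [h1]
    push_cast
    nlinarith

theorem log_two_mul_le {n : ℕ} (hn : 2 ≤ n) : (Nat.log 2 n + 1 : ℝ) ≤ 4 * Real.log n := by
  have h1 : (Nat.log 2 n : ℝ) * Real.log 2 ≤ Real.log n := by
    rw [← Real.log_pow]
    refine Real.log_le_log (by positivity) ?_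
    exact_mod_cast Nat.pow_log_le_self 2 (by omega)
  have h2 := Real.log_two_gt_d9
  have h3 : (0 : ℝ) ≤ Nat.log 2 n := by positivity
  have h4 := log_two_le_log hn
  nlinarith

/-- For n < 2 or Δ < 2 the input has diameter at most 1 and is returned; this also avoids vanishing
logarithms. For k ≥ 32a the star coloring is within the budget. In the remaining case k < 32a keeps
the expected load K/R of order εa, and the two-stage algorithm applies. -/
theorem exists_constant_diameter (n a Δ k d c : ℕ) {ε : ℝ} (hε : 0 < ε) (hε' : ε < 1 / 2)
    (h : arboricityConstant c * min (Real.log n / ε) (Real.log Δ / ε ^ 2) ≤ a) :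
    ∃ A : LocalAlgorithm, (A.rounds : ℝ) ≤ (1088 * c + 4 * d + 2000000) * (Real.log n / ε) ∧
      A.ConvertsForestDecompositions n a Δ k d c (k + ⌈ε * a⌉₊)
        ((1088 * c + 4 * d + 2000000) * (1 / ε)) := by
  have hc0 : (0 : ℝ) ≤ c := by positivity
  have hd0 : (0 : ℝ) ≤ d := by positivity
  have hC : 2000000 ≤ 1088 * (c : ℝ) + 4 * d + 2000000 := by linarith
  have hε1 : 2 ≤ 1 / ε := by rw [le_div_iff₀ hε]; linarith
  have hlog := Real.log_natCast_nonneg n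
  have hX0 : 0 ≤ (1088 * (c : ℝ) + 4 * d + 2000000) * (Real.log n / ε) := by positivity
  have hD2 : ((2 : ℕ) : ℝ) ≤ (1088 * (c : ℝ) + 4 * d + 2000000) * (1 / ε) := by
    push_cast
    nlinarith
  rcases lt_or_ge n 2 with hn | hn
  · obtain ⟨A, h1, h2⟩ := exists_of_diamLE (n := n) (a := a) (Δ := Δ) (d := d) (c := c)
      (Nat.le_add_right k ⌈ε * a⌉₊) hD2 fun V E _ _ N φ hV _ q =>
        (diamLE_zero_of_card_le (by omega) _).mono (by omega)
    exact ⟨A, by rw [h1]; exact_mod_cast hX0, h2⟩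
  rcases lt_or_ge Δ 2 with hΔ | hΔ
  · obtain ⟨A, h1, h2⟩ := exists_of_diamLE (n := n) (a := a) (Δ := Δ) (d := d) (c := c)
      (Nat.le_add_right k ⌈ε * a⌉₊) hD2 fun V E _ _ N φ _ hdeg q =>
        (N.diamLE_one_of_multiDegree_le fun v => (hdeg v).trans (by omega)).mono (by omega)
    exact ⟨A, by rw [h1]; exact_mod_cast hX0, h2⟩
  have hX := one_le_log_div hn hε hε'
  have hl := natLog_le hn hε hε'
  rcases lt_or_ge k (32 * a) with hk | hk
  · have hr := stageRadius_le hn (c + 1) (by linarith : 0 < ε / 4) (by linarith)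
    have hr' : (stageRadius n (c + 1) (ε / 4) : ℝ) ≤ (544 * c + 6000) * (Real.log n / ε) := by
      refine hr.trans (le_of_eq_of_le ?_ (mul_le_mul_of_nonneg_right
        (by linarith : 544 * (c : ℝ) + 5988 ≤ _) (by positivity)))
      push_cast
      field_simp
      ring
    have hB := blockLength_le hε hε'
    have hBl : (blockLength ε : ℝ) * (Nat.log 2 n + 1) ≤ 139268 * (Real.log n / ε) := by
      calc (blockLength ε : ℝ) * (Nat.log 2 n + 1) ≤ 34817 / ε * (4 * Real.log n) := by
            gcongr
            exact log_two_mul_le hn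
        _ = 139268 * (Real.log n / ε) := by ring
    have hB1 : (blockLength ε : ℝ) ≤ blockLength ε * (Nat.log 2 n + 1) :=
      le_mul_of_one_le_right (by positivity) (by norm_num)
    obtain ⟨b, hb⟩ := exists_card_stageTwoLabel a k ε
    obtain ⟨A, h1, h2⟩ := exists_of_goodColoring hb (n := n) (a := a) (Δ := Δ) (k := k) (d := d)
      (c := c) (k' := k + ⌈ε * a⌉₊) (D := (1088 * c + 4 * d + 2000000) * (1 / ε))
      (PortNetwork.stageTwo_local n a k d c ε) (D' := 4 * blockLength ε)
      (by
        push_cast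
        rw [mul_one_div]
        calc (4 : ℝ) * blockLength ε ≤ 4 * (34817 / ε) := by gcongr
          _ = 139268 / ε := by ring
          _ ≤ _ := by gcongr; linarith)
      fun V E _ _ N φ g1 g2 g3 g4 g5 =>
        PortNetwork.prob_not_goodColoring_stageTwo_le hn hΔ hε hε' hk h g1 g2 g3 g4 g5
    refine ⟨A, ?_, h2⟩
    rw [h1]
    have hdl : (d : ℝ) * Nat.log 2 n ≤ d * (Real.log n / ε) := by gcongr
    have hdX : (d : ℝ) ≤ d * (Real.log n / ε) := le_mul_of_one_le_right hd0 hX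
    push_cast
    linarith
  · obtain ⟨A, h1, h2⟩ := exists_of_goodColoring (Ω := Unit) (b := 0) (by simp)
      (PortNetwork.starColoring_local n a d) (n := n) (a := a) (Δ := Δ) (k := k) (d := d) (c := c)
      (k' := k + ⌈ε * a⌉₊) hD2 fun V E _ _ N φ g1 g2 _ g4 g5 =>
        (prob_eq_zero fun ω hω => hω ((PortNetwork.goodColoring_starColoring g1 g2 g4 g5).mono
          (by omega) le_rfl)).trans_le (by positivity)
    refine ⟨A, ?_, h2⟩
    rw [h1]
    have hdl : (d : ℝ) * Nat.log 2 n ≤ d * (Real.log n / ε) := by gcongr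
    have hdX : (d : ℝ) ≤ d * (Real.log n / ε) := le_mul_of_one_le_right hd0 hX
    have hcX : 0 ≤ c * (Real.log n / ε) := by positivity
    push_cast
    nlinarith

end LocalAlgorithm
-- The main theorem
theorem mainTheorem11 (d c : ℕ) :
    (∃ C : ℝ, 0 < C ∧ ∃ A : (n a Δ k : ℕ) → (ε : ℝ) → LocalAlgorithm,
      ∀ (n a Δ k : ℕ) (ε : ℝ), 0 < ε → ε < 1 / 2 →
        ((A n a Δ k ε).rounds : ℝ) ≤ C * (Real.log n / ε) ∧
        (A n a Δ k ε).ConvertsForestDecompositions n a Δ k d c (k + ⌈ε * a⌉₊)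
          (C * (Real.log n / ε))) ∧
    (∃ K C : ℝ, 0 < K ∧ 0 < C ∧ ∃ A : (n a Δ k : ℕ) → (ε : ℝ) → LocalAlgorithm,
      ∀ (n a Δ k : ℕ) (ε : ℝ), 0 < ε → ε < 1 / 2 →
        K * min (Real.log n / ε) (Real.log Δ / ε ^ 2) ≤ a →
        ((A n a Δ k ε).rounds : ℝ) ≤ C * (Real.log n / ε) ∧
        (A n a Δ k ε).ConvertsForestDecompositions n a Δ k d c (k + ⌈ε * a⌉₊)
          (C * (1 / ε))) := by
  refine ⟨⟨136 * c + 2 * d + 1400, by positivity, ?_⟩, arboricityConstant c,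
    1088 * c + 4 * d + 2000000, by unfold arboricityConstant; positivity, by positivity, ?_⟩
  -- The constants are uniform, so one algorithm can be chosen for each tuple of parameters known to
  -- the vertices.
  · choose! A hA using fun (n a Δ k : ℕ) (ε : ℝ) (hε : 0 < ε) (hε' : ε < 1 / 2) =>
      LocalAlgorithm.exists_logarithmic_diameter n a Δ k d c hε hε'
    exact ⟨A, hA⟩
  · choose! A hA using fun (n a Δ k : ℕ) (ε : ℝ) (hε : 0 < ε) (hε' : ε < 1 / 2)
        (h : arboricityConstant c * min (Real.log n / ε) (Real.log Δ / ε ^ 2) ≤ a) =>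
      LocalAlgorithm.exists_constant_diameter n a Δ k d c hε hε' h
    exact ⟨A, hA⟩
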